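/- Let $\alpha,\beta\in\mathbf N=\{0,1,2,\dots\}$ and consider on $H=L^2(\mathbf R,\mathbf C)$ the system $$\mathrm i\,\partial_t\psi(x,t)=\big[(-\Delta+x^2)^\alpha+u(t)\,x^\beta\big]\psi(x,t),$$ that is, $\psi'=(A+u(t)B)\psi$ with $A=-\mathrm i(-\Delta+x^2)^\alpha$ on $D(A)=\{\psi\in L^2:(-\Delta+x^2)^\alpha\psi\in L^2\}$ (in the sense of tempered distributions) and $B=-\mathrm i x^\beta$ on its maximal domain. Let $\mathcal U$ be the set of functions $u:\mathbf R\to\mathbf R$ of bounded variation with $u(t)=0$ for $t\le 0$; a sequence $(u_n)$ in $\mathcal U$ converges to $u\in\mathcal U$ if $TV_{\mathbf R}(u_n)\le TV_{\mathbf R}(u)$ for all $n$ and $u_n(t)\to u(t)$ for almost every $t$. The system is called well-posed for a class $\mathcal V\subset\mathcal U$ of controls if there are unitary operators $\Upsilon^u_t$ of $H$ ($u\in\mathcal V$, $t\ge 0$) such that, for every $u\in\mathcal V$: 1. for every $\psi_0\in H$, $t\mapsto\Upsilon^u_t\psi_0$ is the unique $\psi\in C([0,\infty);H)$ with $\psi(0)=\psi_0$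 that solves the equation weakly, i.e. for every Schwartz function $\varphi$ and every $t\ge0$, $$\langle\varphi,\psi(t)\rangle=\langle\varphi,\psi_0\rangle-\mathrm i\int_0^t\Big(\langle(-\Delta+x^2)^\alpha\varphi,\psi(s)\rangle+u(s)\langle x^\beta\varphi,\psi(s)\rangle\Big)\,ds;$$ 2. if $\psi_0\in D(A)$, this solution $\psi$ is strong: $\psi(t)\in D(A)\cap D(B)$ for all $t\ge 0$, the function $(A+uB)\psi$ is locally Bochner integrable on $[0,\infty)$, and $\psi(t)=\psi_0+\int_0^t(A+u(s)B)\psi(s)\,ds$; 3. for each $T\geq 0$ there is $C$ with $\|A\Upsilon^u_t\psi_0\|+\|\Upsilon^u_t\psi_0\|\le C(\|A\psi_0\|+\|\psi_0\|)$ for all $\psi_0\in D(A)$ and $t\in[0,T]$; 4. if $u_n\in\mathcal V$ converges to $u$ in $\mathcal U$, then $\Upsilon^{u_n}_t\psi_0\to\Upsilon^u_t\psi_0$ in $H$ for all $\psi_0\in H$ and $t\ge0$. Then: * if $2\alpha=\beta$, the system is well-posed for the class of all $u\in\mathcal U$ with $\|u\|_{L^\infty}<\sqrt{(2\beta+1)2^{-\beta}}$;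 * if $2\alpha>\beta$, the system is well-posed for the class $\mathcal U$ of all controls. -/

import Mathlib

open MeasureTheory Set Filter Topology
open scoped SchwartzMap

namespace Anharmonic

/-- The Hilbert space `L²(ℝ, ℂ)`. -/
abbrev L2 : Type := Lp ℂ 2 (volume : Measure ℝ)

/-- A Schwartz function, seen in `L²(ℝ, ℂ)`. -/
noncomputable abbrev emb (φ : 𝓢(ℝ, ℂ)) : L2 := φ.toLp 2 volume

/-- Multiplication by `x ^ k` on Schwartz functions. -/
noncomputable def mulX (k : ℕ) : 𝓢(ℝ, ℂ) →L[ℂ] 𝓢(ℝ, ℂ) :=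
  SchwartzMap.smulLeftCLM ℂ (fun x : ℝ => (x : ℂ) ^ k)

/-- The harmonic oscillator `-Δ + x²` on Schwartz functions. -/
noncomputable def osc : 𝓢(ℝ, ℂ) →L[ℂ] 𝓢(ℝ, ℂ) :=
  -(SchwartzMap.derivCLM ℂ ℂ ∘L SchwartzMap.derivCLM ℂ ℂ) + mulX 2

theorem mulX_apply (k : ℕ) (φ : 𝓢(ℝ, ℂ)) (x : ℝ) : mulX k φ x = (x : ℂ) ^ k * φ x := by
  have h : Function.HasTemperateGrowth (fun x : ℝ => (x : ℂ) ^ k) :=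
    Function.HasTemperateGrowth.pow Function.Complex.hasTemperateGrowth_ofReal k
  simp [mulX, SchwartzMap.smulLeftCLM_apply_apply h]

theorem osc_apply (φ : 𝓢(ℝ, ℂ)) (x : ℝ) :
    osc φ x = -deriv (deriv φ) x + (x : ℂ) ^ 2 * φ x := by
  have h : (SchwartzMap.derivCLM ℂ ℂ φ : ℝ → ℂ) = deriv φ := by
    ext y; simp
  have h2 : osc φ x = -(SchwartzMap.derivCLM ℂ ℂ (SchwartzMap.derivCLM ℂ ℂ φ) x)
      + mulX 2 φ x := rfl
  rw [h2, mulX_apply, SchwartzMap.derivCLM_apply, h]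

/-- The power `(-Δ + x²) ^ α` on Schwartz functions. -/
noncomputable abbrev oscS (α : ℕ) : 𝓢(ℝ, ℂ) →L[ℂ] 𝓢(ℝ, ℂ) := osc ^ α

/-- Pairs `(ψ, f)` of square integrable functions such that `(-Δ + x²) ^ α ψ = f` in the sense of
tempered distributions. -/
noncomputable def oscGraph (α : ℕ) : Submodule ℂ (L2 × L2) where
  carrier := {p | ∀ φ : 𝓢(ℝ, ℂ), inner ℂ (emb (oscS α φ)) p.1 = inner ℂ (emb φ) p.2}
  add_mem' := by
    intro p q hp hq φ
    simp only [mem_ofPred_eq] at hp hq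
    simp only [Prod.fst_add, Prod.snd_add, inner_add_right, hp φ, hq φ]
  zero_mem' := by
    intro φ
    simp only [Prod.fst_zero, Prod.snd_zero, inner_zero_right]
  smul_mem' := by
    intro c p hp φ
    simp only [mem_ofPred_eq] at hp
    simp only [Prod.smul_fst, Prod.smul_snd, inner_smul_right, hp φ]

/-- Pairs `(ψ, f)` of square integrable functions such that `f = x ^ β ψ`. -/
noncomputable def mulGraph (β : ℕ) : Submodule ℂ (L2 × L2) where
  carrier := {p | ∀ᵐ x : ℝ, p.2 x = (x : ℂ) ^ β * p.1 x}
  add_mem' := by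
    intro p q hp hq
    simp only [mem_ofPred_eq] at hp hq ⊢
    filter_upwards [hp, hq, Lp.coeFn_add p.1 q.1, Lp.coeFn_add p.2 q.2] with x h1 h2 h3 h4
    simp only [Prod.fst_add, Prod.snd_add]
    rw [h3, h4, Pi.add_apply, Pi.add_apply, h1, h2]
    ring
  zero_mem' := by
    simp only [mem_ofPred_eq, Prod.fst_zero, Prod.snd_zero]
    filter_upwards [Lp.coeFn_zero ℂ 2 (volume : Measure ℝ)] with x h
    rw [h]; simp
  smul_mem' := by
    intro c p hp
    simp only [mem_ofPred_eq] at hp ⊢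
    filter_upwards [hp, Lp.coeFn_smul c p.1, Lp.coeFn_smul c p.2] with x h1 h3 h4
    simp only [Prod.smul_fst, Prod.smul_snd]
    rw [h3, h4, Pi.smul_apply, Pi.smul_apply, h1]
    simp only [smul_eq_mul]
    ring

theorem oscGraph_single (α : ℕ) (p : L2 × L2) (hp : p ∈ oscGraph α) (h0 : p.1 = 0) :
    p.2 = 0 := by
  have h : ∀ φ : 𝓢(ℝ, ℂ), inner ℂ (emb φ) p.2 = 0 := by
    intro φ
    rw [← hp φ, h0, inner_zero_right]
  have hd : DenseRange (SchwartzMap.toLpCLM ℂ ℂ 2 (volume : Measure ℝ)) :=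
    SchwartzMap.denseRange_toLpCLM (by simp)
  have hall : ∀ g : L2, inner ℂ g p.2 = (0 : ℂ) := by
    intro g
    refine hd.induction_on (p := fun g : L2 => inner ℂ g p.2 = (0 : ℂ)) g ?_ ?_
    · exact isClosed_eq (by fun_prop) continuous_const
    · intro φ; exact h φ
  exact inner_self_eq_zero.mp (hall p.2)

theorem mulGraph_single (β : ℕ) (p : L2 × L2) (hp : p ∈ mulGraph β) (h0 : p.1 = 0) :
    p.2 = 0 := by
  have hp' : ∀ᵐ x : ℝ, p.2 x = (x : ℂ) ^ β * p.1 x := hp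
  rw [Lp.eq_zero_iff_ae_eq_zero]
  filter_upwards [hp', (Lp.eq_zero_iff_ae_eq_zero).mp h0] with x h1 h2
  rw [h1, h2]; simp

/-- The self-adjoint operator `(-Δ + x²) ^ α` in `L²(ℝ, ℂ)`; its domain consists of all `ψ ∈ L²`
such that the tempered distribution `(-Δ + x²) ^ α ψ` is in `L²`. -/
noncomputable def oscPow (α : ℕ) : L2 →ₗ.[ℂ] L2 := (oscGraph α).toLinearPMap

/-- The multiplication operator by `x ^ β` in `L²(ℝ, ℂ)`, with maximal domain. -/
noncomputable def mulPow (β : ℕ) : L2 →ₗ.[ℂ] L2 := (mulGraph β).toLinearPMap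

theorem oscPow_graph (α : ℕ) : (oscPow α).graph = oscGraph α :=
  (oscGraph α).toLinearPMap_graph_eq (oscGraph_single α)

theorem mulPow_graph (β : ℕ) : (mulPow β).graph = mulGraph β :=
  (mulGraph β).toLinearPMap_graph_eq (mulGraph_single β)

/-- `A = -i (-Δ + x²) ^ α`. -/
noncomputable def opA (α : ℕ) : L2 →ₗ.[ℂ] L2 := (-Complex.I) • oscPow α

/-- `B = -i x ^ β`. -/
noncomputable def opB (β : ℕ) : L2 →ₗ.[ℂ] L2 := (-Complex.I) • mulPow β

/-- The set `𝒰` of the controls: functions of bounded variation on `ℝ` that vanish on `(-∞, 0]`. -/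
def controls : Set (ℝ → ℝ) := {u | BoundedVariationOn u univ ∧ ∀ t ≤ 0, u t = 0}

/-- Convergence of a sequence of controls in `𝒰`. -/
def ControlTendsto (v : ℕ → ℝ → ℝ) (u : ℝ → ℝ) : Prop :=
  (∀ n, eVariationOn (v n) univ ≤ eVariationOn u univ) ∧
    ∀ᵐ t : ℝ, Tendsto (fun n => v n t) atTop (𝓝 (u t))

/-- `ψ ∈ C([0, ∞), L²)` has initial value `ψ₀` and solves
`i ∂ψ/∂t = ((-Δ + x²) ^ α + u(t) x ^ β) ψ` weakly, that is, tested against every Schwartz function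
of the space variable and integrated in time. -/
def IsWeakSolution (α β : ℕ) (u : ℝ → ℝ) (ψ₀ : L2) (ψ : ℝ → L2) : Prop :=
  ContinuousOn ψ (Ici 0) ∧ ψ 0 = ψ₀ ∧
    ∀ φ : 𝓢(ℝ, ℂ), ∀ t : ℝ, 0 ≤ t →
      inner ℂ (emb φ) (ψ t) = inner ℂ (emb φ) ψ₀ +
        ∫ s in (0 : ℝ)..t, (-Complex.I) *
          (inner ℂ (emb (oscS α φ)) (ψ s) + (u s : ℂ) * inner ℂ (emb (mulX β φ)) (ψ s))

/-- `ψ` is a strong solution of `dψ/dt = (A + u(t) B) ψ` on `[0, ∞)` with `ψ(0) = ψ₀`: it is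
continuous, has values in `D(A) ∩ D(B)`, and is the primitive of the locally (Bochner) integrable
function `(A + u B) ψ`. Here `f = A ψ` and `g = B ψ`. -/
def IsStrongSolution (α β : ℕ) (u : ℝ → ℝ) (ψ₀ : L2) (ψ : ℝ → L2) : Prop :=
  ContinuousOn ψ (Ici 0) ∧ ψ 0 = ψ₀ ∧
    ∃ f g : ℝ → L2,
      (∀ s : ℝ, 0 ≤ s → (ψ s, f s) ∈ (opA α).graph ∧ (ψ s, g s) ∈ (opB β).graph) ∧
      ∀ t : ℝ, 0 ≤ t →
        IntervalIntegrable (fun s => f s + (u s : ℂ) • g s) volume 0 t ∧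
        ψ t = ψ₀ + ∫ s in (0 : ℝ)..t, (f s + (u s : ℂ) • g s)

/-- Well-posedness of the controlled oscillator for the controls of a class `𝒱 ⊆ 𝒰`: there are
unitary propagators `Υ u t = Υ^u_{t,0}` which give the unique solution for every initial state,
which act continuously on `D(A)` and give strong solutions there, and which depend
continuously on the control. -/
def WellPosed (α β : ℕ) (𝒱 : Set (ℝ → ℝ)) : Prop :=
  ∃ Υ : (ℝ → ℝ) → ℝ → (L2 ≃ₗᵢ[ℂ] L2),
    (∀ u ∈ 𝒱,
      (∀ ψ₀ : L2, IsWeakSolution α β u ψ₀ (fun t => Υ u t ψ₀)) ∧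
      (∀ (ψ₀ : L2) (ψ : ℝ → L2), IsWeakSolution α β u ψ₀ ψ → ∀ t : ℝ, 0 ≤ t → ψ t = Υ u t ψ₀) ∧
      (∀ ψ₀ ∈ (opA α).domain, IsStrongSolution α β u ψ₀ (fun t => Υ u t ψ₀)) ∧
      (∀ T : ℝ, ∃ C : ℝ, ∀ t ∈ Icc 0 T, ∀ ψ₀ : (opA α).domain,
        ∃ h : Υ u t (ψ₀ : L2) ∈ (opA α).domain,
          ‖opA α ⟨Υ u t (ψ₀ : L2), h⟩‖ + ‖Υ u t (ψ₀ : L2)‖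
            ≤ C * (‖opA α ψ₀‖ + ‖(ψ₀ : L2)‖))) ∧
    (∀ u ∈ 𝒱, ∀ v : ℕ → ℝ → ℝ, (∀ n, v n ∈ 𝒱) → ControlTendsto v u →
      ∀ (ψ₀ : L2) (t : ℝ), 0 ≤ t → Tendsto (fun n => Υ (v n) t ψ₀) atTop (𝓝 (Υ u t ψ₀)))

end Anharmonic

namespace Anharmonic

/-! ### The Gaussian as a Schwartz function -/

/-! In the Hermite basis the operator H = (-Δ + x²)^α is diagonal with eigenvalues (2k+1)^α, while x
couples only neighbouring modes, with weights of size √k. Counting these weights gives ‖x^β φ‖² ≤ ∑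
(2k+2β)^β |c_k|², to be compared with ‖Hφ‖² = ∑ (2k+1)^(2α) |c_k|². Hence x^β is bounded relative to
H: with arbitrarily small relative bound if β < 2α, and with any relative bound a > 1 if β = 2α. The
evolution problem is then solved for an abstract `DiagModel`.

The control is replaced by step functions on a mesh 1/(n+1), and the Hamiltonian by its compression
to the first n modes, so that propagators are finite products of exponentials of bounded
self-adjoint operators. Suppose that they are bounded in the graph norm ‖H·‖, uniformly in n
(`Stable`). Pair a Galerkin trajectory y with a weak solution z, or with a Galerkin trajectory of
higher order. By symmetry everything cancels in the derivative of ⟨y, z⟩ except the difference of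
the controls and the coupling of low modes to high modes (`norm_inner_galProp_sub_le`). Between
vectors of equal norm, inner products control distances. So this one estimate yields the convergence
of the approximations and of their inverses (`exists_isLimit`), the uniqueness of weak solutions
(`IsLimit.unique`) and the continuity in the control (`IsLimit.tendsto_of_control`). The weak
equation and the graph norm bounds pass to the limit, and a weak solution bounded in the domain is
strong.

Stability has two sources. If x^β has relative bound a with aM < 1, then ‖(H + w x^β)ψ‖ + Mb‖ψ‖ is
equivalent to the graph norm, is conserved while w is constant, and changes by at most a factor
exp(K'|Δw|) at each jump; the product of the factors is controlled by the total variation. This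
covers β < 2α for every M, and β = 2α for M < 1. The threshold √((2β+1)2^(-β)) is at most 3/4 for β
≥ 4, but it equals 1 for β = 0 and √5/2 for β = 2. In these two cases the commutator of H and x^β
vanishes or is bounded relative to H, and a Grönwall estimate of ‖Hψ‖² works for every M. -/

theorem exists_abs_pow_mul_gaussian_le (k : ℕ) :
    ∃ C : ℝ, ∀ x : ℝ, |x| ^ k * Real.exp (-(x ^ 2 / 2)) ≤ C := by
  -- Bound |x|^k by 1 + (x²)^k, and (x²)^k by one term of the exponential series of x²/2.
  refine ⟨1 + 2 ^ k * k.factorial, fun x => ?_⟩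
  have h1 : |x| ^ k ≤ 1 + (x ^ 2) ^ k := by
    rcases le_total |x| 1 with h | h
    · have := pow_le_one₀ (n := k) (abs_nonneg x) h
      have : 0 ≤ (x ^ 2) ^ k := by positivity
      linarith
    · have : |x| ^ k ≤ |x| ^ (2 * k) := pow_le_pow_right₀ h (by omega)
      rw [pow_mul, sq_abs] at this
      linarith
  have h2 := Real.pow_div_factorial_le_exp (x ^ 2 / 2) (by positivity) k
  have h3 : (x ^ 2) ^ k ≤ 2 ^ k * k.factorial * Real.exp (x ^ 2 / 2) := by
    rw [div_pow, div_div, div_le_iff₀ (by positivity)] at h2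
    linarith
  have h4 : 1 ≤ Real.exp (x ^ 2 / 2) := Real.one_le_exp (by positivity)
  rw [Real.exp_neg, ← div_eq_mul_inv, div_le_iff₀ (Real.exp_pos _)]
  nlinarith

theorem exists_abs_aeval_mul_gaussian_le (p : Polynomial ℤ) (k : ℕ) :
    ∃ C : ℝ, ∀ x : ℝ, |x| ^ k * |Polynomial.aeval x p * Real.exp (-(x ^ 2 / 2))| ≤ C := by
  choose C hC using exists_abs_pow_mul_gaussian_le
  refine ⟨∑ i ∈ Finset.range (p.natDegree + 1), |(p.coeff i : ℝ)| * C (k + i), fun x => ?_⟩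
  rw [Polynomial.aeval_eq_sum_range, abs_mul, abs_of_pos (Real.exp_pos _)]
  calc |x| ^ k * (|∑ i ∈ Finset.range (p.natDegree + 1), p.coeff i • x ^ i|
          * Real.exp (-(x ^ 2 / 2)))
      ≤ |x| ^ k * ((∑ i ∈ Finset.range (p.natDegree + 1), |p.coeff i • x ^ i|)
          * Real.exp (-(x ^ 2 / 2))) := by
        gcongr
        exact Finset.abs_sum_le_sum_abs _ _
    _ = ∑ i ∈ Finset.range (p.natDegree + 1), |(p.coeff i : ℝ)| *
          (|x| ^ (k + i) * Real.exp (-(x ^ 2 / 2))) := by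
        rw [Finset.sum_mul, Finset.mul_sum]
        refine Finset.sum_congr rfl fun i _ => ?_
        rw [zsmul_eq_mul, abs_mul, abs_pow, pow_add]
        ring
    _ ≤ _ := by
        gcongr with i
        exact hC _ x

/-- The real function `exp (-x² / 2)` as a Schwartz function. -/
noncomputable def gaussianReal : 𝓢(ℝ, ℝ) where
  toFun x := Real.exp (-(x ^ 2 / 2))
  smooth' := by fun_prop
  -- The n-th derivative is, up to sign, the n-th Hermite polynomial times the Gaussian.
  decay' k n := by
    obtain ⟨C, hC⟩ := exists_abs_aeval_mul_gaussian_le (Polynomial.hermite n) k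
    refine ⟨C, fun x => ?_⟩
    rw [norm_iteratedFDeriv_eq_norm_iteratedDeriv, iteratedDeriv_eq_iterate,
      Polynomial.deriv_gaussian_eq_hermite_mul_gaussian, mul_assoc, norm_mul, norm_pow, norm_neg,
      norm_one, one_pow, one_mul]
    exact hC x

/-- The complex function `exp (-x² / 2)` as a Schwartz function. -/
noncomputable def gaussianS : 𝓢(ℝ, ℂ) := gaussianReal.postcompCLM Complex.ofRealCLM

theorem gaussianS_apply (x : ℝ) : gaussianS x = (Real.exp (-(x ^ 2 / 2)) : ℂ) := by
  simp only [gaussianS, SchwartzMap.postcompCLM_apply]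
  rfl

/-! ### Position and derivative -/

/-- The derivative on Schwartz functions. -/
noncomputable abbrev dS : 𝓢(ℝ, ℂ) →L[ℂ] 𝓢(ℝ, ℂ) := SchwartzMap.derivCLM ℂ ℂ

theorem mulX_one_apply (φ : 𝓢(ℝ, ℂ)) (x : ℝ) : mulX 1 φ x = (x : ℂ) * φ x := by
  rw [mulX_apply, pow_one]

theorem mulX_zero (φ : 𝓢(ℝ, ℂ)) : mulX 0 φ = φ := by
  ext x; rw [mulX_apply, pow_zero, one_mul]

theorem mulX_succ (k : ℕ) (φ : 𝓢(ℝ, ℂ)) : mulX (k + 1) φ = mulX 1 (mulX k φ) := by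
  ext x; rw [mulX_one_apply, mulX_apply, mulX_apply, pow_succ]; ring

theorem deriv_mulX (φ : 𝓢(ℝ, ℂ)) : dS (mulX 1 φ) = mulX 1 (dS φ) + φ := by
  ext x
  have h1 : (mulX 1 φ : ℝ → ℂ) = fun x : ℝ => (x : ℂ) * φ x := funext (mulX_one_apply φ)
  have h2 : HasDerivAt (fun x : ℝ => (x : ℂ) * φ x) (1 * φ x + (x : ℂ) * deriv φ x) x :=
    (Complex.ofRealCLM.hasDerivAt (x := x)).mul (φ.hasDerivAt x)
  rw [SchwartzMap.derivCLM_apply, h1, h2.deriv, add_apply, mulX_one_apply,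
    SchwartzMap.derivCLM_apply]
  ring

theorem osc_eq (φ : 𝓢(ℝ, ℂ)) : osc φ = -dS (dS φ) + mulX 1 (mulX 1 φ) := by
  have : osc φ = -dS (dS φ) + mulX 2 φ := rfl
  rw [this, mulX_succ 1]

theorem deriv_gaussianS : dS gaussianS = -mulX 1 gaussianS := by
  ext x
  have h0 : (gaussianS : ℝ → ℂ) = fun x : ℝ => ((Real.exp (-(x ^ 2 / 2)) : ℝ) : ℂ) :=
    funext gaussianS_apply
  have h1 : HasDerivAt (fun x : ℝ => Real.exp (-(x ^ 2 / 2))) (Real.exp (-(x ^ 2 / 2)) * (-x)) x := by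
    have : HasDerivAt (fun x : ℝ => -(x ^ 2 / 2)) (-x) x := by
      have := ((hasDerivAt_pow 2 x).div_const 2).neg
      convert! this using 1
      simp
    exact this.exp
  rw [SchwartzMap.derivCLM_apply, h0, h1.ofReal_comp.deriv, neg_apply, mulX_one_apply,
    gaussianS_apply]
  push_cast
  ring

theorem inner_emb (φ χ : 𝓢(ℝ, ℂ)) :
    inner ℂ (emb φ) (emb χ) = ∫ x, (starRingEnd ℂ) (φ x) * χ x := by
  refine (SchwartzMap.inner_toL2_toL2_eq φ χ volume).trans ?_
  refine integral_congr_ae (Eventually.of_forall fun x => ?_)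
  simp [mul_comm]

theorem inner_mulX_one (k : ℕ) (φ χ : 𝓢(ℝ, ℂ)) :
    inner ℂ (emb (mulX k φ)) (emb χ) = inner ℂ (emb φ) (emb (mulX k χ)) := by
  rw [inner_emb, inner_emb]
  refine integral_congr_ae (Eventually.of_forall fun x => ?_)
  simp only [mulX_apply, map_mul, map_pow, Complex.conj_ofReal]
  ring

theorem inner_deriv (φ χ : 𝓢(ℝ, ℂ)) :
    inner ℂ (emb (dS φ)) (emb χ) = -inner ℂ (emb φ) (emb (dS χ)) := by
  rw [inner_emb, inner_emb]
  have hc : ∀ x, HasDerivAt (fun x => (starRingEnd ℂ) (φ x)) ((starRingEnd ℂ) (deriv φ x)) x :=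
    fun x => (φ.hasDerivAt x).star
  let ψ : 𝓢(ℝ, ℂ) := φ.postcompCLM Complex.conjCLE.toContinuousLinearMap
  have hψ : ∀ x, ψ x = (starRingEnd ℂ) (φ x) := fun x => by
    simp [ψ, SchwartzMap.postcompCLM_apply]
  have hψ' : ∀ x, deriv ψ x = (starRingEnd ℂ) (deriv φ x) := fun x => by
    rw [show (ψ : ℝ → ℂ) = fun x => (starRingEnd ℂ) (φ x) from funext hψ]
    exact (hc x).deriv
  have := SchwartzMap.integral_mul_deriv_eq_neg_deriv_mul ψ χ
  simp only [hψ, hψ'] at this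
  simp only [SchwartzMap.derivCLM_apply, this, neg_neg]

theorem emb_add (φ χ : 𝓢(ℝ, ℂ)) : emb (φ + χ) = emb φ + emb χ :=
  map_add (SchwartzMap.toLpCLM ℂ ℂ 2 (volume : Measure ℝ)) φ χ

theorem emb_sub (φ χ : 𝓢(ℝ, ℂ)) : emb (φ - χ) = emb φ - emb χ :=
  map_sub (SchwartzMap.toLpCLM ℂ ℂ 2 (volume : Measure ℝ)) φ χ

theorem emb_neg (φ : 𝓢(ℝ, ℂ)) : emb (-φ) = -emb φ :=
  map_neg (SchwartzMap.toLpCLM ℂ ℂ 2 (volume : Measure ℝ)) φ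

theorem emb_smul (c : ℂ) (φ : 𝓢(ℝ, ℂ)) : emb (c • φ) = c • emb φ :=
  map_smul (SchwartzMap.toLpCLM ℂ ℂ 2 (volume : Measure ℝ)) c φ

theorem emb_sum {ι : Type*} (s : Finset ι) (φ : ι → 𝓢(ℝ, ℂ)) :
    emb (∑ i ∈ s, φ i) = ∑ i ∈ s, emb (φ i) :=
  map_sum (SchwartzMap.toLpCLM ℂ ℂ 2 (volume : Measure ℝ)) φ s

theorem inner_osc (φ χ : 𝓢(ℝ, ℂ)) :
    inner ℂ (emb (osc φ)) (emb χ) = inner ℂ (emb φ) (emb (osc χ)) := by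
  simp only [osc_eq, emb_add, emb_neg, inner_add_left, inner_add_right, inner_neg_left,
    inner_neg_right, inner_mulX_one, inner_deriv, neg_neg]

theorem inner_oscS (α : ℕ) (φ χ : 𝓢(ℝ, ℂ)) :
    inner ℂ (emb (oscS α φ)) (emb χ) = inner ℂ (emb φ) (emb (oscS α χ)) := by
  induction α generalizing φ χ with
  | zero => simp [oscS]
  | succ n ih =>
    have h1 : oscS (n + 1) φ = oscS n (osc φ) := by rw [oscS, pow_succ]; rfl
    have h2 : oscS (n + 1) χ = osc (oscS n χ) := by rw [oscS, pow_succ']; rfl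
    rw [h1, h2, ih, inner_osc]

/-! ### Ladder operators and Hermite functions -/

/-- `√2` times the creation operator. -/
noncomputable def raise (φ : 𝓢(ℝ, ℂ)) : 𝓢(ℝ, ℂ) := mulX 1 φ - dS φ

/-- `√2` times the annihilation operator. -/
noncomputable def lower (φ : 𝓢(ℝ, ℂ)) : 𝓢(ℝ, ℂ) := mulX 1 φ + dS φ

theorem raise_smul (c : ℂ) (φ : 𝓢(ℝ, ℂ)) : raise (c • φ) = c • raise φ := by
  simp only [raise, map_smul, smul_sub]

theorem lower_smul (c : ℂ) (φ : 𝓢(ℝ, ℂ)) : lower (c • φ) = c • lower φ := by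
  simp only [lower, map_smul, smul_add]

theorem lower_raise (φ : 𝓢(ℝ, ℂ)) : lower (raise φ) = raise (lower φ) + (2 : ℂ) • φ := by
  simp only [lower, raise, map_sub, map_add, deriv_mulX, two_smul]
  abel

theorem osc_eq_raise_lower (φ : 𝓢(ℝ, ℂ)) : osc φ = raise (lower φ) + φ := by
  simp only [lower, raise, osc_eq, map_add, deriv_mulX]
  abel

theorem inner_raise (φ χ : 𝓢(ℝ, ℂ)) :
    inner ℂ (emb (raise φ)) (emb χ) = inner ℂ (emb φ) (emb (lower χ)) := by
  simp only [lower, raise, emb_add, emb_sub, inner_add_right, inner_sub_left, inner_mulX_one,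
    inner_deriv, sub_neg_eq_add]

/-- The normalized Hermite functions. -/
noncomputable def herm : ℕ → 𝓢(ℝ, ℂ)
  | 0 => ((‖emb gaussianS‖⁻¹ : ℝ) : ℂ) • gaussianS
  | k + 1 => (((Real.sqrt (2 * (k + 1)))⁻¹ : ℝ) : ℂ) • raise (herm k)

theorem ofReal_sqrt_mul_self {x : ℝ} (hx : 0 ≤ x) : ((√x : ℝ) : ℂ) * (√x : ℝ) = x := by
  rw [← Complex.ofReal_mul, Real.mul_self_sqrt hx]

theorem raise_herm (k : ℕ) : raise (herm k) = ((√(2 * (k + 1)) : ℝ) : ℂ) • herm (k + 1) := by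
  have h : (√(2 * ((k : ℝ) + 1))) ≠ 0 := (Real.sqrt_pos.2 (by positivity)).ne'
  rw [herm, smul_smul, ← Complex.ofReal_mul, mul_inv_cancel₀ h, Complex.ofReal_one, one_smul]

theorem lower_herm_zero : lower (herm 0) = 0 := by
  rw [herm, lower_smul, lower, deriv_gaussianS, add_neg_cancel, smul_zero]

theorem lower_herm_succ (k : ℕ) :
    lower (herm (k + 1)) = ((√(2 * (k + 1)) : ℝ) : ℂ) • herm k := by
  -- The eigenvalue relation at k gives the action of the annihilation operator at k + 1 through the
  -- commutation relation, and this in turn gives the eigenvalue relation at k + 1.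
  have key : ∀ k : ℕ, raise (lower (herm k)) = ((2 * k : ℝ) : ℂ) • herm k →
      lower (herm (k + 1)) = ((√(2 * (k + 1)) : ℝ) : ℂ) • herm k := by
    intro k hk
    have h : (√(2 * ((k : ℝ) + 1))) ≠ 0 := (Real.sqrt_pos.2 (by positivity)).ne'
    rw [herm, lower_smul, lower_raise, hk, ← add_smul, smul_smul]
    congr 1
    rw [show ((2 * k : ℝ) : ℂ) + 2 = ((2 * (k + 1) : ℝ) : ℂ) by push_cast; ring,
      ← ofReal_sqrt_mul_self (x := 2 * ((k : ℝ) + 1)) (by positivity), ← mul_assoc,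
      ← Complex.ofReal_mul, inv_mul_cancel₀ h, Complex.ofReal_one, one_mul]
  apply key
  induction k with
  | zero => simp [lower_herm_zero, raise]
  | succ n ih =>
    rw [key n ih, raise_smul, raise_herm, smul_smul, ofReal_sqrt_mul_self (by positivity)]
    push_cast
    rfl

theorem lower_herm (k : ℕ) : lower (herm k) = ((√(2 * k) : ℝ) : ℂ) • herm (k - 1) := by
  cases k with
  | zero => simp [lower_herm_zero]
  | succ n => rw [lower_herm_succ]; simp

theorem osc_herm (k : ℕ) : osc (herm k) = ((2 * k + 1 : ℝ) : ℂ) • herm k := by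
  rw [osc_eq_raise_lower]
  cases k with
  | zero => simp [lower_herm_zero, raise]
  | succ n =>
    rw [lower_herm_succ, raise_smul, raise_herm, smul_smul, ofReal_sqrt_mul_self (by positivity)]
    push_cast
    module

theorem oscS_herm (α k : ℕ) : oscS α (herm k) = (((2 * k + 1) ^ α : ℝ) : ℂ) • herm k := by
  induction α with
  | zero => simp [oscS]
  | succ n ih =>
    have h2 : oscS (n + 1) (herm k) = osc (oscS n (herm k)) := by rw [oscS, pow_succ']; rfl
    rw [h2, ih, map_smul, osc_herm, smul_smul]
    push_cast
    rw [pow_succ]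

theorem norm_emb_gaussianS_ne_zero : ‖emb gaussianS‖ ≠ 0 := by
  rw [norm_ne_zero_iff]
  intro h
  have h1 : gaussianS = 0 := by
    apply SchwartzMap.injective_toLp 2 (volume : Measure ℝ)
    refine Eq.trans h ?_
    exact (map_zero (SchwartzMap.toLpCLM ℂ ℂ 2 (volume : Measure ℝ))).symm
  have h2 := gaussianS_apply 0
  rw [h1] at h2
  simp at h2

theorem inner_herm_self (k : ℕ) : inner ℂ (emb (herm k)) (emb (herm k)) = (1 : ℂ) := by
  induction k with
  | zero =>
    rw [herm, emb_smul, inner_self_eq_norm_sq_to_K, norm_smul, Complex.norm_real, norm_inv,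
      norm_norm, inv_mul_cancel₀ norm_emb_gaussianS_ne_zero]
    simp
  | succ n ih =>
    have h : (√(2 * ((n : ℝ) + 1))) ≠ 0 := (Real.sqrt_pos.2 (by positivity)).ne'
    have : inner ℂ (emb (herm (n + 1))) (emb (herm (n + 1))) =
        (((Real.sqrt (2 * (n + 1)))⁻¹ : ℝ) : ℂ) *
          inner ℂ (emb (raise (herm n))) (emb (herm (n + 1))) := by
      conv_lhs => enter [2]; rw [herm]
      rw [emb_smul, inner_smul_left, Complex.conj_ofReal]
    rw [this, inner_raise, lower_herm_succ, emb_smul, inner_smul_right, ih, mul_one,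
      ← Complex.ofReal_mul, inv_mul_cancel₀ h, Complex.ofReal_one]

theorem orthonormal_herm : Orthonormal ℂ (fun k => emb (herm k)) := by
  refine ⟨fun k => ?_, fun j k hjk => ?_⟩
  · have := inner_herm_self k
    rw [inner_self_eq_norm_sq_to_K] at this
    have h2 : ‖emb (herm k)‖ ^ 2 = 1 := Complex.ofReal_injective (by push_cast; exact this)
    exact (pow_eq_one_iff_of_nonneg (norm_nonneg _) two_ne_zero).1 h2
  -- Eigenvectors of a symmetric operator for distinct eigenvalues 2j+1 and 2k+1 are orthogonal.
  · have h := inner_osc (herm j) (herm k)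
    rw [osc_herm, osc_herm, emb_smul, emb_smul, inner_smul_left, inner_smul_right,
      Complex.conj_ofReal, ← sub_eq_zero, ← sub_mul, mul_eq_zero] at h
    refine h.resolve_left ?_
    rw [← Complex.ofReal_sub]
    refine Complex.ofReal_ne_zero.2 fun h' => hjk ?_
    have : (j : ℝ) = k := by linarith
    exact_mod_cast this

theorem mulX_one_herm (k : ℕ) : mulX 1 (herm k) =
    (2⁻¹ : ℂ) • (((√(2 * (k + 1)) : ℝ) : ℂ) • herm (k + 1) +
      ((√(2 * k) : ℝ) : ℂ) • herm (k - 1)) := by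
  rw [← raise_herm, ← lower_herm, raise, lower]
  module

theorem deriv_herm (k : ℕ) : dS (herm k) =
    (2⁻¹ : ℂ) • (((√(2 * k) : ℝ) : ℂ) • herm (k - 1) -
      ((√(2 * (k + 1)) : ℝ) : ℂ) • herm (k + 1)) := by
  rw [← raise_herm, ← lower_herm, raise, lower]
  module

/-! ### Completeness of the Hermite functions -/

theorem mulX_one_mem_span_herm {φ : 𝓢(ℝ, ℂ)} (h : φ ∈ Submodule.span ℂ (range herm)) :
    mulX 1 φ ∈ Submodule.span ℂ (range herm) := by
  have hm : ∀ k, herm k ∈ Submodule.span ℂ (range herm) := fun k =>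
    Submodule.subset_span ⟨k, rfl⟩
  refine Submodule.span_induction ?_ ?_ ?_ ?_ h
  · rintro _ ⟨k, rfl⟩
    rw [mulX_one_herm]
    exact Submodule.smul_mem _ _
      (Submodule.add_mem _ (Submodule.smul_mem _ _ (hm _)) (Submodule.smul_mem _ _ (hm _)))
  · rw [map_zero]; exact Submodule.zero_mem _
  · intro x y _ _ hx hy
    rw [map_add]; exact Submodule.add_mem _ hx hy
  · intro c x _ hx
    rw [map_smul]; exact Submodule.smul_mem _ _ hx

/-- The span of the Hermite functions contains the Gaussian and is stable under multiplication by x.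
Orthogonality to all Hermite functions therefore kills all moments against the Gaussian. -/
theorem mulX_gaussianS_mem_span_herm (k : ℕ) :
    mulX k gaussianS ∈ Submodule.span ℂ (range herm) := by
  induction k with
  | zero =>
    rw [mulX_zero]
    have h : gaussianS = ((‖emb gaussianS‖ : ℝ) : ℂ) • herm 0 := by
      rw [herm, smul_smul, ← Complex.ofReal_mul, mul_inv_cancel₀ norm_emb_gaussianS_ne_zero,
        Complex.ofReal_one, one_smul]
    rw [h]
    exact Submodule.smul_mem _ _ (Submodule.subset_span ⟨0, rfl⟩)
  | succ n ih =>
    rw [mulX_succ]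
    exact mulX_one_mem_span_herm ih

theorem inner_emb_eq_zero_of_mem_span {f : L2} (hf : ∀ k, inner ℂ (emb (herm k)) f = (0 : ℂ))
    {φ : 𝓢(ℝ, ℂ)} (h : φ ∈ Submodule.span ℂ (range herm)) : inner ℂ (emb φ) f = (0 : ℂ) := by
  refine Submodule.span_induction ?_ ?_ ?_ ?_ h
  · rintro _ ⟨k, rfl⟩
    exact hf k
  · have : emb 0 = 0 := map_zero (SchwartzMap.toLpCLM ℂ ℂ 2 (volume : Measure ℝ))
    rw [this, inner_zero_left]
  · intro x y _ _ hx hy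
    rw [emb_add, inner_add_left, hx, hy, add_zero]
  · intro c x _ hx
    rw [emb_smul, inner_smul_left, hx, mul_zero]

theorem inner_emb_left (φ : 𝓢(ℝ, ℂ)) (f : L2) :
    inner ℂ (emb φ) f = ∫ x, (starRingEnd ℂ) (φ x) * f x := by
  rw [L2.inner_def]
  refine integral_congr_ae ?_
  filter_upwards [φ.coeFn_toLp 2 volume] with x hx
  rw [hx]
  simp [mul_comm]

theorem memLp_exp_mul_abs_mul_gaussian (c : ℝ) :
    MemLp (fun x : ℝ => Real.exp (c * |x|) * Real.exp (-(x ^ 2 / 2))) 2 volume := by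
  have h1 : Continuous (fun x : ℝ => Real.exp (c * |x|) * Real.exp (-(x ^ 2 / 2))) := by fun_prop
  rw [memLp_two_iff_integrable_sq h1.aestronglyMeasurable]
  have h2 : Integrable (fun x : ℝ => Real.exp (2 * c ^ 2) * Real.exp (-(1 / 2) * x ^ 2)) :=
    (integrable_exp_neg_mul_sq (by norm_num)).const_mul _
  -- Completing the square: 2c|x| - x² ≤ 2c² - x²/2.
  refine h2.mono' (h1.pow 2).aestronglyMeasurable (Eventually.of_forall fun x => ?_)
  rw [Real.norm_of_nonneg (by positivity), ← Real.exp_add, ← Real.exp_add, ← Real.exp_nat_mul]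
  apply Real.exp_le_exp.2
  push_cast
  nlinarith [sq_nonneg (|x| - 2 * c), sq_abs x]

theorem integrable_exp_mul_gaussian_mul (f : L2) (c : ℝ) :
    Integrable (fun x : ℝ => Real.exp (c * |x|) * ‖gaussianS x * f x‖) := by
  have h := (memLp_exp_mul_abs_mul_gaussian c).integrable_mul (Lp.memLp f).norm
  refine h.congr (Eventually.of_forall fun x => ?_)
  simp only [Pi.mul_apply, norm_mul, gaussianS_apply, Complex.norm_real, Real.norm_eq_abs,
    Real.abs_exp]
  ring

theorem integrable_gaussian_mul (f : L2) : Integrable (fun x : ℝ => gaussianS x * f x) := by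
  have h := integrable_exp_mul_gaussian_mul f 0
  simp only [zero_mul, Real.exp_zero, one_mul] at h
  exact (integrable_norm_iff
    (gaussianS.continuous.aestronglyMeasurable.mul (Lp.aestronglyMeasurable f))).1 h

theorem integral_pow_mul_gaussian_eq_zero {f : L2}
    (hf : ∀ k, inner ℂ (emb (herm k)) f = (0 : ℂ)) (k : ℕ) :
    ∫ x : ℝ, (x : ℂ) ^ k * (gaussianS x * f x) = 0 := by
  rw [← inner_emb_eq_zero_of_mem_span hf (mulX_gaussianS_mem_span_herm k), inner_emb_left]
  refine integral_congr_ae (Eventually.of_forall fun x => ?_)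
  simp only [mulX_apply, map_mul, map_pow, Complex.conj_ofReal, gaussianS_apply]
  ring

/-- Expand the exponential in its power series: every term is a vanishing moment, and the series is
dominated by exp(|c||x|) times the Gaussian times |f|, which is integrable. -/
theorem integral_cexp_mul_gaussian_eq_zero {f : L2}
    (hf : ∀ k, inner ℂ (emb (herm k)) f = (0 : ℂ)) (c : ℝ) :
    ∫ x : ℝ, Complex.exp ((c * x : ℝ) * Complex.I) * (gaussianS x * f x) = 0 := by
  have hmeas := gaussianS.continuous.aestronglyMeasurable.mul (Lp.aestronglyMeasurable f)
  have key := hasSum_integral_of_dominated_convergence (μ := (volume : Measure ℝ))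
    (F := fun n x => ((c * x : ℝ) * Complex.I) ^ n / (n.factorial : ℂ) * (gaussianS x * f x))
    (f := fun x => Complex.exp ((c * x : ℝ) * Complex.I) * (gaussianS x * f x))
    (fun n x => (|c| * |x|) ^ n / (n.factorial : ℝ) * ‖gaussianS x * f x‖) ?_ ?_ ?_ ?_ ?_
  · have h0 : ∀ n : ℕ, ∫ x : ℝ, ((c * x : ℝ) * Complex.I) ^ n / (n.factorial : ℂ) *
        (gaussianS x * f x) = 0 := by
      intro n
      have : (fun x : ℝ => ((c * x : ℝ) * Complex.I) ^ n / (n.factorial : ℂ) *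
          (gaussianS x * f x)) = fun x : ℝ => ((c * Complex.I) ^ n / (n.factorial : ℂ)) *
            ((x : ℂ) ^ n * (gaussianS x * f x)) := by
        ext x
        push_cast
        rw [show ((c : ℂ) * x * Complex.I) = (c * Complex.I) * x by ring, mul_pow]
        ring
      rw [this, integral_const_mul, integral_pow_mul_gaussian_eq_zero hf, mul_zero]
    simp only [h0] at key
    exact key.unique hasSum_zero
  · intro n
    refine AEStronglyMeasurable.mul (Continuous.aestronglyMeasurable ?_) hmeas
    fun_prop
  · intro n
    refine Eventually.of_forall fun x => le_of_eq ?_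
    rw [norm_mul, norm_div, norm_pow, norm_mul, Complex.norm_I, mul_one, Complex.norm_real,
      Real.norm_eq_abs, abs_mul, Complex.norm_natCast]
  · exact Eventually.of_forall fun x => (Real.summable_pow_div_factorial _).mul_right _
  · have : (fun x : ℝ => ∑' n : ℕ, (|c| * |x|) ^ n / (n.factorial : ℝ) * ‖gaussianS x * f x‖) =
        fun x => Real.exp (|c| * |x|) * ‖gaussianS x * f x‖ := by
      ext x
      rw [tsum_mul_right, Real.exp_eq_exp_ℝ, NormedSpace.exp_eq_tsum_div]
    rw [this]
    exact integrable_exp_mul_gaussian_mul f _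
  · refine Eventually.of_forall fun x => ?_
    have := NormedSpace.expSeries_div_hasSum_exp (((c * x : ℝ) : ℂ) * Complex.I)
    rw [← Complex.exp_eq_exp_ℂ] at this
    exact this.mul_right _

/-- The Fourier transform of the Gaussian times f vanishes identically, hence so does its integral
against every Schwartz function; the Gaussian itself has no zeros. -/
theorem eq_zero_of_inner_herm_eq_zero {f : L2}
    (hf : ∀ k, inner ℂ (emb (herm k)) f = (0 : ℂ)) : f = 0 := by
  have hg := integrable_gaussian_mul f
  have hF : ∀ w : ℝ, FourierTransform.fourier (fun x : ℝ => gaussianS x * f x) w = 0 := by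
    intro w
    rw [Real.fourier_eq', ← integral_cexp_mul_gaussian_eq_zero hf (-2 * Real.pi * w)]
    refine integral_congr_ae (Eventually.of_forall fun x => ?_)
    simp only [smul_eq_mul]
    congr 3
    simp
    ring
  have hS : ∀ ψ : 𝓢(ℝ, ℂ), ∫ x, ψ x * (gaussianS x * f x) = 0 := by
    intro ψ
    let χ : 𝓢(ℝ, ℂ) := FourierTransformInv.fourierInv ψ
    have h1 : FourierTransform.fourier χ = ψ := FourierTransform.fourier_fourierInv_eq ψ
    have h2 : (ψ : ℝ → ℂ) = FourierTransform.fourier (χ : ℝ → ℂ) := by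
      rw [← SchwartzMap.fourier_coe, h1]
    -- Move the Fourier transform from the test function to the integrable function, where it is
    -- zero.
    have h3 := VectorFourier.integral_fourierIntegral_smul_eq_flip (L := innerₗ ℝ)
      Real.continuous_fourierChar continuous_inner (χ.integrable (μ := volume)) hg
    have h4 : ∫ x, FourierTransform.fourier (χ : ℝ → ℂ) x • (gaussianS x * f x) =
        ∫ x, χ x • FourierTransform.fourier (fun x : ℝ => gaussianS x * f x) x := by
      simpa using! h3
    rw [h2]
    simp only [hF, integral_zero, smul_eq_mul, mul_zero] at h4
    exact h4
  have h0 : ∀ᵐ x : ℝ, gaussianS x * f x = 0 := by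
    refine ae_eq_zero_of_integral_contDiff_smul_eq_zero hg.locallyIntegrable fun g hgs hgc => ?_
    have hc : HasCompactSupport (fun x => (g x : ℂ)) := hgc.comp_left (g := Complex.ofReal) rfl
    have hd : ContDiff ℝ (⊤ : ℕ∞) (fun x => (g x : ℂ)) := Complex.ofRealCLM.contDiff.comp hgs
    have := hS (hc.toSchwartzMap hd)
    simp only [Complex.real_smul]
    exact this
  rw [Lp.eq_zero_iff_ae_eq_zero]
  filter_upwards [h0] with x hx
  rw [gaussianS_apply, mul_eq_zero] at hx
  exact hx.resolve_left (by exact_mod_cast (Real.exp_pos _).ne')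

/-- The Hilbert basis of Hermite functions. -/
noncomputable def hermBasis : HilbertBasis ℕ ℂ L2 :=
  HilbertBasis.mkOfOrthogonalEqBot orthonormal_herm (by
    rw [Submodule.eq_bot_iff]
    intro f hf
    refine eq_zero_of_inner_herm_eq_zero fun k => ?_
    exact (Submodule.mem_orthogonal _ f).1 hf _ (Submodule.subset_span ⟨k, rfl⟩))

theorem hermBasis_apply (k : ℕ) : hermBasis k = emb (herm k) := by
  rw [hermBasis, HilbertBasis.coe_mkOfOrthogonalEqBot]

/-! ### Relative bounds in Hermite coefficients -/

/-- The Hermite coefficients of a Schwartz function. -/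
noncomputable def coeffH (φ : 𝓢(ℝ, ℂ)) (k : ℕ) : ℂ := inner ℂ (emb (herm k)) (emb φ)

/-- Weighted sum of the squares of the Hermite coefficients. -/
noncomputable def weightedSum (β s : ℕ) (φ : 𝓢(ℝ, ℂ)) : ENNReal :=
  ∑' k : ℕ, ENNReal.ofReal ((2 * k + s) ^ β * ‖coeffH φ k‖ ^ 2)

/-- The elementary inequality (s + t)² ≤ 2s² + 2t². It discards the phases in the two-term
recurrences of x and d/dx, so that both satisfy the same bound on coefficients. -/
theorem norm_half_sqrt_sq_le (k : ℕ) (p q : ℂ) :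
    ‖(2⁻¹ : ℂ) * (((√(2 * (k + 1)) : ℝ) : ℂ) * p + ((√(2 * k) : ℝ) : ℂ) * q)‖ ^ 2 ≤
      (k + 1) * ‖p‖ ^ 2 + k * ‖q‖ ^ 2 := by
  have h1 : (√(2 * ((k : ℝ) + 1))) ^ 2 = 2 * (k + 1) := Real.sq_sqrt (by positivity)
  have h2 : (√(2 * (k : ℝ))) ^ 2 = 2 * k := Real.sq_sqrt (by positivity)
  set A := √(2 * ((k : ℝ) + 1))
  set B := √(2 * (k : ℝ))
  have h3 : ‖(A : ℂ) * p + (B : ℂ) * q‖ ≤ A * ‖p‖ + B * ‖q‖ := by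
    refine (norm_add_le _ _).trans ?_
    rw [norm_mul, norm_mul, Complex.norm_real, Complex.norm_real, Real.norm_of_nonneg,
      Real.norm_of_nonneg] <;> positivity
  rw [norm_mul, mul_pow]
  have h4 : ‖(2⁻¹ : ℂ)‖ ^ 2 = 1 / 4 := by norm_num
  rw [h4]
  have h5 := pow_le_pow_left₀ (norm_nonneg _) h3 2
  have e1 : (A * ‖p‖) ^ 2 = 2 * (k + 1) * ‖p‖ ^ 2 := by rw [mul_pow, h1]
  have e2 : (B * ‖q‖) ^ 2 = 2 * k * ‖q‖ ^ 2 := by rw [mul_pow, h2]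
  nlinarith [sq_nonneg (A * ‖p‖ - B * ‖q‖)]

theorem norm_coeffH_mulX_sq_le (φ : 𝓢(ℝ, ℂ)) (k : ℕ) : ‖coeffH (mulX 1 φ) k‖ ^ 2 ≤
    (k + 1) * ‖coeffH φ (k + 1)‖ ^ 2 + k * ‖coeffH φ (k - 1)‖ ^ 2 := by
  have h : coeffH (mulX 1 φ) k = (2⁻¹ : ℂ) * (((√(2 * (k + 1)) : ℝ) : ℂ) * coeffH φ (k + 1) +
      ((√(2 * k) : ℝ) : ℂ) * coeffH φ (k - 1)) := by
    rw [coeffH, ← inner_mulX_one, mulX_one_herm, emb_smul, emb_add, emb_smul, emb_smul,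
      inner_smul_left, inner_add_left, inner_smul_left, inner_smul_left, Complex.conj_ofReal,
      Complex.conj_ofReal, coeffH, coeffH]
    simp only [map_inv₀, Complex.conj_ofNat]
  rw [h]
  exact norm_half_sqrt_sq_le k _ _

theorem norm_coeffH_deriv_sq_le (φ : 𝓢(ℝ, ℂ)) (k : ℕ) : ‖coeffH (dS φ) k‖ ^ 2 ≤
    (k + 1) * ‖coeffH φ (k + 1)‖ ^ 2 + k * ‖coeffH φ (k - 1)‖ ^ 2 := by
  have h : coeffH (dS φ) k = (2⁻¹ : ℂ) * (((√(2 * (k + 1)) : ℝ) : ℂ) * coeffH φ (k + 1) +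
      ((√(2 * k) : ℝ) : ℂ) * -coeffH φ (k - 1)) := by
    rw [coeffH, ← neg_neg (inner ℂ (emb (herm k)) (emb (dS φ))), ← inner_deriv, deriv_herm,
      emb_smul, emb_sub, emb_smul, emb_smul, inner_smul_left, inner_sub_left, inner_smul_left,
      inner_smul_left, Complex.conj_ofReal, Complex.conj_ofReal, coeffH, coeffH]
    simp only [map_inv₀, Complex.conj_ofNat]
    ring
  rw [h]
  refine (norm_half_sqrt_sq_le k _ _).trans ?_
  rw [norm_neg]

/-- One application of x or d/dx costs one power of the weight and a shift of it by 2. After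
reindexing, |c_k|² is counted with weight at most k (2k+s+2)^β + (k+1) (2k+s+2)^β = (2k+1)
(2k+s+2)^β. At k = 0 the truncated index k - 1 is harmless because its coefficient vanishes. -/
theorem weightedSum_le {φ χ : 𝓢(ℝ, ℂ)} (h : ∀ k : ℕ, ‖coeffH χ k‖ ^ 2 ≤
    (k + 1) * ‖coeffH φ (k + 1)‖ ^ 2 + k * ‖coeffH φ (k - 1)‖ ^ 2) (β s : ℕ) :
    weightedSum β s χ ≤ weightedSum (β + 1) (s + 2) φ := by
  let g : ℕ → ENNReal := fun j => ENNReal.ofReal ((2 * j + s + 2) ^ β * (j * ‖coeffH φ j‖ ^ 2))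
  let f : ℕ → ENNReal := fun k => ENNReal.ofReal ((2 * k + s) ^ β * (k * ‖coeffH φ (k - 1)‖ ^ 2))
  have h1 : ∑' k : ℕ, g (k + 1) ≤ ∑' k, g k :=
    ENNReal.tsum_comp_le_tsum_of_injective (add_left_injective 1) g
  have h2 : ∑' k : ℕ, f k = ∑' k, f (k + 1) := by
    rw [tsum_eq_zero_add' ENNReal.summable]
    simp [f]
  calc weightedSum β s χ ≤ ∑' k : ℕ, (g (k + 1) + f k) := by
        refine ENNReal.tsum_le_tsum fun k => ?_
        rw [← ENNReal.ofReal_add (by positivity) (by positivity)]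
        refine ENNReal.ofReal_le_ofReal ?_
        have e1 : ((2 : ℝ) * k + s) ^ β ≤ (2 * ((k + 1 : ℕ) : ℝ) + s + 2) ^ β :=
          pow_le_pow_left₀ (by positivity) (by push_cast; linarith) β
        calc ((2 : ℝ) * k + s) ^ β * ‖coeffH χ k‖ ^ 2 ≤ (2 * k + s) ^ β *
              ((k + 1) * ‖coeffH φ (k + 1)‖ ^ 2 + k * ‖coeffH φ (k - 1)‖ ^ 2) := by
              gcongr; exact h k
          _ = (2 * k + s) ^ β * ((k + 1) * ‖coeffH φ (k + 1)‖ ^ 2) +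
              (2 * k + s) ^ β * (k * ‖coeffH φ (k - 1)‖ ^ 2) := by ring
          _ ≤ _ := by
              gcongr
              push_cast
              rfl
    _ ≤ ∑' k : ℕ, (g k + f (k + 1)) := by
        rw [ENNReal.tsum_add, ENNReal.tsum_add, h2]
        gcongr
    _ ≤ weightedSum (β + 1) (s + 2) φ := by
        refine ENNReal.tsum_le_tsum fun k => ?_
        rw [← ENNReal.ofReal_add (by positivity) (by positivity)]
        refine ENNReal.ofReal_le_ofReal ?_
        simp only [Nat.add_sub_cancel]
        push_cast
        have : ((2 : ℝ) * k + s + 2) ^ β * (k * ‖coeffH φ k‖ ^ 2) +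
            (2 * (k + 1) + s) ^ β * ((k + 1) * ‖coeffH φ k‖ ^ 2) =
            (2 * k + (s + 2)) ^ β * (2 * k + 1) * ‖coeffH φ k‖ ^ 2 := by ring
        rw [this, pow_succ]
        refine mul_le_mul_of_nonneg_right ?_ (by positivity)
        refine mul_le_mul_of_nonneg_left ?_ (by positivity)
        have : (0 : ℝ) ≤ s := Nat.cast_nonneg s
        linarith

theorem hasSum_norm_inner_sq {ι E : Type*} [NormedAddCommGroup E] [InnerProductSpace ℂ E]
    (b : HilbertBasis ι ℂ E) (x : E) : HasSum (fun i => ‖inner ℂ (b i) x‖ ^ 2) (‖x‖ ^ 2) := by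
  have h := b.hasSum_inner_mul_inner x x
  rw [← Complex.hasSum_ofReal]
  convert! h using 1
  · ext i
    rw [← inner_conj_symm x, Complex.conj_mul']
    push_cast; rfl
  · rw [inner_self_eq_norm_sq_to_K]
    push_cast; rfl

theorem hasSum_norm_coeffH_sq (φ : 𝓢(ℝ, ℂ)) :
    HasSum (fun k => ‖coeffH φ k‖ ^ 2) (‖emb φ‖ ^ 2) := by
  have := hasSum_norm_inner_sq hermBasis (emb φ)
  simpa only [hermBasis_apply] using! this

theorem weightedSum_zero (s : ℕ) (φ : 𝓢(ℝ, ℂ)) :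
    weightedSum 0 s φ = ENNReal.ofReal (‖emb φ‖ ^ 2) := by
  have h := hasSum_norm_coeffH_sq φ
  rw [← h.tsum_eq, ENNReal.ofReal_tsum_of_nonneg (fun _ => by positivity) h.summable]
  simp [weightedSum]

theorem weightedSum_mulX_le (β γ s : ℕ) (φ : 𝓢(ℝ, ℂ)) :
    weightedSum γ s (mulX β φ) ≤ weightedSum (γ + β) (s + 2 * β) φ := by
  induction β generalizing γ s with
  | zero => rw [mulX_zero]; rfl
  | succ n ih =>
    rw [mulX_succ]
    refine (weightedSum_le (norm_coeffH_mulX_sq_le _) γ s).trans ((ih _ _).trans (le_of_eq ?_))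
    congr 1 <;> ring

theorem coeffH_oscS (α : ℕ) (φ : 𝓢(ℝ, ℂ)) (k : ℕ) :
    coeffH (oscS α φ) k = (((2 * k + 1) ^ α : ℝ) : ℂ) * coeffH φ k := by
  rw [coeffH, ← inner_oscS, oscS_herm, emb_smul, inner_smul_left, Complex.conj_ofReal, coeffH]

theorem hasSum_oscS_sq (α : ℕ) (φ : 𝓢(ℝ, ℂ)) :
    HasSum (fun k : ℕ => ((2 * k + 1 : ℝ) ^ (2 * α)) * ‖coeffH φ k‖ ^ 2) (‖emb (oscS α φ)‖ ^ 2) := by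
  refine (hasSum_norm_coeffH_sq (oscS α φ)).congr_fun ?_
  intro k
  rw [coeffH_oscS, norm_mul, mul_pow, Complex.norm_real, Real.norm_of_nonneg (by positivity),
    ← pow_mul, mul_comm α]

/-- Reduces a relative bound between operators to an inequality between weights, mode by mode. -/
theorem le_of_weightedSum_le {α γ s : ℕ} {a b : ℝ} (ha : 0 ≤ a) (hb : 0 ≤ b)
    (h : ∀ k : ℕ, (2 * k + s : ℝ) ^ γ ≤ a ^ 2 * (2 * k + 1) ^ (2 * α) + b ^ 2) {φ χ : 𝓢(ℝ, ℂ)}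
    (hw : weightedSum 0 0 χ ≤ weightedSum γ s φ) :
    ‖emb χ‖ ≤ a * ‖emb (oscS α φ)‖ + b * ‖emb φ‖ := by
  have h1 := ((hasSum_oscS_sq α φ).mul_left (a ^ 2)).add
    ((hasSum_norm_coeffH_sq φ).mul_left (b ^ 2))
  have h2 : weightedSum γ s φ ≤
      ENNReal.ofReal (a ^ 2 * ‖emb (oscS α φ)‖ ^ 2 + b ^ 2 * ‖emb φ‖ ^ 2) := by
    rw [← h1.tsum_eq, ENNReal.ofReal_tsum_of_nonneg (fun _ => by positivity) h1.summable]
    refine ENNReal.tsum_le_tsum fun k => ENNReal.ofReal_le_ofReal ?_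
    rw [← mul_assoc, ← add_mul]
    gcongr
    exact h k
  rw [weightedSum_zero] at hw
  have h3 := (ENNReal.ofReal_le_ofReal_iff (by positivity)).1 (hw.trans h2)
  refine abs_le_of_sq_le_sq' ?_ (by positivity) |>.2
  have : 0 ≤ a * ‖emb (oscS α φ)‖ * (b * ‖emb φ‖) := by positivity
  nlinarith

theorem norm_mulX_le {α β : ℕ} {a b : ℝ} (ha : 0 ≤ a) (hb : 0 ≤ b)
    (h : ∀ k : ℕ, (2 * k + (2 * β : ℕ) : ℝ) ^ β ≤ a ^ 2 * (2 * k + 1) ^ (2 * α) + b ^ 2)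
    (φ : 𝓢(ℝ, ℂ)) : ‖emb (mulX β φ)‖ ≤ a * ‖emb (oscS α φ)‖ + b * ‖emb φ‖ := by
  refine le_of_weightedSum_le ha hb h ((weightedSum_mulX_le β 0 0 φ).trans (le_of_eq ?_))
  simp

theorem norm_emb_le_oscS (α : ℕ) (φ : 𝓢(ℝ, ℂ)) : ‖emb φ‖ ≤ ‖emb (oscS α φ)‖ := by
  refine abs_le_of_sq_le_sq' ?_ (by positivity) |>.2
  refine hasSum_le (fun k => ?_) (hasSum_norm_coeffH_sq φ) (hasSum_oscS_sq α φ)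
  have : (1 : ℝ) ≤ (2 * k + 1) ^ (2 * α) := one_le_pow₀ (by linarith [Nat.cast_nonneg (α := ℝ) k])
  nlinarith [sq_nonneg ‖coeffH φ k‖]

/-- The commutator of the oscillator with x² is only of first order in d/dx and in x. This is what
makes the quadratic perturbation stable without a smallness condition. -/
theorem osc_mulX_two (φ : 𝓢(ℝ, ℂ)) :
    osc (mulX 2 φ) = mulX 2 (osc φ) - ((4 : ℂ) • mulX 1 (dS φ) + (2 : ℂ) • φ) := by
  simp only [osc_eq, mulX_succ 1, map_add, map_neg, deriv_mulX]
  module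

theorem norm_mulX_deriv_le (φ : 𝓢(ℝ, ℂ)) : ‖emb (mulX 1 (dS φ))‖ ≤ 4 * ‖emb (osc φ)‖ := by
  have h := le_of_weightedSum_le (α := 1) (γ := 2) (s := 4) (a := 4) (b := 0) (φ := φ)
    (χ := mulX 1 (dS φ)) (by norm_num) le_rfl ?_ ?_
  · simpa [oscS] using! h
  · intro k
    have : (0 : ℝ) ≤ k := Nat.cast_nonneg k
    push_cast
    nlinarith
  · exact (weightedSum_le (norm_coeffH_mulX_sq_le _) 0 0).trans
      (weightedSum_le (norm_coeffH_deriv_sq_le _) 1 2)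

/-- With x = 2k+1, the left side is at most D x^β where D = (2β+1)^β. Beyond R = D/a² the extra
power of x absorbs D; below R everything is at most D R^β. -/
theorem exists_relative_bound_of_lt {α β : ℕ} (h : β < 2 * α) {a : ℝ} (ha : 0 < a) :
    ∃ b : ℝ, 0 ≤ b ∧ ∀ k : ℕ,
      (2 * k + (2 * β : ℕ) : ℝ) ^ β ≤ a ^ 2 * (2 * k + 1) ^ (2 * α) + b ^ 2 := by
  set D : ℝ := (2 * β + 1) ^ β
  have hD : 0 < D := by positivity
  set R : ℝ := D / a ^ 2
  have hR : 0 < R := by positivity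
  refine ⟨√(D * R ^ β), by positivity, fun k => ?_⟩
  rw [Real.sq_sqrt (by positivity)]
  set x : ℝ := 2 * k + 1
  have hx : 1 ≤ x := by simp only [x]; linarith [Nat.cast_nonneg (α := ℝ) k]
  have h1 : (2 * k + (2 * β : ℕ) : ℝ) ^ β ≤ D * x ^ β := by
    rw [← mul_pow]
    refine pow_le_pow_left₀ (by positivity) ?_ β
    have : (0 : ℝ) ≤ β := Nat.cast_nonneg β
    have hk : (0 : ℝ) ≤ k := Nat.cast_nonneg k
    simp only [x]
    push_cast
    nlinarith [mul_nonneg this hk]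
  refine h1.trans ?_
  rcases le_total R x with hRx | hRx
  · have h2 : D ≤ a ^ 2 * x := by
      have := (div_le_iff₀ (by positivity)).1 hRx
      linarith
    have h3 : D * x ^ β ≤ a ^ 2 * x ^ (β + 1) := by
      rw [pow_succ x, mul_comm (x ^ β), ← mul_assoc]
      gcongr
    have h4 : x ^ (β + 1) ≤ x ^ (2 * α) := pow_le_pow_right₀ hx h
    have h5 : a ^ 2 * x ^ (β + 1) ≤ a ^ 2 * x ^ (2 * α) := by gcongr
    have : 0 ≤ D * R ^ β := by positivity
    linarith
  · have h2 : D * x ^ β ≤ D * R ^ β := by gcongr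
    have : 0 ≤ a ^ 2 * x ^ (2 * α) := by positivity
    linarith

/-- With x = 2k+1, the ratio (x + 2β)^β / x^β tends to 1, so it falls below a² for large x; the
remaining modes go into the constant b. -/
theorem exists_relative_bound_of_eq {α β : ℕ} (h : β = 2 * α) {a : ℝ} (ha : 1 < a) :
    ∃ b : ℝ, 0 ≤ b ∧ ∀ k : ℕ,
      (2 * k + (2 * β : ℕ) : ℝ) ^ β ≤ a ^ 2 * (2 * k + 1) ^ (2 * α) + b ^ 2 := by
  subst h
  set β := 2 * α
  have hc : Tendsto (fun t : ℝ => (1 + 2 * β * t⁻¹) ^ β) atTop (𝓝 ((1 + 2 * β * 0) ^ β)) :=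
    ((tendsto_inv_atTop_zero.const_mul _).const_add _).pow β
  have ha2 : (1 + 2 * (β : ℝ) * 0) ^ β < a ^ 2 := by
    simp only [mul_zero, add_zero, one_pow]
    nlinarith
  obtain ⟨R, hR0, hR⟩ := ((hc.eventually_lt_const ha2).and (eventually_gt_atTop 0)).exists_forall_of_atTop.imp
    fun R hR => (⟨(hR R le_rfl).2, fun x hx => (hR x hx).1⟩ :
      0 < R ∧ ∀ x ≥ R, (1 + 2 * (β : ℝ) * x⁻¹) ^ β < a ^ 2)
  refine ⟨√((R + 2 * β) ^ β), by positivity, fun k => ?_⟩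
  rw [Real.sq_sqrt (by positivity)]
  set x : ℝ := 2 * k + 1
  have hx : 1 ≤ x := by simp only [x]; linarith [Nat.cast_nonneg (α := ℝ) k]
  have h1 : (2 * k + (2 * β : ℕ) : ℝ) ^ β ≤ (x + 2 * β) ^ β := by
    refine pow_le_pow_left₀ (by positivity) ?_ β
    simp only [x]
    push_cast
    linarith
  refine h1.trans ?_
  rcases le_total R x with hRx | hRx
  · have h2 : (x + 2 * β) ^ β = (1 + 2 * β * x⁻¹) ^ β * x ^ β := by
      rw [← mul_pow]
      congr 1
      field_simp
    rw [h2]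
    have h3 := (hR x hRx).le
    have h4 : (1 + 2 * β * x⁻¹) ^ β * x ^ β ≤ a ^ 2 * x ^ β := by gcongr
    have : 0 ≤ (R + 2 * β : ℝ) ^ β := by positivity
    linarith
  · have h2 : (x + 2 * β) ^ β ≤ (R + 2 * β) ^ β := by gcongr
    have : 0 ≤ a ^ 2 * x ^ β := by positivity
    linarith

/-! ### The graphs of the operators -/

/-- Testing with Hermite functions suffices: Parseval recovers the pairing with an arbitrary
Schwartz function. The distributional domain is thereby the spectral one. -/
theorem mem_oscGraph_iff {α : ℕ} {ψ f : L2} : (ψ, f) ∈ oscGraph α ↔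
    ∀ k : ℕ, inner ℂ (hermBasis k) f = (((2 * k + 1) ^ α : ℝ) : ℂ) * inner ℂ (hermBasis k) ψ := by
  constructor
  · intro h k
    have := h (herm k)
    rw [oscS_herm, emb_smul, inner_smul_left, Complex.conj_ofReal] at this
    rw [hermBasis_apply]
    exact this.symm
  · intro h φ
    change inner ℂ (emb (oscS α φ)) ψ = inner ℂ (emb φ) f
    rw [← hermBasis.tsum_inner_mul_inner, ← hermBasis.tsum_inner_mul_inner]
    congr 1
    ext k
    rw [h k, hermBasis_apply, inner_oscS, oscS_herm, emb_smul, inner_smul_right]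
    ring

/-- The maximal multiplication operator is closed: pass to successive subsequences along which both
sequences converge almost everywhere. -/
theorem mem_mulGraph_of_tendsto {β : ℕ} {ψ f : ℕ → L2} {ψ' f' : L2}
    (h : ∀ n, (ψ n, f n) ∈ mulGraph β) (hψ : Tendsto ψ atTop (𝓝 ψ')) (hf : Tendsto f atTop (𝓝 f')) :
    (ψ', f') ∈ mulGraph β := by
  obtain ⟨n₁, hn₁, h₁⟩ := (tendstoInMeasure_of_tendsto_Lp hψ).exists_seq_tendsto_ae
  have hf2 := hf.comp hn₁.tendsto_atTop
  obtain ⟨n₂, hn₂, h₂⟩ := (tendstoInMeasure_of_tendsto_Lp hf2).exists_seq_tendsto_ae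
  have hall : ∀ᵐ x : ℝ, ∀ n, f n x = (x : ℂ) ^ β * ψ n x := ae_all_iff.2 h
  change ∀ᵐ x : ℝ, f' x = (x : ℂ) ^ β * ψ' x
  filter_upwards [h₁, h₂, hall] with x h1 h2 h3
  refine tendsto_nhds_unique h2 ?_
  simp only [Function.comp_apply, h3]
  exact (h1.comp hn₂.tendsto_atTop).const_mul _

theorem emb_mem_mulGraph (β : ℕ) (φ : 𝓢(ℝ, ℂ)) : (emb φ, emb (mulX β φ)) ∈ mulGraph β := by
  change ∀ᵐ x : ℝ, emb (mulX β φ) x = (x : ℂ) ^ β * emb φ x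
  filter_upwards [φ.coeFn_toLp 2 volume, (mulX β φ).coeFn_toLp 2 volume] with x h1 h2
  rw [h1, h2, mulX_apply]

theorem mem_opA_graph {α : ℕ} {ψ f : L2} (h : (ψ, f) ∈ oscGraph α) :
    (ψ, (-Complex.I) • f) ∈ (opA α).graph := by
  rw [← oscPow_graph, LinearPMap.mem_graph_iff] at h
  obtain ⟨y, hy1, hy2⟩ := h
  rw [LinearPMap.mem_graph_iff]
  exact ⟨y, hy1, congrArg (fun g => (-Complex.I) • g) hy2⟩

theorem mem_opB_graph {β : ℕ} {ψ f : L2} (h : (ψ, f) ∈ mulGraph β) :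
    (ψ, (-Complex.I) • f) ∈ (opB β).graph := by
  rw [← mulPow_graph, LinearPMap.mem_graph_iff] at h
  obtain ⟨y, hy1, hy2⟩ := h
  rw [LinearPMap.mem_graph_iff]
  exact ⟨y, hy1, congrArg (fun g => (-Complex.I) • g) hy2⟩

theorem exists_oscGraph_of_mem_domain {α : ℕ} (ψ : (opA α).domain) :
    ∃ f : L2, ((ψ : L2), f) ∈ oscGraph α ∧ opA α ψ = (-Complex.I) • f := by
  refine ⟨oscPow α ⟨ψ, ψ.2⟩, ?_, rfl⟩
  rw [← oscPow_graph]
  exact LinearPMap.mem_graph _ _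

/-! ### A product rule for primitives -/

theorem lipschitzOnWith_primitive {G : Type*} [NormedAddCommGroup G] [NormedSpace ℝ G]
    {F : ℝ → G} {T C : ℝ}
    (hT : 0 ≤ T) (hF : IntervalIntegrable F volume 0 T) (hC : ∀ s ∈ Icc 0 T, ‖F s‖ ≤ C) (c : G) :
    LipschitzOnWith (Real.toNNReal C) (fun t => c + ∫ s in (0 : ℝ)..t, F s) (uIcc 0 T) := by
  have hC0 : 0 ≤ C := (norm_nonneg _).trans (hC 0 ⟨le_rfl, hT⟩)
  refine LipschitzOnWith.of_dist_le_mul fun t ht s hs => ?_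
  rw [uIcc_of_le hT] at ht hs
  have hi : ∀ r ∈ Icc 0 T, IntervalIntegrable F volume 0 r := fun r hr =>
    hF.mono_set (by rw [uIcc_of_le hr.1, uIcc_of_le hT]; exact Icc_subset_Icc_right hr.2)
  rw [dist_eq_norm, add_sub_add_left_eq_sub,
    intervalIntegral.integral_interval_sub_left (hi t ht) (hi s hs), Real.coe_toNNReal C hC0,
    Real.dist_eq]
  refine intervalIntegral.norm_integral_le_of_norm_le_const fun r hr => hC r ?_
  have h1 := uIoc_subset_uIcc hr
  have h2 : uIcc s t ⊆ Icc 0 T := by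
    rw [← uIcc_of_le hT]
    exact uIcc_subset_uIcc (by rwa [uIcc_of_le hT]) (by rwa [uIcc_of_le hT])
  exact h2 h1

/-- Controls may jump, so the curves need not be differentiable everywhere. Primitives of bounded
functions are Lipschitz, hence absolutely continuous; the product minus the candidate primitive is
absolutely continuous with derivative zero almost everywhere, hence constant. -/
theorem mul_eq_add_integral_of_bounded {F G f g : ℝ → ℂ} {T C : ℝ} (hT : 0 ≤ T)
    (hF : IntervalIntegrable F volume 0 T) (hG : IntervalIntegrable G volume 0 T)
    (hFC : ∀ s ∈ Icc 0 T, ‖F s‖ ≤ C) (hGC : ∀ s ∈ Icc 0 T, ‖G s‖ ≤ C)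
    (hf : ∀ t ∈ Icc 0 T, f t = f 0 + ∫ s in (0 : ℝ)..t, F s)
    (hg : ∀ t ∈ Icc 0 T, g t = g 0 + ∫ s in (0 : ℝ)..t, G s) :
    IntervalIntegrable (fun s => F s * g s + f s * G s) volume 0 T ∧
    f T * g T = f 0 * g 0 + ∫ s in (0 : ℝ)..T, (F s * g s + f s * G s) := by
  set f' : ℝ → ℂ := fun t => f 0 + ∫ s in (0 : ℝ)..t, F s with hf'
  set g' : ℝ → ℂ := fun t => g 0 + ∫ s in (0 : ℝ)..t, G s with hg'
  have hfa := (lipschitzOnWith_primitive hT hF hFC (f 0)).absolutelyContinuousOnInterval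
  have hga := (lipschitzOnWith_primitive hT hG hGC (g 0)).absolutelyContinuousOnInterval
  change AbsolutelyContinuousOnInterval f' 0 T at hfa
  change AbsolutelyContinuousOnInterval g' 0 T at hga
  have hI : IntervalIntegrable (fun s => F s * g' s + f' s * G s) volume 0 T :=
    (hF.mul_continuousOn hga.continuousOn).add (hG.continuousOn_mul hfa.continuousOn)
  obtain ⟨D₁, hD₁⟩ := hfa.exists_bound
  obtain ⟨D₂, hD₂⟩ := hga.exists_bound
  rw [uIcc_of_le hT] at hD₁ hD₂
  have hIC : ∀ s ∈ Icc 0 T, ‖F s * g' s + f' s * G s‖ ≤ C * D₂ + D₁ * C := by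
    intro s hs
    have hC0 : 0 ≤ C := (norm_nonneg _).trans (hFC s hs)
    have hD0 : 0 ≤ D₁ := (norm_nonneg _).trans (hD₁ s hs)
    refine (norm_add_le _ _).trans ?_
    rw [norm_mul, norm_mul]
    exact add_le_add (mul_le_mul (hFC s hs) (hD₂ s hs) (norm_nonneg _) hC0)
      (mul_le_mul (hD₁ s hs) (hGC s hs) (norm_nonneg _) hD0)
  have hIa := (lipschitzOnWith_primitive hT hI hIC 0).absolutelyContinuousOnInterval
  have hall := (hfa.smul hga).sub hIa
  obtain ⟨D, hD⟩ := hall.const_of_ae_hasDerivAt_zero (by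
    filter_upwards [hF.ae_hasDerivAt_integral, hG.ae_hasDerivAt_integral,
      hI.ae_hasDerivAt_integral] with x h1 h2 h3 hx
    have e1 := (h1 hx 0 left_mem_uIcc).const_add (f 0)
    have e2 := (h2 hx 0 left_mem_uIcc).const_add (g 0)
    have e3 := (h3 hx 0 left_mem_uIcc).const_add 0
    have := (e1.mul e2).sub e3
    rw [sub_self] at this
    exact this)
  have h0 := hD 0 left_mem_uIcc
  have h1 := hD T right_mem_uIcc
  have hff : ∀ t ∈ Icc 0 T, f t = f' t := hf
  have hgg : ∀ t ∈ Icc 0 T, g t = g' t := hg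
  have hcongr : EqOn (fun s => F s * g' s + f' s * G s) (fun s => F s * g s + f s * G s)
      (uIcc 0 T) := by
    intro s hs
    rw [uIcc_of_le hT] at hs
    simp only [hff s hs, hgg s hs]
  refine ⟨hI.congr fun s hs => hcongr (uIoc_subset_uIcc hs), ?_⟩
  rw [← intervalIntegral.integral_congr hcongr, hff T ⟨hT, le_rfl⟩, hgg T ⟨hT, le_rfl⟩]
  simp only [Pi.sub_apply, Pi.mul_apply, smul_eq_mul, zero_add,
    intervalIntegral.integral_same, sub_zero] at h0 h1
  have e1 : f' 0 = f 0 := by simp [hf']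
  have e2 : g' 0 = g 0 := by simp [hg']
  rw [e1, e2] at h0
  rw [h0, ← h1]
  ring

/-! ### Unitary groups of bounded operators and their products -/

section Propagators

variable {E : Type*} [NormedAddCommGroup E] [InnerProductSpace ℂ E] [CompleteSpace E]

/-- The unitary group `exp (-i t a)` of a bounded self-adjoint operator. -/
noncomputable def flow (a : selfAdjoint (E →L[ℂ] E)) (t : ℝ) : E ≃ₗᵢ[ℂ] E :=
  Unitary.linearIsometryEquiv (selfAdjoint.expUnitary ((-t) • a))

theorem flow_apply (a : selfAdjoint (E →L[ℂ] E)) (t : ℝ) (ψ : E) :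
    flow a t ψ = NormedSpace.exp (t • ((-Complex.I) • (a : E →L[ℂ] E))) ψ := by
  have : (flow a t : E →L[ℂ] E) = NormedSpace.exp (t • ((-Complex.I) • (a : E →L[ℂ] E))) := by
    rw [flow, Unitary.coe_linearIsometryEquiv_apply, selfAdjoint.expUnitary_coe]
    congr 1
    rw [selfAdjoint.val_smul, smul_comm Complex.I, neg_smul, neg_smul, smul_neg]
  rw [← this]
  rfl

theorem flow_zero (a : selfAdjoint (E →L[ℂ] E)) (ψ : E) : flow a 0 ψ = ψ := by
  rw [flow_apply, zero_smul, NormedSpace.exp_zero]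
  rfl

theorem hasDerivAt_flow (a : selfAdjoint (E →L[ℂ] E)) (ψ : E) (t : ℝ) :
    HasDerivAt (fun t => flow a t ψ) ((-Complex.I) • (a : E →L[ℂ] E) (flow a t ψ)) t := by
  have h := hasDerivAt_exp_smul_const' (𝕂 := ℝ) ((-Complex.I) • (a : E →L[ℂ] E)) t
  let ev : (E →L[ℂ] E) →L[ℝ] E := (ContinuousLinearMap.apply ℂ E ψ).restrictScalars ℝ
  simp only [flow_apply]
  exact ev.hasFDerivAt.comp_hasDerivAt t h

theorem flow_commute {a : selfAdjoint (E →L[ℂ] E)} {S : E →L[ℂ] E}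
    (h : ∀ ψ, S ((a : E →L[ℂ] E) ψ) = (a : E →L[ℂ] E) (S ψ)) (t : ℝ) (ψ : E) :
    S (flow a t ψ) = flow a t (S ψ) := by
  have hc : Commute S (a : E →L[ℂ] E) := ContinuousLinearMap.ext h
  have h2 : Commute S (NormedSpace.exp (t • ((-Complex.I) • (a : E →L[ℂ] E)))) :=
    ((hc.smul_right _).smul_right t).exp_right
  rw [flow_apply, flow_apply]
  exact DFunLike.congr_fun h2.eq ψ

/-- The product of the first `k` flows, each of them during a time `h`. -/
noncomputable def stepFlow (a : ℕ → selfAdjoint (E →L[ℂ] E)) (h : ℝ) : ℕ → (E ≃ₗᵢ[ℂ] E)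
  | 0 => LinearIsometryEquiv.refl ℂ E
  | k + 1 => (stepFlow a h k).trans (flow (a k) h)

/-- The propagator of the generator which equals `a k` during `[k h, (k + 1) h)`. -/
noncomputable def propag (a : ℕ → selfAdjoint (E →L[ℂ] E)) (h t : ℝ) : E ≃ₗᵢ[ℂ] E :=
  (stepFlow a h ⌊t / h⌋₊).trans (flow (a ⌊t / h⌋₊) (t - ⌊t / h⌋₊ * h))

theorem propag_apply (a : ℕ → selfAdjoint (E →L[ℂ] E)) (h t : ℝ) (ψ : E) :
    propag a h t ψ = flow (a ⌊t / h⌋₊) (t - ⌊t / h⌋₊ * h) (stepFlow a h ⌊t / h⌋₊ ψ) := rfl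

theorem floor_div_eq {h t : ℝ} (hh : 0 < h) {k : ℕ} (h1 : k * h ≤ t) (h2 : t < (k + 1) * h) :
    ⌊t / h⌋₊ = k := by
  rw [Nat.floor_eq_iff (div_nonneg (le_trans (by positivity) h1) hh.le)]
  exact ⟨(le_div_iff₀ hh).2 h1, (div_lt_iff₀ hh).2 h2⟩

/-- Valid up to and including the right endpoint of the cell: there the index jumps to k + 1, but
the new flow acts for time zero. -/
theorem propag_eq_flow (a : ℕ → selfAdjoint (E →L[ℂ] E)) {h t : ℝ} (hh : 0 < h) {k : ℕ}
    (h1 : k * h ≤ t) (h2 : t ≤ (k + 1) * h) (ψ : E) :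
    propag a h t ψ = flow (a k) (t - k * h) (stepFlow a h k ψ) := by
  rcases h2.lt_or_eq with h3 | h3
  · rw [propag_apply, floor_div_eq hh h1 h3]
  · have h4 : ⌊t / h⌋₊ = k + 1 := by
      apply floor_div_eq hh
      · push_cast; exact h3.ge
      · push_cast; nlinarith
    rw [propag_apply, h4, h3]
    push_cast
    rw [sub_self, flow_zero, show ((k : ℝ) + 1) * h - k * h = h by ring]
    rfl

theorem propag_zero (a : ℕ → selfAdjoint (E →L[ℂ] E)) {h : ℝ} (ψ : E) :
    propag a h 0 ψ = ψ := by
  rw [propag_apply]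
  simp only [zero_div, Nat.floor_zero, Nat.cast_zero, zero_mul, sub_zero, flow_zero]
  rfl

theorem stepFlow_commute {a : ℕ → selfAdjoint (E →L[ℂ] E)} {S : E →L[ℂ] E}
    (hS : ∀ k ψ, S ((a k : E →L[ℂ] E) ψ) = (a k : E →L[ℂ] E) (S ψ)) (h : ℝ) (k : ℕ) (ψ : E) :
    S (stepFlow a h k ψ) = stepFlow a h k (S ψ) := by
  induction k with
  | zero => rfl
  | succ k ih =>
    change S (flow (a k) h (stepFlow a h k ψ)) = flow (a k) h (stepFlow a h k (S ψ))
    rw [flow_commute (hS k), ih]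

theorem propag_commute {a : ℕ → selfAdjoint (E →L[ℂ] E)} {S : E →L[ℂ] E}
    (hS : ∀ k ψ, S ((a k : E →L[ℂ] E) ψ) = (a k : E →L[ℂ] E) (S ψ)) (h t : ℝ) (ψ : E) :
    S (propag a h t ψ) = propag a h t (S ψ) := by
  rw [propag_apply, flow_commute (hS _), stepFlow_commute hS, propag_apply]

theorem propag_cell (a : ℕ → selfAdjoint (E →L[ℂ] E)) {h t : ℝ} (hh : 0 < h) {k : ℕ}
    (h1 : k * h ≤ t) (h2 : t ≤ (k + 1) * h) (ψ : E) :
    IntervalIntegrable (fun s => (-Complex.I) • (a ⌊s / h⌋₊ : E →L[ℂ] E) (propag a h s ψ))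
      volume (k * h) t ∧
    propag a h t ψ = propag a h (k * h) ψ +
      ∫ s in (k * h)..t, (-Complex.I) • (a ⌊s / h⌋₊ : E →L[ℂ] E) (propag a h s ψ) := by
  set F : ℝ → E := fun s => (-Complex.I) • (a k : E →L[ℂ] E) (flow (a k) (s - k * h)
    (stepFlow a h k ψ)) with hF
  have hd : ∀ s, HasDerivAt (fun s => flow (a k) (s - k * h) (stepFlow a h k ψ)) (F s) s :=
    fun s => (hasDerivAt_flow (a k) (stepFlow a h k ψ) (s - k * h)).comp_sub_const s (k * h)
  have hc : Continuous F := by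
    have : Continuous (fun s => flow (a k) (s - k * h) (stepFlow a h k ψ)) :=
      continuous_iff_continuousAt.2 fun s => (hd s).continuousAt
    fun_prop
  have hae : ∀ᵐ s ∂(volume : Measure ℝ), s ∈ uIoc (k * h) t →
      F s = (-Complex.I) • (a ⌊s / h⌋₊ : E →L[ℂ] E) (propag a h s ψ) := by
    -- The generator switches at the right endpoint, which is a null set.
    have hne : ∀ᵐ s : ℝ, s ≠ (k + 1) * h := by simp [ae_iff, measure_singleton]
    filter_upwards [hne] with s hs hs2
    rw [uIoc_of_le h1] at hs2
    have h3 : s < (k + 1) * h := lt_of_le_of_ne (hs2.2.trans h2) hs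
    rw [floor_div_eq hh hs2.1.le h3, propag_eq_flow a hh hs2.1.le h3.le]
  refine ⟨(hc.intervalIntegrable _ _).congr_ae
    ((ae_restrict_iff' measurableSet_uIoc).2 hae), ?_⟩
  rw [← intervalIntegral.integral_congr_ae hae,
    intervalIntegral.integral_eq_sub_of_hasDerivAt (fun s _ => hd s) (hc.intervalIntegrable _ _),
    propag_eq_flow a hh h1 h2, propag_eq_flow a hh le_rfl (by nlinarith)]
  abel

theorem propag_eq_integral (a : ℕ → selfAdjoint (E →L[ℂ] E)) {h t : ℝ} (hh : 0 < h) (ht : 0 ≤ t)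
    (ψ : E) :
    IntervalIntegrable (fun s => (-Complex.I) • (a ⌊s / h⌋₊ : E →L[ℂ] E) (propag a h s ψ))
      volume 0 t ∧
    propag a h t ψ = ψ +
      ∫ s in (0 : ℝ)..t, (-Complex.I) • (a ⌊s / h⌋₊ : E →L[ℂ] E) (propag a h s ψ) := by
  have hgrid : ∀ k : ℕ,
      IntervalIntegrable (fun s => (-Complex.I) • (a ⌊s / h⌋₊ : E →L[ℂ] E) (propag a h s ψ))
        volume 0 (k * h) ∧ propag a h (k * h) ψ = ψ +
      ∫ s in (0 : ℝ)..(k * h), (-Complex.I) • (a ⌊s / h⌋₊ : E →L[ℂ] E) (propag a h s ψ) := by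
    intro k
    induction k with
    | zero => simp [propag_zero]
    | succ k ih =>
      have := propag_cell a hh (k := k) (t := (k + 1) * h) (by nlinarith) le_rfl ψ
      push_cast
      refine ⟨ih.1.trans this.1, ?_⟩
      rw [this.2, ih.2, add_assoc, intervalIntegral.integral_add_adjacent_intervals ih.1 this.1]
  have h1 : (⌊t / h⌋₊ : ℝ) * h ≤ t := (le_div_iff₀ hh).1 (Nat.floor_le (by positivity))
  have h2 : t ≤ (⌊t / h⌋₊ + 1 : ℝ) * h := ((div_lt_iff₀ hh).1 (Nat.lt_floor_add_one _)).le
  have hc := propag_cell a hh h1 h2 ψ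
  have hg := hgrid ⌊t / h⌋₊
  refine ⟨hg.1.trans hc.1, ?_⟩
  rw [hc.2, hg.2, add_assoc, intervalIntegral.integral_add_adjacent_intervals hg.1 hc.1]

/-! ### Energies along a product of flows -/

/-- If a family of functions on `E` grows at most exponentially along the flows, and changes by a
controlled factor when the generator is switched, then it is controlled, from above and
from below, along the product of the flows. -/
theorem energy_propag_le {a : ℕ → selfAdjoint (E →L[ℂ] E)} {h κ : ℝ} (hh : 0 < h)
    {F : ℕ → E → ℝ} {δ : ℕ → ℝ}
    (hflow : ∀ k ψ (s : ℝ), F k (flow (a k) s ψ) ≤ Real.exp (κ * |s|) * F k ψ)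
    (hup : ∀ k ψ, F (k + 1) ψ ≤ Real.exp (δ k) * F k ψ)
    (hdown : ∀ k ψ, F k ψ ≤ Real.exp (δ k) * F (k + 1) ψ) {t : ℝ} (ht : 0 ≤ t) (ψ : E) :
    F ⌊t / h⌋₊ (propag a h t ψ) ≤
        Real.exp (κ * t + ∑ j ∈ Finset.range ⌊t / h⌋₊, δ j) * F 0 ψ ∧
      F 0 ψ ≤ Real.exp (κ * t + ∑ j ∈ Finset.range ⌊t / h⌋₊, δ j) *
        F ⌊t / h⌋₊ (propag a h t ψ) := by
  -- The lower bound along a flow is the upper bound for the reversed flow.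
  have hback : ∀ k ψ (s : ℝ), F k ψ ≤ Real.exp (κ * |s|) * F k (flow (a k) s ψ) := by
    intro k ψ s
    have h1 := hflow k (flow (a k) s ψ) (-s)
    have h2 : flow (a k) (-s) (flow (a k) s ψ) = ψ := by
      rw [flow_apply, flow_apply]
      have hc : Commute ((-s) • ((-Complex.I) • (a k : E →L[ℂ] E)))
        (s • ((-Complex.I) • (a k : E →L[ℂ] E))) :=
        ((Commute.refl _).smul_left _).smul_right _
      let _ : NormedAlgebra ℚ (E →L[ℂ] E) := NormedAlgebra.restrictScalars ℚ ℂ _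
      have := NormedSpace.exp_add_of_commute hc
      rw [neg_smul, neg_add_cancel, NormedSpace.exp_zero] at this
      rw [neg_smul]
      exact (DFunLike.congr_fun this ψ).symm
    rwa [h2, abs_neg] at h1
  have hgrid : ∀ k : ℕ, F k (stepFlow a h k ψ) ≤
      Real.exp (κ * (k * h) + ∑ j ∈ Finset.range k, δ j) * F 0 ψ ∧
      F 0 ψ ≤ Real.exp (κ * (k * h) + ∑ j ∈ Finset.range k, δ j) * F k (stepFlow a h k ψ) := by
    intro k
    induction k with
    | zero => simp [stepFlow]
    | succ k ih =>
      have e : Real.exp (κ * ((k + 1 : ℕ) * h) + ∑ j ∈ Finset.range (k + 1), δ j) =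
          Real.exp (δ k) * (Real.exp (κ * |h|) *
            Real.exp (κ * (k * h) + ∑ j ∈ Finset.range k, δ j)) := by
        rw [← Real.exp_add, ← Real.exp_add, abs_of_pos hh, Finset.sum_range_succ]
        congr 1
        push_cast
        ring
      rw [e]
      constructor
      · calc F (k + 1) (flow (a k) h (stepFlow a h k ψ))
            ≤ Real.exp (δ k) * F k (flow (a k) h (stepFlow a h k ψ)) := hup _ _
          _ ≤ Real.exp (δ k) * (Real.exp (κ * |h|) * F k (stepFlow a h k ψ)) := by
              gcongr; exact hflow _ _ _
          _ ≤ Real.exp (δ k) * (Real.exp (κ * |h|) *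
              (Real.exp (κ * (k * h) + ∑ j ∈ Finset.range k, δ j) * F 0 ψ)) := by
              gcongr; exact ih.1
          _ = _ := by ring
      · calc F 0 ψ ≤ Real.exp (κ * (k * h) + ∑ j ∈ Finset.range k, δ j) *
              F k (stepFlow a h k ψ) := ih.2
          _ ≤ Real.exp (κ * (k * h) + ∑ j ∈ Finset.range k, δ j) *
              (Real.exp (κ * |h|) * F k (flow (a k) h (stepFlow a h k ψ))) := by
              gcongr; exact hback _ _ _
          _ ≤ Real.exp (κ * (k * h) + ∑ j ∈ Finset.range k, δ j) *
              (Real.exp (κ * |h|) * (Real.exp (δ k) *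
                F (k + 1) (flow (a k) h (stepFlow a h k ψ)))) := by
              gcongr; exact hdown _ _
          _ = Real.exp (δ k) * (Real.exp (κ * |h|) *
            Real.exp (κ * (k * h) + ∑ j ∈ Finset.range k, δ j)) *
              F (k + 1) (flow (a k) h (stepFlow a h k ψ)) := by ring
  have hg := hgrid ⌊t / h⌋₊
  set k := ⌊t / h⌋₊ with hk
  have h1 : (k : ℝ) * h ≤ t := (le_div_iff₀ hh).1 (Nat.floor_le (by positivity))
  have e : Real.exp (κ * t + ∑ j ∈ Finset.range k, δ j) =
      Real.exp (κ * |t - k * h|) * Real.exp (κ * (k * h) + ∑ j ∈ Finset.range k, δ j) := by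
    rw [← Real.exp_add, abs_of_nonneg (sub_nonneg.2 h1)]
    congr 1
    ring
  rw [e, propag_apply, ← hk]
  constructor
  · calc F k (flow (a k) (t - k * h) (stepFlow a h k ψ))
        ≤ Real.exp (κ * |t - k * h|) * F k (stepFlow a h k ψ) := hflow _ _ _
      _ ≤ Real.exp (κ * |t - k * h|) *
          (Real.exp (κ * (k * h) + ∑ j ∈ Finset.range k, δ j) * F 0 ψ) := by gcongr; exact hg.1
      _ = _ := by ring
  · calc F 0 ψ ≤ Real.exp (κ * (k * h) + ∑ j ∈ Finset.range k, δ j) *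
          F k (stepFlow a h k ψ) := hg.2
      _ ≤ Real.exp (κ * (k * h) + ∑ j ∈ Finset.range k, δ j) *
          (Real.exp (κ * |t - k * h|) * F k (flow (a k) (t - k * h) (stepFlow a h k ψ))) := by
          gcongr; exact hback _ _ _
      _ = _ := by ring

end Propagators

/-! ### Symmetric perturbations of diagonal operators -/

/-- A diagonal operator `b k ↦ lam k • b k` in a Hilbert basis, together with the images `v k` of
the basis vectors under a symmetric operator which is bounded relative to it. -/
structure DiagModel (E : Type*) [NormedAddCommGroup E] [InnerProductSpace ℂ E] where
  /-- the Hilbert basis of eigenvectors -/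
  b : HilbertBasis ℕ ℂ E
  /-- the eigenvalues -/
  lam : ℕ → ℝ
  /-- the images of the basis vectors under the perturbation -/
  v : ℕ → E
  /-- the relative bound -/
  K : ℝ
  one_le_lam : ∀ k, 1 ≤ lam k
  symm : ∀ j k, inner ℂ (b j) (v k) = (inner ℂ (v j) (b k) : ℂ)
  K_nonneg : 0 ≤ K
  bound : ∀ (n : ℕ) (ψ : E), ‖∑ k ∈ Finset.range n, (inner ℂ (b k) ψ : ℂ) • v k‖ ≤
    K * ‖∑ k ∈ Finset.range n, (inner ℂ (b k) ψ : ℂ) • ((lam k : ℂ) • b k)‖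

namespace DiagModel

variable {E : Type*} [NormedAddCommGroup E] [InnerProductSpace ℂ E] (S : DiagModel E)

/-- The linear map which sends the basis vectors `b k` with `k < n` to `x k`, and the others to
zero. -/
noncomputable def trunc (x : ℕ → E) (n : ℕ) : E →L[ℂ] E :=
  ∑ k ∈ Finset.range n, (innerSL ℂ (S.b k)).smulRight (x k)

theorem trunc_apply (x : ℕ → E) (n : ℕ) (ψ : E) :
    S.trunc x n ψ = ∑ k ∈ Finset.range n, (inner ℂ (S.b k) ψ : ℂ) • x k := by
  simp [trunc]

/-- The orthogonal projection on the span of the first `n` basis vectors. -/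
noncomputable def proj (n : ℕ) : E →L[ℂ] E := S.trunc S.b n

/-- The truncated diagonal operator. -/
noncomputable def diag (n : ℕ) : E →L[ℂ] E := S.trunc (fun k => (S.lam k : ℂ) • S.b k) n

/-- The perturbation on the span of the first `n` basis vectors. -/
noncomputable def pert (n : ℕ) : E →L[ℂ] E := S.trunc S.v n

theorem norm_pert_le (n : ℕ) (ψ : E) : ‖S.pert n ψ‖ ≤ S.K * ‖S.diag n ψ‖ := by
  simp only [pert, diag, trunc_apply]
  exact S.bound n ψ

theorem inner_basis (j k : ℕ) : inner ℂ (S.b j) (S.b k) = if j = k then (1 : ℂ) else 0 :=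
  orthonormal_iff_ite.1 S.b.orthonormal j k

theorem inner_basis_trunc (d : ℕ → ℂ) (n k : ℕ) (ψ : E) :
    inner ℂ (S.b k) (S.trunc (fun k => d k • S.b k) n ψ) =
      if k < n then d k * inner ℂ (S.b k) ψ else 0 := by
  simp only [trunc_apply, inner_sum, inner_smul_right, inner_basis]
  simp only [mul_ite, mul_one, mul_zero]
  rw [Finset.sum_ite_eq]
  simp [mul_comm]

theorem inner_basis_proj (n k : ℕ) (ψ : E) :
    inner ℂ (S.b k) (S.proj n ψ) = if k < n then inner ℂ (S.b k) ψ else (0 : ℂ) := by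
  have := S.inner_basis_trunc (fun _ => 1) n k ψ
  simpa only [one_smul, one_mul] using! this

theorem inner_basis_diag (n k : ℕ) (ψ : E) : inner ℂ (S.b k) (S.diag n ψ) =
    if k < n then (S.lam k : ℂ) * inner ℂ (S.b k) ψ else (0 : ℂ) :=
  S.inner_basis_trunc (fun k => S.lam k) n k ψ

theorem ext_basis {x y : E} (h : ∀ k, inner ℂ (S.b k) x = (inner ℂ (S.b k) y : ℂ)) : x = y := by
  apply S.b.repr.injective
  ext k
  rw [S.b.repr_apply_apply, S.b.repr_apply_apply, h]

theorem trunc_congr {x : ℕ → E} {n : ℕ} {ψ η : E}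
    (h : ∀ k < n, inner ℂ (S.b k) ψ = (inner ℂ (S.b k) η : ℂ)) :
    S.trunc x n ψ = S.trunc x n η := by
  rw [trunc_apply, trunc_apply]
  exact Finset.sum_congr rfl fun k hk => by rw [h k (Finset.mem_range.1 hk)]

theorem trunc_proj_of_le (x : ℕ → E) {n m : ℕ} (h : n ≤ m) (ψ : E) :
    S.trunc x n (S.proj m ψ) = S.trunc x n ψ :=
  S.trunc_congr fun k hk => by rw [inner_basis_proj, if_pos (hk.trans_le h)]

theorem trunc_proj_of_ge (x : ℕ → E) {n m : ℕ} (h : n ≤ m) (ψ : E) :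
    S.trunc x m (S.proj n ψ) = S.trunc x n ψ := by
  rw [trunc_apply, trunc_apply]
  simp only [inner_basis_proj]
  rw [← Finset.sum_subset (Finset.range_subset_range.2 h)]
  · refine Finset.sum_congr rfl fun k hk => ?_
    rw [if_pos (Finset.mem_range.1 hk)]
  · intro k _ hk
    rw [if_neg (by simpa using hk), zero_smul]

theorem proj_proj_of_le {n m : ℕ} (h : n ≤ m) (ψ : E) : S.proj n (S.proj m ψ) = S.proj n ψ :=
  S.trunc_proj_of_le _ h ψ

theorem proj_proj_of_ge {n m : ℕ} (h : n ≤ m) (ψ : E) : S.proj m (S.proj n ψ) = S.proj n ψ :=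
  S.trunc_proj_of_ge _ h ψ

theorem proj_eq_self_of_le {n m : ℕ} (h : n ≤ m) {ψ : E} (hψ : S.proj n ψ = ψ) :
    S.proj m ψ = ψ := by
  rw [← hψ, S.proj_proj_of_ge h]

theorem diag_eq_of_le {n m : ℕ} (h : n ≤ m) {ψ : E} (hψ : S.proj n ψ = ψ) :
    S.diag m ψ = S.diag n ψ := by
  conv_lhs => rw [← hψ]
  exact S.trunc_proj_of_ge _ h ψ

theorem diag_proj (n : ℕ) (ψ : E) : S.diag n (S.proj n ψ) = S.diag n ψ :=
  S.trunc_proj_of_le _ le_rfl ψ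

theorem pert_proj (n : ℕ) (ψ : E) : S.pert n (S.proj n ψ) = S.pert n ψ :=
  S.trunc_proj_of_le _ le_rfl ψ

theorem proj_diag_of_le {n m : ℕ} (h : n ≤ m) (ψ : E) : S.proj n (S.diag m ψ) = S.diag n ψ := by
  refine S.ext_basis fun k => ?_
  rw [inner_basis_proj, inner_basis_diag, inner_basis_diag]
  by_cases hk : k < n
  · rw [if_pos hk, if_pos hk, if_pos (hk.trans_le h)]
  · rw [if_neg hk, if_neg hk]

theorem proj_diag (n : ℕ) (ψ : E) : S.proj n (S.diag n ψ) = S.diag n ψ :=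
  S.proj_diag_of_le le_rfl ψ

theorem inner_trunc_left (x : ℕ → E) (n : ℕ) (ψ η : E) : inner ℂ (S.trunc x n ψ) η =
    ∑ k ∈ Finset.range n, (inner ℂ ψ (S.b k) : ℂ) * inner ℂ (x k) η := by
  rw [trunc_apply, sum_inner]
  refine Finset.sum_congr rfl fun k _ => ?_
  rw [inner_smul_left, inner_conj_symm]

theorem inner_trunc_right (x : ℕ → E) (n : ℕ) (ψ η : E) : inner ℂ ψ (S.trunc x n η) =
    ∑ k ∈ Finset.range n, (inner ℂ ψ (x k) : ℂ) * inner ℂ (S.b k) η := by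
  rw [trunc_apply, inner_sum]
  refine Finset.sum_congr rfl fun k _ => ?_
  rw [inner_smul_right, mul_comm]

theorem inner_proj_left (n : ℕ) (ψ η : E) :
    inner ℂ (S.proj n ψ) η = (inner ℂ ψ (S.proj n η) : ℂ) := by
  rw [proj, inner_trunc_left, inner_trunc_right]

theorem inner_diag_left (n : ℕ) (ψ η : E) :
    inner ℂ (S.diag n ψ) η = (inner ℂ ψ (S.diag n η) : ℂ) := by
  rw [diag, inner_trunc_left, inner_trunc_right]
  refine Finset.sum_congr rfl fun k _ => ?_
  rw [inner_smul_left, inner_smul_right, Complex.conj_ofReal]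
  ring

theorem hasSum_norm_sq (ψ : E) : HasSum (fun k => ‖inner ℂ (S.b k) ψ‖ ^ 2) (‖ψ‖ ^ 2) :=
  hasSum_norm_inner_sq S.b ψ

theorem norm_le_of_coeff_le {x y : E} (h : ∀ k, ‖inner ℂ (S.b k) x‖ ≤ ‖inner ℂ (S.b k) y‖) :
    ‖x‖ ≤ ‖y‖ := by
  refine abs_le_of_sq_le_sq' ?_ (norm_nonneg _) |>.2
  exact hasSum_le (fun k => pow_le_pow_left₀ (norm_nonneg _) (h k) 2) (S.hasSum_norm_sq x)
    (S.hasSum_norm_sq y)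

theorem norm_proj_le (n : ℕ) (ψ : E) : ‖S.proj n ψ‖ ≤ ‖ψ‖ := by
  refine S.norm_le_of_coeff_le fun k => ?_
  rw [inner_basis_proj]
  split_ifs
  · exact le_rfl
  · rw [norm_zero]; exact norm_nonneg _

theorem norm_diag_le_of_le {n m : ℕ} (h : n ≤ m) (ψ : E) : ‖S.diag n ψ‖ ≤ ‖S.diag m ψ‖ := by
  rw [← S.proj_diag_of_le h]
  exact S.norm_proj_le _ _

theorem norm_proj_le_diag (n : ℕ) (ψ : E) : ‖S.proj n ψ‖ ≤ ‖S.diag n ψ‖ := by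
  refine S.norm_le_of_coeff_le fun k => ?_
  rw [inner_basis_proj, inner_basis_diag]
  split_ifs
  · rw [norm_mul, Complex.norm_real]
    exact le_mul_of_one_le_left (norm_nonneg _) ((S.one_le_lam k).trans (le_abs_self _))
  · exact le_rfl

theorem tendsto_proj (ψ : E) : Tendsto (fun n => S.proj n ψ) atTop (𝓝 ψ) := by
  have h := (S.b.hasSum_repr ψ).tendsto_sum_nat
  refine h.congr fun n => ?_
  rw [proj, trunc_apply]
  simp only [S.b.repr_apply_apply]

theorem dense_setOf_proj : Dense {ψ : E | ∃ m, S.proj m ψ = ψ} := by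
  intro ψ
  refine mem_closure_of_tendsto (S.tendsto_proj ψ) (Eventually.of_forall fun n => ?_)
  exact ⟨n, S.proj_proj_of_le le_rfl ψ⟩

/-- Expanding both sides in the basis leaves the finite matrix ⟨b j, v k⟩, which is Hermitian by
`symm`. -/
theorem proj_pert_symm (n : ℕ) (ψ η : E) :
    inner ℂ (S.proj n (S.pert n ψ)) η = (inner ℂ ψ (S.proj n (S.pert n η)) : ℂ) := by
  rw [inner_proj_left, ← inner_proj_left S n ψ, pert, inner_trunc_left, inner_trunc_right]
  have h1 : ∀ k, (inner ℂ (S.v k) (S.proj n η) : ℂ) =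
      ∑ j ∈ Finset.range n, inner ℂ (S.v k) (S.b j) * inner ℂ (S.b j) η := fun k =>
    S.inner_trunc_right _ n _ η
  have h2 : ∀ j, (inner ℂ (S.proj n ψ) (S.v j) : ℂ) =
      ∑ k ∈ Finset.range n, inner ℂ ψ (S.b k) * inner ℂ (S.b k) (S.v j) := fun j =>
    S.inner_trunc_left _ n ψ _
  simp only [h1, h2, Finset.mul_sum, Finset.sum_mul]
  rw [Finset.sum_comm]
  refine Finset.sum_congr rfl fun j _ => Finset.sum_congr rfl fun k _ => ?_
  rw [S.symm k j]
  ring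

/-! ### Galerkin truncations and the pairing estimate -/

variable [CompleteSpace E]

/-- The Galerkin truncation of the diagonal operator plus `w` times the perturbation. -/
noncomputable def gal (n : ℕ) (w : ℝ) : selfAdjoint (E →L[ℂ] E) :=
  ⟨S.diag n + (w : ℂ) • (S.proj n ∘L S.pert n), by
    rw [selfAdjoint.mem_iff, ← isSelfAdjoint_iff,
      ContinuousLinearMap.isSelfAdjoint_iff_isSymmetric]
    intro ψ η
    simp only [ContinuousLinearMap.coe_coe, add_apply,
      smul_apply, ContinuousLinearMap.comp_apply, inner_add_left,
      inner_add_right, inner_smul_left, inner_smul_right, Complex.conj_ofReal, S.inner_diag_left,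
      S.proj_pert_symm]⟩

theorem gal_apply (n : ℕ) (w : ℝ) (ψ : E) :
    (S.gal n w : E →L[ℂ] E) ψ = S.diag n ψ + (w : ℂ) • S.proj n (S.pert n ψ) := rfl

theorem proj_gal (n : ℕ) (w : ℝ) (ψ : E) :
    S.proj n ((S.gal n w : E →L[ℂ] E) ψ) = (S.gal n w : E →L[ℂ] E) (S.proj n ψ) := by
  rw [gal_apply, gal_apply, map_add, map_smul, S.proj_diag, S.proj_proj_of_le le_rfl, S.diag_proj,
    S.pert_proj]

theorem proj_gal_self (n : ℕ) (w : ℝ) (ψ : E) :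
    S.proj n ((S.gal n w : E →L[ℂ] E) ψ) = (S.gal n w : E →L[ℂ] E) ψ := by
  rw [gal_apply, map_add, map_smul, S.proj_diag, S.proj_proj_of_le le_rfl]

theorem norm_gal_le (n : ℕ) {w M : ℝ} (hw : |w| ≤ M) (ψ : E) :
    ‖(S.gal n w : E →L[ℂ] E) ψ‖ ≤ (1 + M * S.K) * ‖S.diag n ψ‖ := by
  rw [gal_apply]
  refine (norm_add_le _ _).trans ?_
  rw [norm_smul, Complex.norm_real, add_mul, one_mul, mul_assoc]
  gcongr
  · exact (abs_nonneg w).trans hw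
  · exact hw
  · exact (S.norm_proj_le _ _).trans (S.norm_pert_le _ _)

/-- The propagator of the Galerkin truncation for a piecewise constant control. -/
noncomputable def galProp (n : ℕ) (w : ℕ → ℝ) (h t : ℝ) : E ≃ₗᵢ[ℂ] E :=
  propag (fun k => S.gal n (w k)) h t

theorem proj_galProp (n : ℕ) (w : ℕ → ℝ) (h t : ℝ) (ψ : E) :
    S.proj n (S.galProp n w h t ψ) = S.galProp n w h t (S.proj n ψ) :=
  propag_commute (fun k ψ => S.proj_gal n (w k) ψ) h t ψ

theorem galProp_zero (n : ℕ) (w : ℕ → ℝ) (h : ℝ) (ψ : E) : S.galProp n w h 0 ψ = ψ :=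
  propag_zero _ ψ

theorem galProp_eq_integral (n : ℕ) (w : ℕ → ℝ) {h t : ℝ} (hh : 0 < h) (ht : 0 ≤ t) (ψ : E) :
    IntervalIntegrable (fun s => (-Complex.I) • (S.gal n (w ⌊s / h⌋₊) : E →L[ℂ] E)
      (S.galProp n w h s ψ)) volume 0 t ∧
    S.galProp n w h t ψ = ψ + ∫ s in (0 : ℝ)..t, (-Complex.I) •
      (S.gal n (w ⌊s / h⌋₊) : E →L[ℂ] E) (S.galProp n w h s ψ) :=
  propag_eq_integral (fun k => S.gal n (w k)) hh ht ψ

theorem galProp_continuousOn (n : ℕ) (w : ℕ → ℝ) {h T : ℝ} (hh : 0 < h) (hT : 0 ≤ T) (ψ : E) :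
    ContinuousOn (fun t => S.galProp n w h t ψ) (Icc 0 T) := by
  have h1 := (S.galProp_eq_integral n w hh hT ψ).1
  rw [intervalIntegrable_iff_integrableOn_Icc_of_le hT, ← uIcc_of_le hT] at h1
  have h2 := intervalIntegral.continuousOn_primitive_interval h1
  rw [uIcc_of_le hT] at h2
  refine (continuousOn_const (c := ψ) |>.add h2).congr fun t ht => ?_
  exact (S.galProp_eq_integral n w hh ht.1 ψ).2

theorem intervalIntegrable_of_measurable_of_bounded {u : ℝ → ℝ} (hu : Measurable u) {B : ℝ}
    (hB : ∀ t, |u t| ≤ B) (s t : ℝ) : IntervalIntegrable (fun x => (u x : ℂ)) volume s t := by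
  have : IntervalIntegrable (fun _ : ℝ => B) volume s t := intervalIntegrable_const
  refine this.mono_fun' (Complex.measurable_ofReal.comp hu).aestronglyMeasurable
    (Eventually.of_forall fun x => ?_)
  change ‖((u x : ℝ) : ℂ)‖ ≤ B
  rw [Complex.norm_real]
  exact hB x

/-- The pairing of a Galerkin propagator with a curve which solves the weak equation, tested
against the basis vectors with index below the order of the truncation. -/
theorem norm_inner_galProp_sub_le (n : ℕ) {w : ℕ → ℝ} {h T M B : ℝ} (hh : 0 < h) (hT : 0 ≤ T)
    (hw : ∀ k, |w k| ≤ M) {u : ℝ → ℝ} (hu : Measurable u) (hB : ∀ t, |u t| ≤ B) {z : ℝ → E}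
    (hz : ContinuousOn z (Icc 0 T))
    (hweak : ∀ k < n, ∀ t ∈ Icc 0 T, inner ℂ (S.b k) (z t) = inner ℂ (S.b k) (z 0) +
      ∫ s in (0 : ℝ)..t, (-Complex.I) *
        ((S.lam k : ℂ) * inner ℂ (S.b k) (z s) + (u s : ℂ) * inner ℂ (S.v k) (z s)))
    {ψ : E} (hψ : S.proj n ψ = ψ) {g : ℝ → ℝ} (hg : IntervalIntegrable g volume 0 T)
    (hle : ∀ s ∈ Icc 0 T, |w ⌊s / h⌋₊ - u s| * (‖S.pert n (S.galProp n w h s ψ)‖ * ‖z s‖) +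
      |u s| * ‖(inner ℂ (S.pert n (S.galProp n w h s ψ)) (z s - S.proj n (z s)) : ℂ)‖ ≤ g s) :
    ‖(inner ℂ (S.galProp n w h T ψ) (z T) : ℂ) - inner ℂ ψ (z 0)‖ ≤ ∫ s in (0 : ℝ)..T, g s := by
  set y : ℝ → E := fun s => S.galProp n w h s ψ with hy
  have hPy : ∀ s, S.proj n (y s) = y s := fun s => by
    rw [hy]; simp only [S.proj_galProp, hψ]
  obtain ⟨Z, hZ⟩ := isCompact_Icc.exists_bound_of_continuousOn hz
  have hB0 : 0 ≤ B := (abs_nonneg _).trans (hB 0)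
  have hM0 : 0 ≤ M := (abs_nonneg _).trans (hw 0)
  set a : ℝ → E → E := fun s x => (S.gal n (w ⌊s / h⌋₊) : E →L[ℂ] E) x with ha
  set f : ℕ → ℝ → ℂ := fun k t => inner ℂ (y t) (S.b k) with hf
  set F : ℕ → ℝ → ℂ := fun k s => Complex.I * inner ℂ (a s (y s)) (S.b k) with hF
  set G : ℕ → ℝ → ℂ := fun k s => (-Complex.I) *
    ((S.lam k : ℂ) * inner ℂ (S.b k) (z s) + (u s : ℂ) * inner ℂ (S.v k) (z s)) with hG
  -- The product rule is applied mode by mode, since the weak equation for z is known only against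
  -- basis vectors.
  have hproduct : ∀ k < n, IntervalIntegrable
      (fun s => F k s * inner ℂ (S.b k) (z s) + f k s * G k s) volume 0 T ∧
      f k T * inner ℂ (S.b k) (z T) = f k 0 * inner ℂ (S.b k) (z 0) +
        ∫ s in (0 : ℝ)..T, (F k s * inner ℂ (S.b k) (z s) + f k s * G k s) := by
    intro k hk
    let L : E →L[ℝ] ℂ := (Complex.conjCLE : ℂ →L[ℝ] ℂ) ∘L
      ((innerSL ℂ (S.b k)).restrictScalars ℝ)
    have hL : ∀ x, L x = inner ℂ x (S.b k) := fun x => by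
      simp only [L, ContinuousLinearMap.comp_apply, ContinuousLinearMap.coe_restrictScalars',
        innerSL_apply_apply]
      exact inner_conj_symm _ _
    have hLF : ∀ s, L ((-Complex.I) • a s (y s)) = F k s := fun s => by
      rw [hL, inner_smul_left]
      simp [hF]
    have hint : ∀ t ∈ Icc 0 T, IntervalIntegrable (F k) volume 0 t ∧
        f k t = f k 0 + ∫ s in (0 : ℝ)..t, F k s := by
      intro t ht
      obtain ⟨h1, h2⟩ := S.galProp_eq_integral n w hh ht.1 ψ
      have h3 := ContinuousLinearMap.intervalIntegral_comp_comm L h1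
      have h4 : IntervalIntegrable (F k) volume 0 t := by
        have := L.integrable_comp h1.1
        have h6 := L.integrable_comp h1.2
        exact ⟨this.congr (Eventually.of_forall hLF), h6.congr (Eventually.of_forall hLF)⟩
      refine ⟨h4, ?_⟩
      have h5 := congrArg L h2
      rw [map_add, ← h3, hL, hL] at h5
      simp only [hf]
      rw [show y t = S.galProp n w h t ψ from rfl, h5,
        show y 0 = ψ from S.galProp_zero n w h ψ]
      congr 1
      exact intervalIntegral.integral_congr fun s _ => hLF s
    have hGi : IntervalIntegrable (G k) volume 0 T := by
      have hc : ∀ x : E, ContinuousOn (fun s => (inner ℂ x (z s) : ℂ)) (uIcc 0 T) := by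
        intro x
        rw [uIcc_of_le hT]
        exact continuousOn_const.inner hz
      have h1 : IntervalIntegrable (fun s => (S.lam k : ℂ) * inner ℂ (S.b k) (z s)) volume 0 T :=
        (continuousOn_const.mul (hc _)).intervalIntegrable
      have h2 : IntervalIntegrable (fun s => (u s : ℂ) * inner ℂ (S.v k) (z s)) volume 0 T :=
        (intervalIntegrable_of_measurable_of_bounded hu hB 0 T).mul_continuousOn (hc _)
      exact (h1.add h2).const_mul _
    have hb1 : ‖S.b k‖ = 1 := S.b.orthonormal.1 k
    have hFb : ∀ s ∈ Icc 0 T, ‖F k s‖ ≤ (1 + M * S.K) * (‖S.diag n‖ * ‖ψ‖) := by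
      intro s _
      rw [hF, norm_mul, Complex.norm_I, one_mul]
      refine (norm_inner_le_norm _ _).trans ?_
      rw [hb1, mul_one]
      refine (S.norm_gal_le n (hw _) _).trans ?_
      have h1 := (S.diag n).le_opNorm (y s)
      rw [show ‖y s‖ = ‖ψ‖ from LinearIsometryEquiv.norm_map _ _] at h1
      have : 0 ≤ M * S.K := mul_nonneg hM0 S.K_nonneg
      gcongr
    have hGb : ∀ s ∈ Icc 0 T, ‖G k s‖ ≤ |S.lam k| * Z + B * (‖S.v k‖ * Z) := by
      intro s hs
      rw [hG, norm_mul, norm_neg, Complex.norm_I, one_mul]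
      refine (norm_add_le _ _).trans ?_
      rw [norm_mul, norm_mul, Complex.norm_real, Complex.norm_real]
      have hZs := hZ s hs
      have h1 : ‖(inner ℂ (S.b k) (z s) : ℂ)‖ ≤ Z := by
        refine (norm_inner_le_norm _ _).trans ?_
        rw [hb1, one_mul]; exact hZs
      have h2 : ‖(inner ℂ (S.v k) (z s) : ℂ)‖ ≤ ‖S.v k‖ * Z :=
        (norm_inner_le_norm _ _).trans (by gcongr)
      rw [Real.norm_eq_abs, Real.norm_eq_abs]
      have := hB s
      gcongr
    exact mul_eq_add_integral_of_bounded hT (hint T ⟨hT, le_rfl⟩).1 hGi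
      (fun s hs => (hFb s hs).trans (le_max_left _ _))
      (fun s hs => (hGb s hs).trans (le_max_right _ _)) (fun t ht => (hint t ht).2)
      (fun t ht => hweak k hk t ht)
  have hsum : ∀ t, (inner ℂ (y t) (z t) : ℂ) =
      ∑ k ∈ Finset.range n, f k t * inner ℂ (S.b k) (z t) := by
    intro t
    conv_lhs => rw [← hPy t]
    exact S.inner_trunc_left _ n _ _
  -- The diagonal parts cancel. The perturbation leaves the difference of the controls, seen on the
  -- first n modes, and the coupling of these modes to the tail of z.
  have hpt : ∀ s, ∑ k ∈ Finset.range n, (F k s * inner ℂ (S.b k) (z s) + f k s * G k s) =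
      Complex.I * (((w ⌊s / h⌋₊ - u s : ℝ) : ℂ) * inner ℂ (S.pert n (y s)) (S.proj n (z s)) -
        (u s : ℂ) * inner ℂ (S.pert n (y s)) (z s - S.proj n (z s))) := by
    intro s
    rw [Finset.sum_add_distrib]
    have h1 : ∑ k ∈ Finset.range n, F k s * inner ℂ (S.b k) (z s) =
        Complex.I * inner ℂ (a s (y s)) (z s) := by
      have hP : S.proj n (a s (y s)) = a s (y s) := S.proj_gal_self _ _ _
      conv_rhs => rw [← hP]
      rw [proj, inner_trunc_left, Finset.mul_sum]
      exact Finset.sum_congr rfl fun k _ => by rw [hF]; ring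
    have h2 : ∑ k ∈ Finset.range n, f k s * G k s = (-Complex.I) *
        (inner ℂ (S.diag n (y s)) (z s) + (u s : ℂ) * inner ℂ (S.pert n (y s)) (z s)) := by
      rw [diag, pert, inner_trunc_left, inner_trunc_left, Finset.mul_sum,
        ← Finset.sum_add_distrib, Finset.mul_sum]
      refine Finset.sum_congr rfl fun k _ => ?_
      rw [inner_smul_left, Complex.conj_ofReal, hG, hf]
      ring
    rw [h1, h2, ha]
    simp only [gal_apply, inner_add_left, inner_smul_left, Complex.conj_ofReal, inner_proj_left,
      inner_sub_right]
    push_cast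
    ring
  have h0 : y 0 = ψ := S.galProp_zero n w h ψ
  have hmain : (inner ℂ (y T) (z T) : ℂ) - inner ℂ ψ (z 0) = ∫ s in (0 : ℝ)..T,
      ∑ k ∈ Finset.range n, (F k s * inner ℂ (S.b k) (z s) + f k s * G k s) := by
    rw [intervalIntegral.integral_finsetSum fun k hk => (hproduct k (Finset.mem_range.1 hk)).1,
      ← h0, hsum, hsum, ← Finset.sum_sub_distrib]
    refine Finset.sum_congr rfl fun k hk => ?_
    rw [(hproduct k (Finset.mem_range.1 hk)).2]
    ring
  change ‖(inner ℂ (y T) (z T) : ℂ) - inner ℂ ψ (z 0)‖ ≤ _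
  rw [hmain]
  refine intervalIntegral.norm_integral_le_of_norm_le hT ?_ hg
  refine Eventually.of_forall fun s hs => ?_
  rw [hpt, norm_mul, Complex.norm_I, one_mul]
  refine (norm_sub_le _ _).trans (le_trans ?_ (hle s ⟨hs.1.le, hs.2⟩))
  rw [norm_mul, norm_mul, Complex.norm_real, Complex.norm_real]
  refine add_le_add (mul_le_mul_of_nonneg_left ?_ (abs_nonneg _)) le_rfl
  refine (norm_inner_le_norm _ _).trans ?_
  exact mul_le_mul_of_nonneg_left (S.norm_proj_le _ _) (norm_nonneg _)

end DiagModel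

/-! ### Limits of unitary operators -/

section UnitaryLimits

variable {E : Type*} [NormedAddCommGroup E] [InnerProductSpace ℂ E]

/-- For vectors of norm r one has ‖x - y‖² = 2(r² - Re⟨x, y⟩). Unitarity thus turns every estimate
of inner products into one of distances. -/
theorem norm_sub_sq_le_of_inner {x y : E} {r β : ℝ} (hx : ‖x‖ = r) (hy : ‖y‖ = r)
    (h : ‖(inner ℂ x y : ℂ) - (r : ℂ) ^ 2‖ ≤ β) : ‖x - y‖ ^ 2 ≤ 2 * β := by
  have h1 := @norm_sub_sq ℂ E _ _ _ x y
  have h2 := (Complex.abs_re_le_norm _).trans h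
  rw [Complex.sub_re] at h2
  have h3 : (((r : ℂ) ^ 2).re) = r ^ 2 := by norm_cast
  rw [h3] at h2
  have h4 := (abs_le.1 h2).1
  rw [h1, hx, hy]
  change r ^ 2 - 2 * (inner ℂ x y : ℂ).re + r ^ 2 ≤ 2 * β
  linarith

theorem cauchySeq_of_inner {x : ℕ → E} {r : ℝ} {β : ℕ → ℝ} {m : ℕ} (hx : ∀ n, ‖x n‖ = r)
    (hβ : Tendsto β atTop (𝓝 0))
    (h : ∀ n p, m ≤ n → n ≤ p → ‖(inner ℂ (x n) (x p) : ℂ) - (r : ℂ) ^ 2‖ ≤ β n + β p) :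
    CauchySeq x := by
  rw [Metric.cauchySeq_iff']
  intro ε hε
  -- The squared distance is at most twice the sum of two errors, so ε²/4 for each one suffices.
  obtain ⟨N, hN⟩ := ((hβ.eventually_lt_const (show (0 : ℝ) < ε ^ 2 / 4 by positivity)).and
    (eventually_ge_atTop m)).exists_forall_of_atTop
  refine ⟨N, fun n hn => ?_⟩
  have h1 := norm_sub_sq_le_of_inner (hx N) (hx n) (h N n (hN N le_rfl).2 hn)
  have h2 := (hN N le_rfl).1
  have h3 := (hN n hn).1
  rw [dist_comm, dist_eq_norm]
  exact lt_of_pow_lt_pow_left₀ 2 hε.le (by linarith)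

theorem cauchySeq_of_dense {U : ℕ → E ≃ₗᵢ[ℂ] E} {D : Set E} (hD : Dense D)
    (h : ∀ ψ ∈ D, CauchySeq fun n => U n ψ) (ψ : E) : CauchySeq fun n => U n ψ := by
  rw [Metric.cauchySeq_iff']
  intro ε hε
  obtain ⟨χ, hχ, hd⟩ := Metric.dense_iff.1 hD ψ (ε / 3) (by positivity)
  obtain ⟨N, hN⟩ := Metric.cauchySeq_iff'.1 (h _ hd) (ε / 3) (by positivity)
  refine ⟨N, fun n hn => ?_⟩
  have h1 : dist (U n ψ) (U n χ) < ε / 3 := by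
    rw [(U n).isometry.dist_eq, dist_comm]; exact hχ
  have h2 : dist (U N χ) (U N ψ) < ε / 3 := by
    rw [(U N).isometry.dist_eq]; exact hχ
  have h3 := dist_triangle4 (U n ψ) (U n χ) (U N χ) (U N ψ)
  have h4 := hN n hn
  linarith

theorem tendsto_of_dense {U : ℕ → E ≃ₗᵢ[ℂ] E} {V : E ≃ₗᵢ[ℂ] E} {D : Set E} (hD : Dense D)
    (h : ∀ ψ ∈ D, Tendsto (fun n => U n ψ) atTop (𝓝 (V ψ))) (ψ : E) :
    Tendsto (fun n => U n ψ) atTop (𝓝 (V ψ)) := by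
  rw [Metric.tendsto_atTop]
  intro ε hε
  obtain ⟨χ, hχ, hd⟩ := Metric.dense_iff.1 hD ψ (ε / 3) (by positivity)
  obtain ⟨N, hN⟩ := Metric.tendsto_atTop.1 (h _ hd) (ε / 3) (by positivity)
  refine ⟨N, fun n hn => ?_⟩
  have h1 : dist (U n ψ) (U n χ) < ε / 3 := by
    rw [(U n).isometry.dist_eq, dist_comm]; exact hχ
  have h2 : dist (V χ) (V ψ) < ε / 3 := by
    rw [V.isometry.dist_eq]; exact hχ
  have h3 := dist_triangle4 (U n ψ) (U n χ) (V χ) (V ψ)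
  have h4 := hN n hn
  linarith

theorem tendsto_apply_of_tendsto {U : ℕ → E ≃ₗᵢ[ℂ] E} {x : ℕ → E} {y l : E}
    (hU : Tendsto (fun n => U n y) atTop (𝓝 l)) (hx : Tendsto x atTop (𝓝 y)) :
    Tendsto (fun n => U n (x n)) atTop (𝓝 l) := by
  have h : Tendsto (fun n => U n (x n) - U n y) atTop (𝓝 0) := by
    rw [tendsto_zero_iff_norm_tendsto_zero]
    have := tendsto_iff_norm_sub_tendsto_zero.1 hx
    refine this.congr fun n => ?_
    rw [← map_sub, LinearIsometryEquiv.norm_map]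
  have := h.add hU
  simpa using this

/-- A strong limit of unitary operators is an isometry but may fail to be onto. Convergence of the
inverses provides preimages, which is why stability is required in both directions. -/
theorem exists_linearIsometryEquiv_limit [CompleteSpace E] {U : ℕ → E ≃ₗᵢ[ℂ] E}
    (h1 : ∀ ψ, CauchySeq fun n => U n ψ) (h2 : ∀ ψ, CauchySeq fun n => (U n).symm ψ) :
    ∃ V : E ≃ₗᵢ[ℂ] E, ∀ ψ, Tendsto (fun n => U n ψ) atTop (𝓝 (V ψ)) := by
  choose V hV using fun ψ => cauchySeq_tendsto_of_complete (h1 ψ)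
  choose W hW using fun ψ => cauchySeq_tendsto_of_complete (h2 ψ)
  let V' : E →ₗᵢ[ℂ] E :=
    { toFun := V
      map_add' := fun x y => tendsto_nhds_unique (hV (x + y)) (by
        simp only [map_add]; exact (hV x).add (hV y))
      map_smul' := fun c x => tendsto_nhds_unique (hV (c • x)) (by
        simp only [map_smul]; exact (hV x).const_smul c)
      norm_map' := fun x => tendsto_nhds_unique (hV x).norm (by
        simp only [LinearIsometryEquiv.norm_map]; exact tendsto_const_nhds) }
  have hsurj : Function.Surjective V' := fun φ => ⟨W φ, by
    have h := tendsto_apply_of_tendsto (hV (W φ)) (hW φ)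
    simp only [LinearIsometryEquiv.apply_symm_apply] at h
    exact tendsto_nhds_unique h tendsto_const_nhds⟩
  exact ⟨LinearIsometryEquiv.ofSurjective V' hsurj, hV⟩

end UnitaryLimits

/-! ### Convergence of the Galerkin propagators and properties of the limit -/

namespace DiagModel

variable {E : Type*} [NormedAddCommGroup E] [InnerProductSpace ℂ E] [CompleteSpace E]
  (S : DiagModel E)

/-- The time step of the `n`-th approximation of a control. -/
noncomputable def mesh (n : ℕ) : ℝ := 1 / ((n : ℝ) + 1)

theorem mesh_pos (n : ℕ) : 0 < mesh n := by unfold mesh; positivity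

/-- The Galerkin propagators are bounded in the graph norm, uniformly for the piecewise constant
controls with values in `[-M, M]` and bounded total variation. -/
def Stable (M : ℝ) : Prop :=
  ∀ τ T : ℝ, ∃ C : ℝ, 0 ≤ C ∧ ∀ (n : ℕ) (w : ℕ → ℝ) (h t : ℝ), 0 < h → t ∈ Icc 0 T →
    (∀ k, |w k| ≤ M) → (∀ k, ∑ j ∈ Finset.range k, |w (j + 1) - w j| ≤ τ) → ∀ ψ : E,
      ‖S.diag n (S.galProp n w h t ψ)‖ ≤ C * ‖S.diag n ψ‖ ∧
        ‖S.diag n ψ‖ ≤ C * ‖S.diag n (S.galProp n w h t ψ)‖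

/-- The coupling of low modes to high modes is small relative to the graph norms. -/
def TailDecay : Prop :=
  ∃ eps : ℕ → ℝ, Tendsto eps atTop (𝓝 0) ∧ ∀ n m : ℕ, n ≤ m → ∀ y z : E,
    ‖(inner ℂ (S.pert n y) (S.proj m z - S.proj n z) : ℂ)‖ ≤
      eps n * (‖S.diag n y‖ * ‖S.diag m z‖)

/-- Piecewise constant approximations, bounded by `M` and with total variation at most `τ`, of a
control. -/
structure IsApprox (M τ : ℝ) (w : ℕ → ℕ → ℝ) (u : ℝ → ℝ) : Prop where
  abs_le : ∀ n k, |w n k| ≤ M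
  sum_le : ∀ n k, ∑ j ∈ Finset.range k, |w n (j + 1) - w n j| ≤ τ
  tendsto : ∀ᵐ t : ℝ, 0 ≤ t → Tendsto (fun n => w n ⌊t / mesh n⌋₊) atTop (𝓝 (u t))

/-- Weak solutions, tested against the basis vectors. -/
def WeakSol (u : ℝ → ℝ) (z : ℝ → E) : Prop :=
  ContinuousOn z (Ici 0) ∧ ∀ (k : ℕ) (t : ℝ), 0 ≤ t →
    inner ℂ (S.b k) (z t) = inner ℂ (S.b k) (z 0) + ∫ s in (0 : ℝ)..t, (-Complex.I) *
      ((S.lam k : ℂ) * inner ℂ (S.b k) (z s) + (u s : ℂ) * inner ℂ (S.v k) (z s))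

/-- `Υ` is the strong limit of the Galerkin propagators. -/
def IsLimit (w : ℕ → ℕ → ℝ) (Υ : ℝ → E ≃ₗᵢ[ℂ] E) : Prop :=
  ∀ t : ℝ, 0 ≤ t → ∀ ψ : E,
    Tendsto (fun n => S.galProp n (w n) (mesh n) t ψ) atTop (𝓝 (Υ t ψ))

theorem measurable_step (w : ℕ → ℝ) (h : ℝ) : Measurable fun s : ℝ => w ⌊s / h⌋₊ :=
  (measurable_from_nat (f := w)).comp (Nat.measurable_floor.comp (measurable_id.div_const h))

theorem intervalIntegrable_abs_sub {u v : ℝ → ℝ} (hu : Measurable u) (hv : Measurable v) {B B' : ℝ}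
    (hB : ∀ t, |u t| ≤ B) (hB' : ∀ t, |v t| ≤ B') (s t : ℝ) :
    IntervalIntegrable (fun x => |u x - v x|) volume s t := by
  have : IntervalIntegrable (fun _ : ℝ => B + B') volume s t := intervalIntegrable_const
  refine this.mono_fun' (hu.sub hv).abs.aestronglyMeasurable (Eventually.of_forall fun x => ?_)
  change ‖|u x - v x|‖ ≤ B + B'
  rw [Real.norm_eq_abs, abs_abs]
  exact (abs_sub _ _).trans (add_le_add (hB x) (hB' x))

variable {S} in
theorem IsApprox.tendsto_integral {M τ : ℝ} {w : ℕ → ℕ → ℝ} {u v : ℝ → ℝ}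
    (happ : IsApprox M τ w v) (hu : Measurable u) {B : ℝ} (hB : ∀ t, |u t| ≤ B) {t : ℝ}
    (ht : 0 ≤ t) :
    Tendsto (fun n => ∫ s in (0 : ℝ)..t, |w n ⌊s / mesh n⌋₊ - u s|) atTop
      (𝓝 (∫ s in (0 : ℝ)..t, |v s - u s|)) := by
  refine intervalIntegral.tendsto_integral_filter_of_dominated_convergence (fun _ => M + B)
    (Eventually.of_forall fun n => ?_) (Eventually.of_forall fun n => ?_)
    intervalIntegrable_const ?_
  · exact ((measurable_step _ _).sub hu).abs.aestronglyMeasurable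
  · refine Eventually.of_forall fun s _ => ?_
    rw [Real.norm_eq_abs, abs_abs]
    exact (abs_sub _ _).trans (add_le_add (happ.abs_le n _) (hB s))
  · filter_upwards [happ.tendsto] with s hs h
    rw [uIoc_of_le ht] at h
    exact ((hs h.1.le).sub_const _).abs

/-- For a trajectory inside the first n modes, the compression of the perturbation is invisible to a
test vector among these modes. A Galerkin trajectory of order p can therefore play the role of z in
the pairing estimate of any order n ≤ p. -/
theorem galProp_weak (n : ℕ) (w : ℕ → ℝ) {h t : ℝ} (hh : 0 < h) (ht : 0 ≤ t) {ψ : E}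
    (hψ : S.proj n ψ = ψ) {k : ℕ} (hk : k < n) :
    inner ℂ (S.b k) (S.galProp n w h t ψ) = inner ℂ (S.b k) ψ + ∫ s in (0 : ℝ)..t, (-Complex.I) *
      ((S.lam k : ℂ) * inner ℂ (S.b k) (S.galProp n w h s ψ) +
        (w ⌊s / h⌋₊ : ℂ) * inner ℂ (S.v k) (S.galProp n w h s ψ)) := by
  obtain ⟨h1, h2⟩ := S.galProp_eq_integral n w hh ht ψ
  have h3 := ContinuousLinearMap.intervalIntegral_comp_comm (innerSL ℂ (S.b k)) h1
  simp only [innerSL_apply_apply] at h3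
  conv_lhs => rw [h2, inner_add_right, ← h3]
  congr 1
  refine intervalIntegral.integral_congr fun s _ => ?_
  have hP : S.proj n (S.galProp n w h s ψ) = S.galProp n w h s ψ := by
    rw [S.proj_galProp, hψ]
  simp only [inner_smul_right, gal_apply, inner_add_right, inner_basis_diag, inner_basis_proj,
    if_pos hk]
  congr 3
  conv_rhs => rw [← hP]
  rw [pert, proj, inner_trunc_right, inner_trunc_right]
  exact Finset.sum_congr rfl fun j _ => by rw [S.symm]

/-- Almost conservation of inner products between Galerkin trajectories of different orders, uniform
over data bounded in the graph norm. This uniformity is needed for the inverses, whose data vary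
with n. -/
theorem exists_pair_bound {M τ : ℝ} (hst : S.Stable M) (htail : S.TailDecay) {w : ℕ → ℕ → ℝ}
    {u : ℝ → ℝ} (hu : Measurable u) {B : ℝ} (hB : ∀ t, |u t| ≤ B) (happ : IsApprox M τ w u)
    {t : ℝ} (ht : 0 ≤ t) :
    ∃ C : ℝ, 0 ≤ C ∧ ∃ β : ℕ → ℝ, Tendsto β atTop (𝓝 0) ∧
      (∀ n (ψ : E), ‖S.diag n ψ‖ ≤ C * ‖S.diag n (S.galProp n (w n) (mesh n) t ψ)‖) ∧
      (∀ n, 0 ≤ β n) ∧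
      ∀ n p, n ≤ p → ∀ ψ η : E, S.proj n ψ = ψ → S.proj p η = η →
        ‖(inner ℂ (S.galProp n (w n) (mesh n) t ψ) (S.galProp p (w p) (mesh p) t η) : ℂ) -
          inner ℂ ψ η‖ ≤ (β n + β p) * (‖S.diag n ψ‖ * ‖S.diag p η‖) := by
  obtain ⟨C, hC0, hC⟩ := hst τ t
  obtain ⟨eps, heps, htl⟩ := htail
  have hM0 : 0 ≤ M := (abs_nonneg _).trans (happ.abs_le 0 0)
  set d : ℕ → ℝ := fun n => ∫ s in (0 : ℝ)..t, |w n ⌊s / mesh n⌋₊ - u s| with hd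
  have hd0 : Tendsto d atTop (𝓝 0) := by
    have := happ.tendsto_integral hu hB ht
    simpa using this
  have hdn : ∀ n, 0 ≤ d n := fun n =>
    intervalIntegral.integral_nonneg ht fun s _ => abs_nonneg _
  have hK := S.K_nonneg
  -- The first term is the L¹ distance of the step control to u, the second the coupling to the
  -- tail; stability costs one factor C for each trajectory estimated in the graph norm.
  refine ⟨C, hC0, fun n => S.K * C * d n + t * (M * |eps n| * C ^ 2), ?_, fun n ψ => ?_,
    fun n => ?_, ?_⟩
  · have h1 := hd0.const_mul (S.K * C)
    have h2 := ((heps.abs.const_mul M).mul_const (C ^ 2)).const_mul t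
    have := h1.add h2
    simpa using this
  · exact (hC n (w n) (mesh n) t (mesh_pos n) ⟨ht, le_rfl⟩ (happ.abs_le n) (happ.sum_le n) ψ).2
  · have := hdn n
    positivity
  · intro n p hnp ψ η hψ hη
    set D := ‖S.diag n ψ‖ * ‖S.diag p η‖ with hD
    have hD0 : 0 ≤ D := by positivity
    have hstep : ∀ n s, |w n ⌊s / mesh n⌋₊| ≤ M := fun n s => happ.abs_le n _
    have hint := intervalIntegrable_abs_sub (measurable_step (w n) (mesh n))
      (measurable_step (w p) (mesh p)) (hstep n) (hstep p) 0 t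
    have hηD : ‖η‖ ≤ ‖S.diag p η‖ := by
      have := S.norm_proj_le_diag p η
      rwa [hη] at this
    have key := S.norm_inner_galProp_sub_le n (mesh_pos n) ht (happ.abs_le n)
      (measurable_step (w p) (mesh p)) (hstep p)
      (z := fun s => S.galProp p (w p) (mesh p) s η)
      (S.galProp_continuousOn p (w p) (mesh_pos p) ht η)
      (fun k hk s hs => by
        simp only [S.galProp_zero]
        exact S.galProp_weak p (w p) (mesh_pos p) hs.1 hη (hk.trans_le hnp))
      hψ (g := fun s => |w n ⌊s / mesh n⌋₊ - w p ⌊s / mesh p⌋₊| * (S.K * C * D) +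
        M * |eps n| * C ^ 2 * D)
      ((hint.mul_const _).add intervalIntegrable_const) ?_
    · simp only [S.galProp_zero] at key
      refine key.trans ?_
      rw [intervalIntegral.integral_add (hint.mul_const _) intervalIntegrable_const,
        intervalIntegral.integral_mul_const, intervalIntegral.integral_const, sub_zero, smul_eq_mul]
      have h1 : ∫ s in (0 : ℝ)..t, |w n ⌊s / mesh n⌋₊ - w p ⌊s / mesh p⌋₊| ≤ d n + d p := by
        rw [hd]
        have i1 := intervalIntegrable_abs_sub (measurable_step (w n) (mesh n)) hu (hstep n) hB 0 t
        have i2 := intervalIntegrable_abs_sub (measurable_step (w p) (mesh p)) hu (hstep p) hB 0 t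
        rw [← intervalIntegral.integral_add i1 i2]
        refine intervalIntegral.integral_mono_on ht hint (i1.add i2) fun s _ => ?_
        have := abs_sub_le (w n ⌊s / mesh n⌋₊) (u s) (w p ⌊s / mesh p⌋₊)
        rwa [abs_sub_comm (u s)] at this
      have h2 : 0 ≤ t * (M * |eps p| * C ^ 2) := by positivity
      calc (∫ s in (0 : ℝ)..t, |w n ⌊s / mesh n⌋₊ - w p ⌊s / mesh p⌋₊|) * (S.K * C * D) +
            t * (M * |eps n| * C ^ 2 * D)
          ≤ (d n + d p) * (S.K * C * D) + t * (M * |eps n| * C ^ 2 * D) := by gcongr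
        _ ≤ (d n + d p) * (S.K * C * D) + t * (M * |eps n| * C ^ 2 * D) +
            t * (M * |eps p| * C ^ 2) * D := le_add_of_nonneg_right (by positivity)
        _ = _ := by ring
    · intro s hs
      have e1 := (hC n (w n) (mesh n) s (mesh_pos n) hs (happ.abs_le n) (happ.sum_le n) ψ).1
      have e2 := (hC p (w p) (mesh p) s (mesh_pos p) hs (happ.abs_le p) (happ.sum_le p) η).1
      have hP : S.proj p (S.galProp p (w p) (mesh p) s η) = S.galProp p (w p) (mesh p) s η := by
        rw [S.proj_galProp, hη]
      refine add_le_add ?_ ?_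
      · refine mul_le_mul_of_nonneg_left ?_ (abs_nonneg _)
        rw [LinearIsometryEquiv.norm_map]
        calc ‖S.pert n (S.galProp n (w n) (mesh n) s ψ)‖ * ‖η‖
            ≤ (S.K * (C * ‖S.diag n ψ‖)) * ‖S.diag p η‖ := by
              gcongr
              exact (S.norm_pert_le _ _).trans (by gcongr)
          _ = S.K * C * D := by rw [hD]; ring
      · have h3 := htl n p hnp (S.galProp n (w n) (mesh n) s ψ)
          (S.galProp p (w p) (mesh p) s η)
        rw [hP] at h3
        calc |w p ⌊s / mesh p⌋₊| * _ ≤ M * (|eps n| * ((C * ‖S.diag n ψ‖) * (C * ‖S.diag p η‖))) := by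
              refine mul_le_mul (hstep p s) (h3.trans ?_) (norm_nonneg _) hM0
              have := le_abs_self (eps n)
              gcongr
          _ = M * |eps n| * C ^ 2 * D := by rw [hD]; ring

theorem exists_isLimit {M τ : ℝ} (hst : S.Stable M) (htail : S.TailDecay) {w : ℕ → ℕ → ℝ}
    {u : ℝ → ℝ} (hu : Measurable u) {B : ℝ} (hB : ∀ t, |u t| ≤ B) (happ : IsApprox M τ w u) :
    ∃ Υ : ℝ → E ≃ₗᵢ[ℂ] E, S.IsLimit w Υ := by
  have main : ∀ t : ℝ, ∃ V : E ≃ₗᵢ[ℂ] E, 0 ≤ t → ∀ ψ : E,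
      Tendsto (fun n => S.galProp n (w n) (mesh n) t ψ) atTop (𝓝 (V ψ)) := by
    intro t
    by_cases ht : 0 ≤ t
    swap
    · exact ⟨LinearIsometryEquiv.refl ℂ E, fun h => absurd h ht⟩
    obtain ⟨C, hC0, β, hβ, hlow, hβ0, hpair⟩ := S.exists_pair_bound hst htail hu hB happ ht
    suffices h : (∀ ψ, CauchySeq fun n => S.galProp n (w n) (mesh n) t ψ) ∧
        ∀ ψ, CauchySeq fun n => (S.galProp n (w n) (mesh n) t).symm ψ by
      obtain ⟨V, hV⟩ := exists_linearIsometryEquiv_limit h.1 h.2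
      exact ⟨V, fun _ => hV⟩
    constructor
    · refine cauchySeq_of_dense S.dense_setOf_proj fun ψ ⟨m, hm⟩ => ?_
      refine cauchySeq_of_inner (r := ‖ψ‖) (m := m)
        (β := fun n => β n * (‖S.diag m ψ‖ * ‖S.diag m ψ‖))
        (fun n => LinearIsometryEquiv.norm_map _ _) (by simpa using hβ.mul_const _) ?_
      intro n p hn hp
      have h1 := hpair n p hp ψ ψ (S.proj_eq_self_of_le hn hm)
        (S.proj_eq_self_of_le (hn.trans hp) hm)
      rw [S.diag_eq_of_le hn hm, S.diag_eq_of_le (hn.trans hp) hm, inner_self_eq_norm_sq_to_K] at h1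
      rw [← add_mul]
      exact h1
    · refine cauchySeq_of_dense (U := fun n => (S.galProp n (w n) (mesh n) t).symm)
        S.dense_setOf_proj fun φ ⟨m, hm⟩ => ?_
      refine cauchySeq_of_inner (r := ‖φ‖) (m := m)
        (β := fun n => β n * ((C * ‖S.diag m φ‖) * (C * ‖S.diag m φ‖)))
        (fun n => LinearIsometryEquiv.norm_map _ _) (by simpa using hβ.mul_const _) ?_
      intro n p hn hp
      -- The pair bound is applied to the preimages of φ: they stay in the first q modes, and the
      -- lower half of stability bounds their graph norms. Both images equal φ, so the bound
      -- compares the preimages themselves.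
      have hproj : ∀ q, m ≤ q → S.proj q ((S.galProp q (w q) (mesh q) t).symm φ) =
          (S.galProp q (w q) (mesh q) t).symm φ := by
        intro q hq
        rw [LinearIsometryEquiv.eq_symm_apply, ← S.proj_galProp,
          LinearIsometryEquiv.apply_symm_apply, S.proj_eq_self_of_le hq hm]
      have hdiag : ∀ q, m ≤ q → ‖S.diag q ((S.galProp q (w q) (mesh q) t).symm φ)‖ ≤
          C * ‖S.diag m φ‖ := by
        intro q hq
        have := hlow q ((S.galProp q (w q) (mesh q) t).symm φ)
        rwa [LinearIsometryEquiv.apply_symm_apply, S.diag_eq_of_le hq hm] at this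
      have h1 := hpair n p hp _ _ (hproj n hn) (hproj p (hn.trans hp))
      rw [LinearIsometryEquiv.apply_symm_apply, LinearIsometryEquiv.apply_symm_apply,
        inner_self_eq_norm_sq_to_K, norm_sub_rev] at h1
      refine h1.trans ?_
      rw [← add_mul]
      have := hβ0 n
      have := hβ0 p
      exact mul_le_mul_of_nonneg_left (mul_le_mul (hdiag n hn) (hdiag p (hn.trans hp))
        (norm_nonneg _) (by positivity)) (by positivity)
  choose Υ hΥ using main
  exact ⟨Υ, hΥ⟩

variable {S}

/-- The untruncated diagonal operator is unbounded and cannot be passed to the limit directly. For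
fixed m the truncated one is bounded, and it is dominated by the truncation of order n ≥ m. -/
theorem IsLimit.norm_diag_le {M τ : ℝ} {w : ℕ → ℕ → ℝ} {u : ℝ → ℝ} {Υ : ℝ → E ≃ₗᵢ[ℂ] E}
    (hΥ : S.IsLimit w Υ) (happ : IsApprox M τ w u) {C T : ℝ} (hC0 : 0 ≤ C)
    (hC : ∀ (n : ℕ) (w : ℕ → ℝ) (h t : ℝ), 0 < h → t ∈ Icc 0 T →
      (∀ k, |w k| ≤ M) → (∀ k, ∑ j ∈ Finset.range k, |w (j + 1) - w j| ≤ τ) → ∀ ψ : E,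
      ‖S.diag n (S.galProp n w h t ψ)‖ ≤ C * ‖S.diag n ψ‖) {t : ℝ} (ht : t ∈ Icc 0 T) {ψ : E}
    {c : ℝ} (hc : ∀ n, ‖S.diag n ψ‖ ≤ c) (m : ℕ) : ‖S.diag m (Υ t ψ)‖ ≤ C * c := by
  have h1 : Tendsto (fun n => ‖S.diag m (S.galProp n (w n) (mesh n) t ψ)‖) atTop
      (𝓝 ‖S.diag m (Υ t ψ)‖) := (((S.diag m).continuous.tendsto _).comp (hΥ t ht.1 ψ)).norm
  refine le_of_tendsto h1 ?_
  filter_upwards [eventually_ge_atTop m] with n hn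
  refine (S.norm_diag_le_of_le hn _).trans ?_
  refine (hC n (w n) (mesh n) t (mesh_pos n) ht (happ.abs_le n) (happ.sum_le n) ψ).trans ?_
  gcongr
  exact hc n

theorem IsLimit.map_zero {w : ℕ → ℕ → ℝ} {Υ : ℝ → E ≃ₗᵢ[ℂ] E} (hΥ : S.IsLimit w Υ) (ψ : E) :
    Υ 0 ψ = ψ := by
  have := hΥ 0 le_rfl ψ
  simp only [S.galProp_zero] at this
  exact tendsto_nhds_unique this tendsto_const_nhds

/-- On finite combinations of basis vectors the approximations are locally Lipschitz in time with a
constant independent of n. Isometry then makes the approximation of a general vector uniform in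
time. -/
theorem IsLimit.continuousOn {M τ : ℝ} (hst : S.Stable M) {w : ℕ → ℕ → ℝ} {u : ℝ → ℝ}
    {Υ : ℝ → E ≃ₗᵢ[ℂ] E} (hΥ : S.IsLimit w Υ) (happ : IsApprox M τ w u) (ψ : E) :
    ContinuousOn (fun t => Υ t ψ) (Ici 0) := by
  have hfin : ∀ m (ψ : E), S.proj m ψ = ψ → ContinuousOn (fun t => Υ t ψ) (Ici 0) := by
    intro m ψ hm t₀ ht₀
    obtain ⟨C, hC0, hC⟩ := hst τ (t₀ + 1)
    have hM0 : 0 ≤ M := (abs_nonneg _).trans (happ.abs_le 0 0)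
    set L := (1 + M * S.K) * (C * ‖S.diag m ψ‖) with hL
    have hlip : ∀ s ∈ Icc 0 (t₀ + 1), ∀ t ∈ Icc 0 (t₀ + 1), ‖Υ t ψ - Υ s ψ‖ ≤ L * |t - s| := by
      intro s hs t ht
      refine le_of_tendsto ((hΥ t ht.1 ψ).sub (hΥ s hs.1 ψ)).norm ?_
      filter_upwards [eventually_ge_atTop m] with n hn
      obtain ⟨i1, e1⟩ := S.galProp_eq_integral n (w n) (mesh_pos n) ht.1 ψ
      obtain ⟨i2, e2⟩ := S.galProp_eq_integral n (w n) (mesh_pos n) hs.1 ψ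
      rw [e1, e2, add_sub_add_left_eq_sub, intervalIntegral.integral_interval_sub_left i1 i2]
      refine intervalIntegral.norm_integral_le_of_norm_le_const fun r hr => ?_
      have hr' : r ∈ Icc 0 (t₀ + 1) := by
        have h2 : uIcc s t ⊆ Icc 0 (t₀ + 1) := by
          rw [← uIcc_of_le (hs.1.trans hs.2)]
          exact uIcc_subset_uIcc (by rwa [uIcc_of_le (hs.1.trans hs.2)])
            (by rwa [uIcc_of_le (hs.1.trans hs.2)])
        exact h2 (uIoc_subset_uIcc hr)
      rw [norm_smul, norm_neg, Complex.norm_I, one_mul]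
      refine (S.norm_gal_le n (happ.abs_le n _) _).trans ?_
      have h3 := (hC n (w n) (mesh n) r (mesh_pos n) hr' (happ.abs_le n) (happ.sum_le n) ψ).1
      rw [S.diag_eq_of_le hn hm] at h3
      have : 0 ≤ 1 + M * S.K := by have := S.K_nonneg; positivity
      exact mul_le_mul_of_nonneg_left h3 this
    have ht₀' : (0 : ℝ) ≤ t₀ := ht₀
    have hmem : t₀ ∈ Icc 0 (t₀ + 1) := ⟨ht₀, by linarith⟩
    have h1 : Tendsto (fun t => L * |t - t₀|) (𝓝[Ici 0] t₀) (𝓝 0) := by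
      have : Continuous fun t => L * |t - t₀| := by fun_prop
      have h2 := (this.tendsto t₀).mono_left (nhdsWithin_le_nhds (s := Ici 0))
      simpa using h2
    refine tendsto_iff_norm_sub_tendsto_zero.2 (squeeze_zero' (Eventually.of_forall fun _ =>
      norm_nonneg _) ?_ h1)
    filter_upwards [self_mem_nhdsWithin,
      nhdsWithin_le_nhds (Iio_mem_nhds (show t₀ < t₀ + 1 by linarith))] with t h3 h4
    exact hlip t₀ hmem t ⟨h3, le_of_lt h4⟩
  have hunif : TendstoUniformlyOn (fun n t => Υ t (S.proj n ψ)) (fun t => Υ t ψ) atTop (Ici 0) := by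
    rw [Metric.tendstoUniformlyOn_iff]
    intro ε hε
    filter_upwards [Metric.tendsto_nhds.1 (S.tendsto_proj ψ) ε hε] with n hn t _
    rw [(Υ t).isometry.dist_eq, dist_comm]
    exact hn
  exact hunif.continuousOn (Frequently.of_forall fun n =>
    hfin n _ (S.proj_proj_of_le le_rfl ψ))

theorem IsLimit.weakSol {M τ : ℝ} (hst : S.Stable M) {w : ℕ → ℕ → ℝ} {u : ℝ → ℝ}
    {Υ : ℝ → E ≃ₗᵢ[ℂ] E} (hΥ : S.IsLimit w Υ) (happ : IsApprox M τ w u) (ψ : E) :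
    S.WeakSol u (fun t => Υ t ψ) := by
  refine ⟨hΥ.continuousOn hst happ ψ, fun k t ht => ?_⟩
  have hM0 : 0 ≤ M := (abs_nonneg _).trans (happ.abs_le 0 0)
  have hlim : ∀ s, 0 ≤ s → Tendsto (fun n => S.galProp n (w n) (mesh n) s (S.proj n ψ)) atTop
      (𝓝 (Υ s ψ)) := fun s hs => tendsto_apply_of_tendsto (hΥ s hs ψ) (S.tendsto_proj ψ)
  have hin : ∀ (x : E) (s : ℝ), 0 ≤ s →
      Tendsto (fun n => (inner ℂ x (S.galProp n (w n) (mesh n) s (S.proj n ψ)) : ℂ)) atTop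
      (𝓝 (inner ℂ x (Υ s ψ))) := fun x s hs => tendsto_const_nhds.inner (hlim s hs)
  simp only [hΥ.map_zero]
  have h1 : Tendsto (fun n => (inner ℂ (S.b k) (S.proj n ψ) : ℂ) + ∫ s in (0 : ℝ)..t,
      (-Complex.I) * ((S.lam k : ℂ) * inner ℂ (S.b k)
        (S.galProp n (w n) (mesh n) s (S.proj n ψ)) +
        (w n ⌊s / mesh n⌋₊ : ℂ) * inner ℂ (S.v k)
          (S.galProp n (w n) (mesh n) s (S.proj n ψ)))) atTop
      (𝓝 (inner ℂ (S.b k) (Υ t ψ))) := by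
    refine (hin (S.b k) t ht).congr' ?_
    filter_upwards [eventually_gt_atTop k] with n hn
    exact S.galProp_weak n (w n) (mesh_pos n) ht (S.proj_proj_of_le le_rfl ψ) hn
  -- The approximate weak equations pass to the limit by dominated convergence: norms are conserved
  -- and the step controls are bounded by M.
  refine tendsto_nhds_unique h1 ((tendsto_const_nhds.inner (S.tendsto_proj ψ)).add ?_)
  refine intervalIntegral.tendsto_integral_filter_of_dominated_convergence
    (fun _ => |S.lam k| * (‖S.b k‖ * ‖ψ‖) + M * (‖S.v k‖ * ‖ψ‖))
    (Eventually.of_forall fun n => ?_) (Eventually.of_forall fun n => ?_)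
    intervalIntegrable_const ?_
  · have hc := S.galProp_continuousOn n (w n) (mesh_pos n) ht (S.proj n ψ)
    have hm : ∀ x : E, AEStronglyMeasurable (fun s =>
        (inner ℂ x (S.galProp n (w n) (mesh n) s (S.proj n ψ)) : ℂ))
        (volume.restrict (uIoc 0 t)) := by
      intro x
      refine ((continuousOn_const.inner hc).mono ?_).aestronglyMeasurable measurableSet_uIoc
      rw [uIoc_of_le ht]
      exact Ioc_subset_Icc_self
    have hs : AEStronglyMeasurable (fun s => (w n ⌊s / mesh n⌋₊ : ℂ))
        (volume.restrict (uIoc 0 t)) :=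
      (Complex.measurable_ofReal.comp (measurable_step (w n) (mesh n))).aestronglyMeasurable
    exact (((hm _).const_mul _).add (hs.mul (hm _))).const_mul _
  · refine Eventually.of_forall fun s _ => ?_
    rw [norm_mul, norm_neg, Complex.norm_I, one_mul]
    refine (norm_add_le _ _).trans ?_
    rw [norm_mul, norm_mul, Complex.norm_real, Complex.norm_real, Real.norm_eq_abs,
      Real.norm_eq_abs]
    have hn : ‖S.galProp n (w n) (mesh n) s (S.proj n ψ)‖ ≤ ‖ψ‖ := by
      rw [LinearIsometryEquiv.norm_map]; exact S.norm_proj_le n ψ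
    have hx : ∀ x : E, ‖(inner ℂ x (S.galProp n (w n) (mesh n) s (S.proj n ψ)) : ℂ)‖ ≤
        ‖x‖ * ‖ψ‖ := fun x => (norm_inner_le_norm _ _).trans (by gcongr)
    have h2 := hx (S.b k)
    have h3 := hx (S.v k)
    have h4 := happ.abs_le n ⌊s / mesh n⌋₊
    gcongr
  · filter_upwards [happ.tendsto] with s hs hst
    rw [uIoc_of_le ht] at hst
    have hw := hs hst.1.le
    have hw' : Tendsto (fun n => (w n ⌊s / mesh n⌋₊ : ℂ)) atTop (𝓝 (u s : ℂ)) :=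
      (Complex.continuous_ofReal.tendsto _).comp hw
    exact (((hin _ s hst.1.le).const_mul _).add (hw'.mul (hin _ s hst.1.le))).const_mul _

/-- The propagator for the control `v`, paired with a weak solution for the control `u`. -/
theorem IsLimit.norm_inner_sub_le {M τ : ℝ} {w : ℕ → ℕ → ℝ} {u v : ℝ → ℝ}
    {Υ : ℝ → E ≃ₗᵢ[ℂ] E} (hΥ : S.IsLimit w Υ) (happ : IsApprox M τ w v)
    (hu : Measurable u) {B : ℝ} (hB : ∀ t, |u t| ≤ B) {z : ℝ → E} (hz : S.WeakSol u z)
    {C t Z : ℝ} (ht : 0 ≤ t) (hC0 : 0 ≤ C)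
    (hC : ∀ (n : ℕ) (w : ℕ → ℝ) (h s : ℝ), 0 < h → s ∈ Icc 0 t →
      (∀ k, |w k| ≤ M) → (∀ k, ∑ j ∈ Finset.range k, |w (j + 1) - w j| ≤ τ) → ∀ ψ : E,
      ‖S.diag n (S.galProp n w h s ψ)‖ ≤ C * ‖S.diag n ψ‖)
    (hZ : ∀ s ∈ Icc 0 t, ‖z s‖ ≤ Z) {m : ℕ} {ψ : E} (hm : S.proj m ψ = ψ) :
    ‖(inner ℂ (Υ t ψ) (z t) : ℂ) - inner ℂ ψ (z 0)‖ ≤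
      S.K * (C * ‖S.diag m ψ‖) * Z * ∫ s in (0 : ℝ)..t, |v s - u s| := by
  set D := S.K * (C * ‖S.diag m ψ‖) with hD
  have hK := S.K_nonneg
  have hD0 : 0 ≤ D := by positivity
  have hB0 : 0 ≤ B := (abs_nonneg _).trans (hB 0)
  have hZ0 : 0 ≤ Z := (norm_nonneg _).trans (hZ 0 ⟨le_rfl, ht⟩)
  have hzc : ContinuousOn z (Icc 0 t) := hz.1.mono Icc_subset_Ici_self
  have hstep : ∀ n s, |w n ⌊s / mesh n⌋₊| ≤ M := fun n s => happ.abs_le n _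
  have hzi : ∀ n, ContinuousOn (fun s => ‖z s - S.proj n (z s)‖) (uIcc 0 t) := fun n => by
    rw [uIcc_of_le ht]
    exact (hzc.sub ((S.proj n).continuous.comp_continuousOn hzc)).norm
  have hint : ∀ n, IntervalIntegrable (fun s => |w n ⌊s / mesh n⌋₊ - u s|) volume 0 t := fun n =>
    intervalIntegrable_abs_sub (measurable_step _ _) hu (hstep n) hB 0 t
  have hbound : ∀ᶠ n in atTop,
      ‖(inner ℂ (S.galProp n (w n) (mesh n) t ψ) (z t) : ℂ) - inner ℂ ψ (z 0)‖ ≤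
      D * Z * (∫ s in (0 : ℝ)..t, |w n ⌊s / mesh n⌋₊ - u s|) +
        B * D * ∫ s in (0 : ℝ)..t, ‖z s - S.proj n (z s)‖ := by
    filter_upwards [eventually_ge_atTop m] with n hn
    have key := S.norm_inner_galProp_sub_le n (mesh_pos n) ht (happ.abs_le n) hu hB hzc
      (fun k _ s hs => hz.2 k s hs.1) (S.proj_eq_self_of_le hn hm)
      (g := fun s => D * Z * |w n ⌊s / mesh n⌋₊ - u s| + B * D * ‖z s - S.proj n (z s)‖)
      (((hint n).const_mul _).add ((hzi n).intervalIntegrable.const_mul _)) ?_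
    · rwa [intervalIntegral.integral_add ((hint n).const_mul _)
        ((hzi n).intervalIntegrable.const_mul _), intervalIntegral.integral_const_mul,
        intervalIntegral.integral_const_mul] at key
    · intro s hs
      have e1 := hC n (w n) (mesh n) s (mesh_pos n) hs (happ.abs_le n) (happ.sum_le n) ψ
      rw [S.diag_eq_of_le hn hm] at e1
      have e2 : ‖S.pert n (S.galProp n (w n) (mesh n) s ψ)‖ ≤ D :=
        (S.norm_pert_le _ _).trans (by rw [hD]; gcongr)
      have e3 := hZ s hs
      refine add_le_add ?_ ?_
      · rw [mul_comm]
        gcongr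
      · rw [mul_assoc]
        refine mul_le_mul (hB s) ((norm_inner_le_norm _ _).trans (by gcongr)) (norm_nonneg _) hB0
  have hlim1 := (happ.tendsto_integral hu hB ht).const_mul (D * Z)
  -- A weak solution has no known graph bound, so there is no rate for its tail; pointwise
  -- convergence with domination by 2Z is enough.
  have hlim2 : Tendsto (fun n => ∫ s in (0 : ℝ)..t, ‖z s - S.proj n (z s)‖) atTop (𝓝 0) := by
    have : Tendsto (fun n => ∫ s in (0 : ℝ)..t, ‖z s - S.proj n (z s)‖) atTop
        (𝓝 (∫ s in (0 : ℝ)..t, (0 : ℝ))) := by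
      refine intervalIntegral.tendsto_integral_filter_of_dominated_convergence (fun _ => Z + Z)
        (Eventually.of_forall fun n => ?_) (Eventually.of_forall fun n => ?_)
        intervalIntegrable_const (Eventually.of_forall fun s hs => ?_)
      · exact ((hzi n).mono uIoc_subset_uIcc).aestronglyMeasurable measurableSet_uIoc
      · refine Eventually.of_forall fun s hs => ?_
        rw [uIoc_of_le ht] at hs
        have := hZ s (Ioc_subset_Icc_self hs)
        rw [norm_norm]
        exact (norm_sub_le _ _).trans (add_le_add this ((S.norm_proj_le n _).trans this))
      · have := (tendsto_const_nhds (x := z s)).sub (S.tendsto_proj (z s))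
        rw [sub_self] at this
        simpa using this.norm
    simpa using this
  have hl := ((hΥ t ht ψ).inner (tendsto_const_nhds (x := z t)) (𝕜 := ℂ)).sub_const
    (inner ℂ ψ (z 0) : ℂ)
  have hr := hlim1.add (hlim2.const_mul (B * D))
  rw [mul_zero, add_zero] at hr
  exact le_of_tendsto_of_tendsto hl.norm hr hbound

/-- When both controls agree, the pairing of the propagator with a weak solution is conserved
exactly, first on a dense set and then everywhere. Unitarity turns ⟨Υ ψ, z(t)⟩ = ⟨ψ, z(0)⟩ into the
formula for z(t). -/
theorem IsLimit.unique {M τ : ℝ} (hst : S.Stable M) {w : ℕ → ℕ → ℝ} {u : ℝ → ℝ}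
    {Υ : ℝ → E ≃ₗᵢ[ℂ] E} (hΥ : S.IsLimit w Υ) (happ : IsApprox M τ w u)
    (hu : Measurable u) {B : ℝ} (hB : ∀ t, |u t| ≤ B) {z : ℝ → E} (hz : S.WeakSol u z)
    {t : ℝ} (ht : 0 ≤ t) : z t = Υ t (z 0) := by
  obtain ⟨C, hC0, hC⟩ := hst τ t
  obtain ⟨Z, hZ⟩ := isCompact_Icc.exists_bound_of_continuousOn
    (hz.1.mono (Icc_subset_Ici_self : Icc 0 t ⊆ Ici 0))
  have h1 : ∀ ψ ∈ {ψ : E | ∃ m, S.proj m ψ = ψ},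
      (inner ℂ (Υ t ψ) (z t) : ℂ) = inner ℂ ψ (z 0) := by
    rintro ψ ⟨m, hm⟩
    have := hΥ.norm_inner_sub_le happ hu hB hz ht hC0
      (fun n w h s h1 h2 h3 h4 ψ => (hC n w h s h1 h2 h3 h4 ψ).1) hZ hm
    simp only [sub_self, abs_zero, intervalIntegral.integral_zero, mul_zero] at this
    exact sub_eq_zero.1 (norm_le_zero_iff.1 this)
  have h2 : ∀ ψ : E, (inner ℂ (Υ t ψ) (z t) : ℂ) = inner ℂ ψ (z 0) := by
    have := Continuous.ext_on (f := fun ψ => (inner ℂ (Υ t ψ) (z t) : ℂ))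
      (g := fun ψ => (inner ℂ ψ (z 0) : ℂ)) S.dense_setOf_proj
      ((Υ t).continuous.inner continuous_const) (continuous_id.inner continuous_const) h1
    exact fun ψ => congrFun this ψ
  refine ext_inner_left ℂ fun χ => ?_
  have h3 := h2 ((Υ t).symm χ)
  rw [LinearIsometryEquiv.apply_symm_apply] at h3
  rw [h3, ← (Υ t).inner_map_map, LinearIsometryEquiv.apply_symm_apply]

/-- The pairing of the two propagators differs from ‖ψ‖² by a multiple of the L¹ distance of the
controls. The multiple does not depend on j because M and τ are common to all controls. -/
theorem IsLimit.tendsto_of_control {M τ : ℝ} (hst : S.Stable M) {w : ℕ → ℕ → ℝ} {u : ℝ → ℝ}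
    {Υ : ℝ → E ≃ₗᵢ[ℂ] E} (hΥ : S.IsLimit w Υ) (happ : IsApprox M τ w u)
    (hu : Measurable u) {B : ℝ} (hB : ∀ t, |u t| ≤ B)
    {w' : ℕ → ℕ → ℕ → ℝ} {u' : ℕ → ℝ → ℝ} {Υ' : ℕ → ℝ → E ≃ₗᵢ[ℂ] E}
    (hΥ' : ∀ j, S.IsLimit (w' j) (Υ' j)) (happ' : ∀ j, IsApprox M τ (w' j) (u' j))
    (hu' : ∀ j, Measurable (u' j)) (hB' : ∀ j t, |u' j t| ≤ B)
    (hlim : ∀ᵐ t : ℝ, Tendsto (fun j => u' j t) atTop (𝓝 (u t))) {t : ℝ} (ht : 0 ≤ t) (ψ : E) :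
    Tendsto (fun j => Υ' j t ψ) atTop (𝓝 (Υ t ψ)) := by
  obtain ⟨C, hC0, hC⟩ := hst τ t
  have hint : Tendsto (fun j => ∫ s in (0 : ℝ)..t, |u' j s - u s|) atTop (𝓝 0) := by
    have : Tendsto (fun j => ∫ s in (0 : ℝ)..t, |u' j s - u s|) atTop
        (𝓝 (∫ s in (0 : ℝ)..t, (0 : ℝ))) := by
      refine intervalIntegral.tendsto_integral_filter_of_dominated_convergence (fun _ => B + B)
        (Eventually.of_forall fun j => ?_) (Eventually.of_forall fun j => ?_)
        intervalIntegrable_const ?_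
      · exact ((hu' j).sub hu).abs.aestronglyMeasurable
      · refine Eventually.of_forall fun s _ => ?_
        rw [Real.norm_eq_abs, abs_abs]
        exact (abs_sub _ _).trans (add_le_add (hB' j s) (hB s))
      · filter_upwards [hlim] with s hs _
        simpa using (hs.sub_const (u s)).abs
    simpa using this
  refine tendsto_of_dense S.dense_setOf_proj (fun ψ ⟨m, hm⟩ => ?_) ψ
  have hb : ∀ j, ‖Υ' j t ψ - Υ t ψ‖ ^ 2 ≤
      2 * (S.K * (C * ‖S.diag m ψ‖) * ‖ψ‖ * ∫ s in (0 : ℝ)..t, |u' j s - u s|) := by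
    intro j
    refine norm_sub_sq_le_of_inner (r := ‖ψ‖) (LinearIsometryEquiv.norm_map _ _)
      (LinearIsometryEquiv.norm_map _ _) ?_
    have := (hΥ' j).norm_inner_sub_le (happ' j) hu hB (hΥ.weakSol hst happ ψ) ht hC0
      (fun n w h s h1 h2 h3 h4 ψ => (hC n w h s h1 h2 h3 h4 ψ).1) (Z := ‖ψ‖)
      (fun s _ => (LinearIsometryEquiv.norm_map _ _).le) hm
    rw [hΥ.map_zero, inner_self_eq_norm_sq_to_K] at this
    exact this
  have h0 : Tendsto (fun j => ‖Υ' j t ψ - Υ t ψ‖ ^ 2) atTop (𝓝 0) := by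
    refine squeeze_zero (fun _ => by positivity) hb ?_
    simpa using (hint.const_mul (S.K * (C * ‖S.diag m ψ‖) * ‖ψ‖)).const_mul 2
  rw [tendsto_iff_norm_sub_tendsto_zero]
  have := h0.sqrt
  simpa [Real.sqrt_sq] using this

end DiagModel

/-- Grönwall in both time directions: g(s) exp(-κs) is antitone, and negative times follow by
reflection. -/
theorem le_exp_mul_of_abs_deriv_le {g g' : ℝ → ℝ} {κ : ℝ} (hg : ∀ s, HasDerivAt g (g' s) s)
    (hb : ∀ s, |g' s| ≤ κ * g s) (s : ℝ) : g s ≤ Real.exp (κ * |s|) * g 0 := by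
  have main : ∀ {g g' : ℝ → ℝ}, (∀ s, HasDerivAt g (g' s) s) → (∀ s, |g' s| ≤ κ * g s) →
      ∀ s, 0 ≤ s → g s ≤ Real.exp (κ * s) * g 0 := by
    intro g g' hg hb s hs
    have hd : ∀ r, HasDerivAt (fun r => g r * Real.exp (-(κ * r)))
        (g' r * Real.exp (-(κ * r)) + g r * (Real.exp (-(κ * r)) * -κ)) r := by
      intro r
      have h1 : HasDerivAt (fun r => -(κ * r)) (-κ) r := by
        have h := ((hasDerivAt_id r).const_mul κ).neg
        rw [mul_one] at h
        exact h
      exact (hg r).mul h1.exp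
    have hanti : Antitone (fun r => g r * Real.exp (-(κ * r))) := by
      refine antitone_of_deriv_nonpos (fun r => (hd r).differentiableAt) fun r => ?_
      rw [(hd r).deriv]
      have h2 := (le_abs_self _).trans (hb r)
      have h3 := Real.exp_pos (-(κ * r))
      nlinarith
    have h4 := hanti hs
    simp only [mul_zero, neg_zero, Real.exp_zero, mul_one] at h4
    rw [Real.exp_neg, ← div_eq_mul_inv, div_le_iff₀ (Real.exp_pos _)] at h4
    linarith
  rcases le_total 0 s with h | h
  · rw [abs_of_nonneg h]
    exact main hg hb s h
  · rw [abs_of_nonpos h]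
    have := main (g := fun r => g (-r)) (g' := fun r => -(g' (-r)))
      (fun r => by
        have h := (hg (-r)).comp r (hasDerivAt_neg r)
        rw [mul_neg_one] at h
        exact h)
      (fun r => by rw [abs_neg]; exact hb (-r)) (-s) (by linarith)
    simpa using this

namespace DiagModel

variable {E : Type*} [NormedAddCommGroup E] [InnerProductSpace ℂ E] (S : DiagModel E)

/-! ### Tails -/

theorem mul_norm_proj_sub_proj_le (hmono : Monotone S.lam) {n m : ℕ} (h : n ≤ m) (z : E) :
    S.lam n * ‖S.proj m z - S.proj n z‖ ≤ ‖S.diag m z‖ := by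
  have h0 : 0 ≤ S.lam n := zero_le_one.trans (S.one_le_lam n)
  have : ‖(S.lam n : ℂ) • (S.proj m z - S.proj n z)‖ ≤ ‖S.diag m z‖ := by
    refine S.norm_le_of_coeff_le fun k => ?_
    rw [inner_smul_right, inner_sub_right, inner_basis_proj, inner_basis_proj, inner_basis_diag]
    by_cases hkm : k < m
    · by_cases hkn : k < n
      · rw [if_pos hkm, if_pos hkn, sub_self, mul_zero, norm_zero]
        exact norm_nonneg _
      · rw [if_pos hkm, if_neg hkn, if_pos hkm, sub_zero, norm_mul, norm_mul, Complex.norm_real,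
          Complex.norm_real, Real.norm_of_nonneg h0,
          Real.norm_of_nonneg (zero_le_one.trans (S.one_le_lam k))]
        exact mul_le_mul_of_nonneg_right (hmono (not_lt.1 hkn)) (norm_nonneg _)
    · rw [if_neg hkm, if_neg (fun h' => hkm (h'.trans_le h)), if_neg hkm, sub_self, mul_zero]
  rwa [norm_smul, Complex.norm_real, Real.norm_of_nonneg h0] at this

/-- The modes between n and m have eigenvalue at least `lam n`, so their norm gains a factor 1 /
`lam n` over the graph norm. -/
theorem tailDecay_of_tendsto (hmono : Monotone S.lam) (hlim : Tendsto S.lam atTop atTop) :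
    S.TailDecay := by
  refine ⟨fun n => S.K * (S.lam n)⁻¹, ?_, fun n m h y z => ?_⟩
  · simpa using (tendsto_inv_atTop_zero.comp hlim).const_mul S.K
  · have h0 : 0 < S.lam n := zero_lt_one.trans_le (S.one_le_lam n)
    have h1 : ‖S.proj m z - S.proj n z‖ ≤ (S.lam n)⁻¹ * ‖S.diag m z‖ := by
      rw [inv_mul_eq_div, le_div_iff₀ h0, mul_comm]
      exact S.mul_norm_proj_sub_proj_le hmono h z
    calc ‖(inner ℂ (S.pert n y) (S.proj m z - S.proj n z) : ℂ)‖
        ≤ ‖S.pert n y‖ * ‖S.proj m z - S.proj n z‖ := norm_inner_le_norm _ _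
      _ ≤ (S.K * ‖S.diag n y‖) * ((S.lam n)⁻¹ * ‖S.diag m z‖) := by
          have := S.K_nonneg
          gcongr
          exact S.norm_pert_le n y
      _ = _ := by ring

section Domain

/-! ### The domain of the diagonal operator -/

variable {S}

/-- Bounded partial sums make the weighted coefficients square summable, so ψ lies in the domain of
the full diagonal operator. -/
theorem exists_of_norm_diag_le {ψ : E} {c : ℝ} (h : ∀ m, ‖S.diag m ψ‖ ≤ c) :
    ∃ f : E, ∀ k, inner ℂ (S.b k) f = (S.lam k : ℂ) * inner ℂ (S.b k) ψ := by
  have hmem : Memℓp (fun k => (S.lam k : ℂ) * inner ℂ (S.b k) ψ) 2 := by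
    refine memℓp_gen ?_
    simp only [ENNReal.toReal_ofNat, Real.rpow_two]
    refine summable_of_sum_range_le (c := c ^ 2) (fun _ => by positivity) fun m => ?_
    have h1 := sum_le_hasSum (Finset.range m) (fun k _ => by positivity)
      (S.hasSum_norm_sq (S.diag m ψ))
    refine le_trans (le_of_eq ?_) (h1.trans (pow_le_pow_left₀ (norm_nonneg _) (h m) 2))
    refine Finset.sum_congr rfl fun k hk => ?_
    rw [inner_basis_diag, if_pos (Finset.mem_range.1 hk)]
  refine ⟨S.b.repr.symm ⟨_, hmem⟩, fun k => ?_⟩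
  rw [← S.b.repr_apply_apply, LinearIsometryEquiv.apply_symm_apply]

theorem diag_eq_proj {ψ f : E} (h : ∀ k, inner ℂ (S.b k) f = (S.lam k : ℂ) * inner ℂ (S.b k) ψ)
    (m : ℕ) : S.diag m ψ = S.proj m f := by
  refine S.ext_basis fun k => ?_
  rw [inner_basis_diag, inner_basis_proj, h]

theorem inner_basis_eq_of_tendsto_pert {ψ g : E}
    (h : Tendsto (fun m => S.pert m ψ) atTop (𝓝 g)) (k : ℕ) :
    inner ℂ (S.b k) g = (inner ℂ (S.v k) ψ : ℂ) := by
  have h1 : Tendsto (fun m => (inner ℂ (S.b k) (S.pert m ψ) : ℂ)) atTop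
      (𝓝 (inner ℂ (S.b k) g)) := tendsto_const_nhds.inner h
  have h2 : Tendsto (fun m => (inner ℂ (S.v k) (S.proj m ψ) : ℂ)) atTop
      (𝓝 (inner ℂ (S.v k) ψ)) := tendsto_const_nhds.inner (S.tendsto_proj ψ)
  refine tendsto_nhds_unique h1 (h2.congr fun m => ?_)
  rw [pert, proj, inner_trunc_right, inner_trunc_right]
  exact Finset.sum_congr rfl fun j _ => by rw [S.symm]

theorem norm_le_of_norm_diag_le {ψ f : E}
    (h : ∀ k, inner ℂ (S.b k) f = (S.lam k : ℂ) * inner ℂ (S.b k) ψ) {c : ℝ}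
    (hc : ∀ m, ‖S.diag m ψ‖ ≤ c) : ‖f‖ ≤ c := by
  refine le_of_tendsto (S.tendsto_proj f).norm (Eventually.of_forall fun m => ?_)
  rw [← diag_eq_proj h]
  exact hc m

end Domain

variable [CompleteSpace E]

/-! ### Stability -/

theorem norm_gal_flow (n : ℕ) (w s : ℝ) (ψ : E) :
    ‖(S.gal n w : E →L[ℂ] E) (flow (S.gal n w) s ψ)‖ = ‖(S.gal n w : E →L[ℂ] E) ψ‖ := by
  rw [flow_commute (S := (S.gal n w : E →L[ℂ] E)) (fun _ => rfl), LinearIsometryEquiv.norm_map]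

theorem norm_proj_flow (n : ℕ) (w s : ℝ) (ψ : E) :
    ‖S.proj n (flow (S.gal n w) s ψ)‖ = ‖S.proj n ψ‖ := by
  rw [flow_commute (S.proj_gal n w), LinearIsometryEquiv.norm_map]

/-- Stability when the perturbation is bounded relative to the diagonal operator with relative
bound less than `1 / M`. -/
theorem stable_of_relative_bound {a b M : ℝ} (hM : 0 ≤ M) (hb : 0 ≤ b)
    (haM : a * M < 1)
    (hrel : ∀ n ψ, ‖S.pert n ψ‖ ≤ a * ‖S.diag n ψ‖ + b * ‖S.proj n ψ‖) : S.Stable M := by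
  intro τ T
  have hK := S.K_nonneg
  set c := 1 - a * M with hc
  have hc0 : 0 < c := by linarith
  set K' := S.K / c with hK'
  have hK'0 : 0 ≤ K' := by positivity
  set A := 1 + M * S.K + M * b with hA
  have hA0 : 0 ≤ A := by positivity
  refine ⟨c⁻¹ * Real.exp (K' * τ) * A, by positivity, ?_⟩
  intro n w h t hh ht hw hsum ψ
  -- This energy is invariant under the k-th flow, which commutes with its generator and with the
  -- projection. The second term absorbs the b part of the relative bound and makes F equivalent to
  -- the graph norm, with lower constant c = 1 - aM.
  set F : ℕ → E → ℝ := fun k ψ => ‖(S.gal n (w k) : E →L[ℂ] E) ψ‖ + M * b * ‖S.proj n ψ‖ with hF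
  have hlow : ∀ k ψ, c * ‖S.diag n ψ‖ ≤ F k ψ := by
    intro k ψ
    have h1 : ‖S.diag n ψ‖ ≤ ‖(S.gal n (w k) : E →L[ℂ] E) ψ‖ +
        |w k| * ‖S.proj n (S.pert n ψ)‖ := by
      have : S.diag n ψ = (S.gal n (w k) : E →L[ℂ] E) ψ - (w k : ℂ) • S.proj n (S.pert n ψ) := by
        rw [gal_apply, add_sub_cancel_right]
      calc ‖S.diag n ψ‖ = _ := congrArg norm this
        _ ≤ _ := norm_sub_le _ _
        _ = _ := by rw [norm_smul, Complex.norm_real, Real.norm_eq_abs]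
    have h2 : |w k| * ‖S.proj n (S.pert n ψ)‖ ≤
        M * (a * ‖S.diag n ψ‖ + b * ‖S.proj n ψ‖) :=
      mul_le_mul (hw k) ((S.norm_proj_le _ _).trans (hrel n ψ)) (norm_nonneg _) hM
    simp only [hF, hc]
    linarith
  have hupp : ∀ k ψ, F k ψ ≤ A * ‖S.diag n ψ‖ := by
    intro k ψ
    have h1 := S.norm_gal_le n (hw k) ψ
    have h2 : M * b * ‖S.proj n ψ‖ ≤ M * b * ‖S.diag n ψ‖ := by
      gcongr
      exact S.norm_proj_le_diag n ψ
    simp only [hF, hA]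
    linarith
  have hpert : ∀ k ψ, ‖S.pert n ψ‖ ≤ K' * F k ψ := by
    intro k ψ
    have h1 := S.norm_pert_le n ψ
    have h2 : ‖S.diag n ψ‖ ≤ F k ψ / c := by
      rw [le_div_iff₀ hc0, mul_comm]; exact hlow k ψ
    calc ‖S.pert n ψ‖ ≤ S.K * (F k ψ / c) := h1.trans (by gcongr)
      _ = K' * F k ψ := by rw [hK']; ring
  have hF0 : ∀ k ψ, 0 ≤ F k ψ := fun k ψ => by positivity
  -- Switching w costs 1 + K'|Δw| ≤ exp(K'|Δw|); the exponents add up to K' times the total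
  -- variation.
  have hcomp : ∀ j k ψ, F j ψ ≤ Real.exp (K' * |w j - w k|) * F k ψ := by
    intro j k ψ
    have h1 : (S.gal n (w j) : E →L[ℂ] E) ψ = (S.gal n (w k) : E →L[ℂ] E) ψ +
        ((w j - w k : ℝ) : ℂ) • S.proj n (S.pert n ψ) := by
      rw [gal_apply, gal_apply]
      push_cast
      module
    have h2 : ‖(S.gal n (w j) : E →L[ℂ] E) ψ‖ ≤ ‖(S.gal n (w k) : E →L[ℂ] E) ψ‖ +
        |w j - w k| * (K' * F k ψ) := by
      rw [h1]
      refine (norm_add_le _ _).trans ?_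
      rw [norm_smul, Complex.norm_real, Real.norm_eq_abs]
      gcongr
      exact (S.norm_proj_le _ _).trans (hpert k ψ)
    have h3 := Real.add_one_le_exp (K' * |w j - w k|)
    have h4 : F j ψ ≤ (K' * |w j - w k| + 1) * F k ψ := by
      have : F j ψ ≤ F k ψ + |w j - w k| * (K' * F k ψ) := by
        change _ + _ ≤ _ + _ + _
        linarith
      linarith
    exact h4.trans (mul_le_mul_of_nonneg_right h3 (hF0 k ψ))
  have key := energy_propag_le (a := fun k => S.gal n (w k)) (κ := 0) hh (F := F)
    (δ := fun k => K' * |w (k + 1) - w k|)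
    (fun k ψ s => by
      simp only [zero_mul, Real.exp_zero, one_mul, hF, S.norm_gal_flow, S.norm_proj_flow]
      exact le_rfl)
    (fun k ψ => hcomp (k + 1) k ψ)
    (fun k ψ => by rw [abs_sub_comm]; exact hcomp k (k + 1) ψ) ht.1 ψ
  rw [zero_mul, zero_add, ← Finset.mul_sum] at key
  set k := ⌊t / h⌋₊
  have he : Real.exp (K' * ∑ j ∈ Finset.range k, |w (j + 1) - w j|) ≤ Real.exp (K' * τ) :=
    Real.exp_le_exp.2 (mul_le_mul_of_nonneg_left (hsum k) hK'0)
  change F k (S.galProp n w h t ψ) ≤ _ ∧ F 0 ψ ≤ _ * F k (S.galProp n w h t ψ) at key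
  have fin : ∀ {x y : E} {i j : ℕ}, F i x ≤
      Real.exp (K' * ∑ j ∈ Finset.range k, |w (j + 1) - w j|) * F j y →
      ‖S.diag n x‖ ≤ c⁻¹ * Real.exp (K' * τ) * A * ‖S.diag n y‖ := by
    intro x y i j hxy
    calc ‖S.diag n x‖ = c⁻¹ * (c * ‖S.diag n x‖) := by field_simp
      _ ≤ c⁻¹ * (Real.exp (K' * τ) * (A * ‖S.diag n y‖)) := by
          refine mul_le_mul_of_nonneg_left ?_ (inv_nonneg.2 hc0.le)
          refine (hlow i x).trans (hxy.trans ?_)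
          exact mul_le_mul he (hupp j y) (hF0 _ _) (Real.exp_pos _).le
      _ = _ := by ring
  exact ⟨fin key.1, fin key.2⟩

/-- Stability when the commutator of the diagonal operator with the perturbation is bounded
relative to the diagonal operator. -/
theorem stable_of_commutator_bound {κ M : ℝ} (hM : 0 ≤ M) (hκ : 0 ≤ κ)
    (hcomm : ∀ n ψ, |(inner ℂ (S.diag n ψ) (S.diag n (S.proj n (S.pert n ψ))) : ℂ).im| ≤
      κ * ‖S.diag n ψ‖ ^ 2) : S.Stable M := by
  intro τ T
  set κ' := 2 * (M * κ) with hκ'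
  have hκ0 : 0 ≤ κ' := by positivity
  refine ⟨Real.exp (κ' * T), (Real.exp_pos _).le, ?_⟩
  intro n w h t hh ht hw _ ψ
  have hflow : ∀ (k : ℕ) (ψ : E) (s : ℝ), ‖S.diag n (flow (S.gal n (w k)) s ψ)‖ ^ 2 ≤
      Real.exp (κ' * |s|) * ‖S.diag n ψ‖ ^ 2 := by
    intro k ψ s
    set y : ℝ → E := fun s => flow (S.gal n (w k)) s ψ with hy
    let L : E →L[ℝ] E := (S.diag n).restrictScalars ℝ
    have hd : ∀ s, HasDerivAt (fun s => S.diag n (y s))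
        (S.diag n ((-Complex.I) • (S.gal n (w k) : E →L[ℂ] E) (y s))) s := fun s =>
      L.hasFDerivAt.comp_hasDerivAt s (hasDerivAt_flow (S.gal n (w k)) ψ s)
    have hg : ∀ s, HasDerivAt (fun s => ‖S.diag n (y s)‖ ^ 2)
        (2 * (inner ℂ (S.diag n (y s))
          (S.diag n ((-Complex.I) • (S.gal n (w k) : E →L[ℂ] E) (y s))) : ℂ).re) s := by
      intro s
      let _ : InnerProductSpace ℝ E := InnerProductSpace.rclikeToReal ℂ E
      have := (hd s).norm_sq
      exact this
    -- The diagonal part commutes with the operator defining the energy and contributes a real inner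
    -- product, so only the perturbation survives after multiplication by -i.
    have hre : ∀ s, (inner ℂ (S.diag n (y s))
        (S.diag n ((-Complex.I) • (S.gal n (w k) : E →L[ℂ] E) (y s))) : ℂ).re =
        w k * (inner ℂ (S.diag n (y s)) (S.diag n (S.proj n (S.pert n (y s)))) : ℂ).im := by
      intro s
      have h1 : (inner ℂ (S.diag n (y s)) (S.diag n (S.diag n (y s))) : ℂ).im = 0 := by
        have h2 := inner_conj_symm (𝕜 := ℂ) (S.diag n (y s)) (S.diag n (S.diag n (y s)))
        rw [S.inner_diag_left] at h2
        exact Complex.conj_eq_iff_im.1 h2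
      rw [gal_apply, map_smul, map_add, map_smul, inner_smul_right, inner_add_right,
        inner_smul_right]
      simp [h1]
    have := le_exp_mul_of_abs_deriv_le (κ := κ') hg (fun s => by
      rw [hre, abs_mul, abs_mul, abs_two, hκ']
      have h1 := hcomm n (y s)
      have h2 := mul_le_mul (hw k) h1 (abs_nonneg _) hM
      linarith) s
    simpa only [hy, flow_zero] using this
  have key := energy_propag_le (a := fun k => S.gal n (w k)) (κ := κ') hh
    (F := fun _ ψ => ‖S.diag n ψ‖ ^ 2) (δ := fun _ => 0) hflow (fun _ _ => by simp)
    (fun _ _ => by simp) ht.1 ψ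
  simp only [Finset.sum_const_zero, add_zero] at key
  -- Not sharp: it permits the constant exp(κ'T) after taking the square root.
  have he : Real.exp (κ' * t) ≤ Real.exp (κ' * T) ^ 2 := by
    rw [← Real.exp_nat_mul]
    apply Real.exp_le_exp.2
    have h1 : κ' * t ≤ κ' * T := mul_le_mul_of_nonneg_left ht.2 hκ0
    have h2 : 0 ≤ κ' * T := mul_nonneg hκ0 (ht.1.trans ht.2)
    push_cast
    linarith
  have fin : ∀ {x y : E}, ‖S.diag n x‖ ^ 2 ≤ Real.exp (κ' * t) * ‖S.diag n y‖ ^ 2 →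
      ‖S.diag n x‖ ≤ Real.exp (κ' * T) * ‖S.diag n y‖ := by
    intro x y hxy
    refine abs_le_of_sq_le_sq' ?_ (by positivity) |>.2
    rw [mul_pow]
    exact hxy.trans (mul_le_mul_of_nonneg_right he (by positivity))
  exact ⟨fin key.1, fin key.2⟩

/-! ### Strong solutions -/

variable {S}

/-- On the domain of the diagonal operator its truncations are Cauchy, and the relative bound
transfers this to the perturbation. -/
theorem exists_tendsto_pert {ψ f : E}
    (h : ∀ k, inner ℂ (S.b k) f = (S.lam k : ℂ) * inner ℂ (S.b k) ψ) :
    ∃ g : E, Tendsto (fun m => S.pert m ψ) atTop (𝓝 g) := by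
  refine cauchySeq_tendsto_of_complete ?_
  have h1 : CauchySeq fun m => S.diag m ψ := by
    simp only [diag_eq_proj h]
    exact (S.tendsto_proj f).cauchySeq
  have hK := S.K_nonneg
  rw [Metric.cauchySeq_iff'] at h1 ⊢
  intro ε hε
  obtain ⟨N, hN⟩ := h1 (ε / (S.K + 1)) (by positivity)
  refine ⟨N, fun n hn => ?_⟩
  have e1 : S.pert n ψ - S.pert N ψ = S.pert n (ψ - S.proj N ψ) := by
    rw [map_sub]; congr 1; exact (S.trunc_proj_of_ge _ hn ψ).symm
  have e2 : S.diag n ψ - S.diag N ψ = S.diag n (ψ - S.proj N ψ) := by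
    rw [map_sub]; congr 1; exact (S.trunc_proj_of_ge _ hn ψ).symm
  have h2 := hN n hn
  rw [dist_eq_norm] at h2 ⊢
  rw [e1]
  rw [e2, lt_div_iff₀ (by positivity)] at h2
  have h3 := S.norm_pert_le n (ψ - S.proj N ψ)
  have h4 := norm_nonneg (S.diag n (ψ - S.proj N ψ))
  linarith

/-- A weak solution with values in the domain of the diagonal operator, and bounded there, is a
strong solution. -/
theorem WeakSol.strong {u : ℝ → ℝ} (hu : Measurable u) {B : ℝ} (hB : ∀ t, |u t| ≤ B)
    {z : ℝ → E} (hz : S.WeakSol u z) {f g : ℝ → E} {t c : ℝ} (ht : 0 ≤ t)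
    (hf : ∀ s, 0 ≤ s → ∀ k, inner ℂ (S.b k) (f s) = (S.lam k : ℂ) * inner ℂ (S.b k) (z s))
    (hg : ∀ s, 0 ≤ s → Tendsto (fun m => S.pert m (z s)) atTop (𝓝 (g s)))
    (hc : ∀ s ∈ Icc 0 t, ∀ m, ‖S.diag m (z s)‖ ≤ c) :
    IntervalIntegrable (fun s => (-Complex.I) • f s + (u s : ℂ) • (-Complex.I) • g s)
      volume 0 t ∧
    z t = z 0 + ∫ s in (0 : ℝ)..t, ((-Complex.I) • f s + (u s : ℂ) • (-Complex.I) • g s) := by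
  have hB0 : 0 ≤ B := (abs_nonneg _).trans (hB 0)
  have hK := S.K_nonneg
  have hsub : uIoc 0 t ⊆ Icc 0 t := by rw [uIoc_of_le ht]; exact Ioc_subset_Icc_self
  have hzc : ContinuousOn z (uIoc 0 t) := hz.1.mono (hsub.trans Icc_subset_Ici_self)
  have hmeas : ∀ A : E →L[ℂ] E, AEStronglyMeasurable (fun s => A (z s))
      (volume.restrict (uIoc 0 t)) := fun A =>
    (A.continuous.comp_continuousOn hzc).aestronglyMeasurable measurableSet_uIoc
  have hfm : AEStronglyMeasurable f (volume.restrict (uIoc 0 t)) := by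
    refine aestronglyMeasurable_of_tendsto_ae atTop (fun m => hmeas (S.diag m)) ?_
    refine (ae_restrict_iff' measurableSet_uIoc).2 (Eventually.of_forall fun s hs => ?_)
    simp only [diag_eq_proj (hf s (hsub hs).1)]
    exact S.tendsto_proj _
  have hgm : AEStronglyMeasurable g (volume.restrict (uIoc 0 t)) := by
    -- The chosen values f(s) and g(s) are measurable in s as pointwise limits of bounded operators
    -- applied to the continuous curve z.
    refine aestronglyMeasurable_of_tendsto_ae atTop (fun m => hmeas (S.pert m)) ?_
    exact (ae_restrict_iff' measurableSet_uIoc).2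
      (Eventually.of_forall fun s hs => hg s (hsub hs).1)
  have hum : AEStronglyMeasurable (fun s => (u s : ℂ)) (volume.restrict (uIoc 0 t)) :=
    (Complex.measurable_ofReal.comp hu).aestronglyMeasurable
  have hi : IntervalIntegrable (fun s => (-Complex.I) • f s + (u s : ℂ) • (-Complex.I) • g s)
      volume 0 t := by
    have : IntervalIntegrable (fun _ : ℝ => c + B * (S.K * c)) volume 0 t :=
      intervalIntegrable_const
    refine this.mono_fun' ((hfm.const_smul _).add (hum.smul (hgm.const_smul _))) ?_
    refine (ae_restrict_iff' measurableSet_uIoc).2 (Eventually.of_forall fun s hs => ?_)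
    have h1 : ‖f s‖ ≤ c := norm_le_of_norm_diag_le (hf s (hsub hs).1) (hc s (hsub hs))
    have h2 : ‖g s‖ ≤ S.K * c := by
      refine le_of_tendsto (hg s (hsub hs).1).norm (Eventually.of_forall fun m => ?_)
      exact (S.norm_pert_le m _).trans (mul_le_mul_of_nonneg_left (hc s (hsub hs) m) hK)
    refine (norm_add_le _ _).trans ?_
    rw [norm_smul, norm_smul, norm_smul, norm_neg, Complex.norm_I, one_mul, one_mul,
      Complex.norm_real]
    have h3 : ‖u s‖ ≤ B := hB s
    exact add_le_add h1 (mul_le_mul h3 h2 (norm_nonneg _) hB0)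
  refine ⟨hi, S.ext_basis fun k => ?_⟩
  have h3 := ContinuousLinearMap.intervalIntegral_comp_comm (innerSL ℂ (S.b k)) hi
  simp only [innerSL_apply_apply] at h3
  rw [inner_add_right, ← h3, hz.2 k t ht]
  congr 1
  refine intervalIntegral.integral_congr fun s hs => ?_
  rw [uIcc_of_le ht] at hs
  simp only [inner_add_right, inner_smul_right, hf s hs.1,
    inner_basis_eq_of_tendsto_pert (hg s hs.1)]
  ring

end DiagModel

/-! ### Controls -/

theorem controls_measurable {u : ℝ → ℝ} (hu : u ∈ controls) : Measurable u := by
  obtain ⟨p, q, hp, hq, hpq⟩ := hu.1.locallyBoundedVariationOn.exists_monotoneOn_sub_monotoneOn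
  rw [hpq]
  exact (monotoneOn_univ.1 hp).measurable.sub (monotoneOn_univ.1 hq).measurable

/-- Since u(0) = 0, the total variation dominates the supremum. A sequence of controls with bounded
variation is thus uniformly bounded. -/
theorem controls_abs_le {u : ℝ → ℝ} (hu : u ∈ controls) (t : ℝ) :
    |u t| ≤ (eVariationOn u univ).toReal := by
  have h := eVariationOn.edist_le u (mem_univ t) (mem_univ (0 : ℝ))
  rw [hu.2 0 le_rfl, edist_dist, Real.dist_eq, sub_zero] at h
  have := ENNReal.toReal_mono hu.1 h
  rwa [ENNReal.toReal_ofReal (abs_nonneg _)] at this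

/-- Sample u once in each open cell, at a point where |u| ≤ M; such points are dense. The samples
are taken at increasing times, so their variation is at most that of u. -/
theorem exists_isApprox {u : ℝ → ℝ} (hu : u ∈ controls) {M τ : ℝ} (hM : ∀ᵐ t : ℝ, |u t| ≤ M)
    (hτ : (eVariationOn u univ).toReal ≤ τ) : ∃ w : ℕ → ℕ → ℝ, DiagModel.IsApprox M τ w u := by
  have hdense : Dense {t : ℝ | |u t| ≤ M} := Measure.dense_of_ae hM
  have hex : ∀ n k : ℕ, ∃ t : ℝ, |u t| ≤ M ∧
      t ∈ Ioo (k * DiagModel.mesh n) ((k + 1) * DiagModel.mesh n) := by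
    intro n k
    have := DiagModel.mesh_pos n
    obtain ⟨t, h1, h2⟩ := hdense.exists_between
      (show (k : ℝ) * DiagModel.mesh n < (k + 1) * DiagModel.mesh n by nlinarith)
    exact ⟨t, h1, h2⟩
  choose s hs1 hs2 using hex
  refine ⟨fun n k => u (s n k), hs1, fun n k => ?_, ?_⟩
  · have hmono : Monotone (s n) := monotone_nat_of_le_succ fun j => by
      have h1 := (hs2 n j).2
      have h2 := (hs2 n (j + 1)).1
      push_cast at h2
      linarith
    have h := eVariationOn.sum_le (f := u) (n := k) hmono (fun i => mem_univ (s n i))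
    simp only [edist_dist, Real.dist_eq] at h
    rw [← ENNReal.ofReal_sum_of_nonneg (fun _ _ => abs_nonneg _)] at h
    have h2 := ENNReal.toReal_mono hu.1 h
    rw [ENNReal.toReal_ofReal (Finset.sum_nonneg fun _ _ => abs_nonneg _)] at h2
    exact h2.trans hτ
  -- A function of bounded variation is continuous almost everywhere, and the sampling point of the
  -- cell of t is within one mesh of t.
  · filter_upwards [hu.1.locallyBoundedVariationOn.ae_differentiableAt] with t ht h0
    refine (ht.continuousAt.tendsto).comp ?_
    have hmesh : Tendsto DiagModel.mesh atTop (𝓝 0) := tendsto_one_div_add_atTop_nhds_zero_nat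
    rw [tendsto_iff_norm_sub_tendsto_zero]
    refine squeeze_zero (fun _ => norm_nonneg _) (fun n => ?_) hmesh
    have hh := DiagModel.mesh_pos n
    have h1 : (⌊t / DiagModel.mesh n⌋₊ : ℝ) * DiagModel.mesh n ≤ t :=
      (le_div_iff₀ hh).1 (Nat.floor_le (by positivity))
    have h2 : t < (⌊t / DiagModel.mesh n⌋₊ + 1 : ℝ) * DiagModel.mesh n :=
      (div_lt_iff₀ hh).1 (Nat.lt_floor_add_one _)
    obtain ⟨h3, h4⟩ := hs2 n ⌊t / DiagModel.mesh n⌋₊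
    rw [Real.norm_eq_abs, abs_le]
    constructor <;> linarith

/-! ### The harmonic oscillator in the Hermite basis -/

theorem exists_norm_mulX_le {α β : ℕ} (h : β ≤ 2 * α) : ∃ K : ℝ, 0 ≤ K ∧
    ∀ φ : 𝓢(ℝ, ℂ), ‖emb (mulX β φ)‖ ≤ K * ‖emb (oscS α φ)‖ := by
  obtain ⟨a, b, ha, hb, hk⟩ : ∃ a b : ℝ, 0 ≤ a ∧ 0 ≤ b ∧ ∀ k : ℕ,
      (2 * k + (2 * β : ℕ) : ℝ) ^ β ≤ a ^ 2 * (2 * k + 1) ^ (2 * α) + b ^ 2 := by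
    rcases h.lt_or_eq with h | h
    · obtain ⟨b, hb, hk⟩ := exists_relative_bound_of_lt h zero_lt_one
      exact ⟨1, b, zero_le_one, hb, hk⟩
    · obtain ⟨b, hb, hk⟩ := exists_relative_bound_of_eq h one_lt_two
      exact ⟨2, b, zero_le_two, hb, hk⟩
  refine ⟨a + b, by positivity, fun φ => (norm_mulX_le ha hb hk φ).trans ?_⟩
  have := mul_le_mul_of_nonneg_left (norm_emb_le_oscS α φ) hb
  linarith

/-- The Hermite expansion, truncated after `n` terms. -/
noncomputable def hermSum (n : ℕ) (ψ : L2) : 𝓢(ℝ, ℂ) :=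
  ∑ k ∈ Finset.range n, (inner ℂ (hermBasis k) ψ : ℂ) • herm k

theorem emb_hermSum (n : ℕ) (ψ : L2) : emb (hermSum n ψ) =
    ∑ k ∈ Finset.range n, (inner ℂ (hermBasis k) ψ : ℂ) • hermBasis k := by
  simp only [hermSum, emb_sum, emb_smul, hermBasis_apply]

theorem emb_oscS_hermSum (α n : ℕ) (ψ : L2) : emb (oscS α (hermSum n ψ)) =
    ∑ k ∈ Finset.range n, (inner ℂ (hermBasis k) ψ : ℂ) •
      ((((2 * k + 1) ^ α : ℝ) : ℂ) • hermBasis k) := by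
  simp only [hermSum, map_sum, map_smul, oscS_herm, emb_sum, emb_smul, hermBasis_apply]

theorem emb_mulX_hermSum (β n : ℕ) (ψ : L2) : emb (mulX β (hermSum n ψ)) =
    ∑ k ∈ Finset.range n, (inner ℂ (hermBasis k) ψ : ℂ) • emb (mulX β (herm k)) := by
  simp only [hermSum, map_sum, map_smul, emb_sum, emb_smul]

/-- The operators `(-Δ + x²) ^ α` and `x ^ β` in the Hermite basis. -/
noncomputable def hermModel (α β : ℕ) (h : β ≤ 2 * α) : DiagModel L2 where
  b := hermBasis
  lam k := (2 * k + 1) ^ α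
  v k := emb (mulX β (herm k))
  K := (exists_norm_mulX_le h).choose
  one_le_lam k := one_le_pow₀ (by linarith [Nat.cast_nonneg (α := ℝ) k])
  symm j k := by rw [hermBasis_apply, hermBasis_apply, inner_mulX_one]
  K_nonneg := (exists_norm_mulX_le h).choose_spec.1
  bound n ψ := by
    rw [← emb_oscS_hermSum, ← emb_mulX_hermSum]
    exact (exists_norm_mulX_le h).choose_spec.2 _

section Model

variable {α β : ℕ} (h : β ≤ 2 * α)

theorem hermModel_proj (n : ℕ) (ψ : L2) : (hermModel α β h).proj n ψ = emb (hermSum n ψ) := by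
  rw [DiagModel.proj, DiagModel.trunc_apply, emb_hermSum]
  rfl

theorem hermModel_diag (n : ℕ) (ψ : L2) :
    (hermModel α β h).diag n ψ = emb (oscS α (hermSum n ψ)) := by
  rw [DiagModel.diag, DiagModel.trunc_apply, emb_oscS_hermSum]
  rfl

theorem hermModel_pert (n : ℕ) (ψ : L2) :
    (hermModel α β h).pert n ψ = emb (mulX β (hermSum n ψ)) := by
  rw [DiagModel.pert, DiagModel.trunc_apply, emb_mulX_hermSum]
  rfl

theorem norm_hermModel_pert_le {a b : ℝ} (ha : 0 ≤ a) (hb : 0 ≤ b)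
    (hk : ∀ k : ℕ, (2 * k + (2 * β : ℕ) : ℝ) ^ β ≤ a ^ 2 * (2 * k + 1) ^ (2 * α) + b ^ 2)
    (n : ℕ) (ψ : L2) : ‖(hermModel α β h).pert n ψ‖ ≤
      a * ‖(hermModel α β h).diag n ψ‖ + b * ‖(hermModel α β h).proj n ψ‖ := by
  rw [hermModel_pert, hermModel_diag, hermModel_proj]
  exact norm_mulX_le ha hb hk _

theorem mem_oscGraph_iff_hermModel {ψ f : L2} : (ψ, f) ∈ oscGraph α ↔ ∀ k,
    inner ℂ ((hermModel α β h).b k) f =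
      (((hermModel α β h).lam k : ℝ) : ℂ) * inner ℂ ((hermModel α β h).b k) ψ :=
  mem_oscGraph_iff

theorem mem_mulGraph_of_tendsto_pert {ψ g : L2}
    (hg : Tendsto (fun m => (hermModel α β h).pert m ψ) atTop (𝓝 g)) : (ψ, g) ∈ mulGraph β := by
  refine mem_mulGraph_of_tendsto (fun m => ?_) ((hermModel α β h).tendsto_proj ψ) hg
  rw [hermModel_proj, hermModel_pert]
  exact emb_mem_mulGraph β _

/-! ### Stability of the truncated oscillator -/

/-- The relative bound may be chosen as 1 / (M + 1), so no restriction on M arises. -/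
theorem stable_of_lt (hlt : β < 2 * α) {M : ℝ} (hM : 0 ≤ M) : (hermModel α β h).Stable M := by
  have ha : 0 < 1 / (M + 1) := by positivity
  obtain ⟨b, hb, hk⟩ := exists_relative_bound_of_lt hlt ha
  refine DiagModel.stable_of_relative_bound _ hM hb ?_ (norm_hermModel_pert_le h ha.le hb hk)
  rw [one_div_mul_eq_div, div_lt_one (by positivity)]
  linarith

/-- The relative bound a = 2 / (M + 1) satisfies both a > 1 and aM < 1. -/
theorem stable_of_eq (heq : β = 2 * α) {M : ℝ} (hM : 0 ≤ M) (hM1 : M < 1) :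
    (hermModel α β h).Stable M := by
  have ha : 1 < 2 / (M + 1) := by rw [lt_div_iff₀ (by positivity)]; linarith
  obtain ⟨b, hb, hk⟩ := exists_relative_bound_of_eq heq ha
  refine DiagModel.stable_of_relative_bound _ hM hb ?_
    (norm_hermModel_pert_le h (zero_lt_one.trans ha).le hb hk)
  rw [div_mul_eq_mul_div, div_lt_one (by positivity)]
  linarith

end Model

/-- The span of the first n modes is invariant, so truncated powers of the oscillator compose as the
true ones do on it. The corresponding statement for x^β would be false. -/
theorem hermSum_emb_oscS_hermSum (α n : ℕ) (ψ : L2) :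
    hermSum n (emb (oscS α (hermSum n ψ))) = oscS α (hermSum n ψ) := by
  have h1 : ∀ j < n, (inner ℂ (hermBasis j) (emb (oscS α (hermSum n ψ))) : ℂ) =
      (((2 * j + 1) ^ α : ℝ) : ℂ) * inner ℂ (hermBasis j) ψ := by
    intro j hj
    rw [← hermModel_diag (zero_le : 0 ≤ 2 * α) n ψ]
    have := (hermModel α 0 zero_le).inner_basis_diag n j ψ
    rw [if_pos hj] at this
    exact this
  conv_rhs => rw [hermSum]
  rw [hermSum, map_sum]
  refine Finset.sum_congr rfl fun j hj => ?_
  rw [h1 j (Finset.mem_range.1 hj), map_smul, oscS_herm, smul_smul, mul_comm]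

theorem stable_one_two (h : 2 ≤ 2 * 1) {M : ℝ} (hM : 0 ≤ M) : (hermModel 1 2 h).Stable M := by
  refine DiagModel.stable_of_commutator_bound (κ := 18) _ hM (by norm_num) fun n ψ => ?_
  set S := hermModel 1 2 h
  set φ := hermSum n ψ with hφ
  have hosc : oscS 1 φ = osc φ := by rw [oscS, pow_one]
  have hdd : S.diag n (S.diag n ψ) = emb (osc (osc φ)) := by
    rw [hermModel_diag, hermModel_diag, hermSum_emb_oscS_hermSum, ← hφ, hosc, oscS, pow_one]
  -- Moving one oscillator to the left removes the projection, so that the exact commutator of the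
  -- oscillator with x² appears. The remaining term with x² has a real value by symmetry.
  have h1 : (inner ℂ (S.diag n ψ) (S.diag n (S.proj n (S.pert n ψ))) : ℂ) =
      inner ℂ (emb (osc φ)) (emb (mulX 2 (osc φ))) -
        inner ℂ (emb (osc φ)) (emb ((4 : ℂ) • mulX 1 (dS φ) + (2 : ℂ) • φ)) := by
    rw [S.diag_proj, ← S.inner_diag_left, hdd, hermModel_pert, ← hφ, inner_osc, osc_mulX_two,
      emb_sub, inner_sub_right]
  have h2 : (inner ℂ (emb (osc φ)) (emb (mulX 2 (osc φ))) : ℂ).im = 0 := by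
    rw [← Complex.conj_eq_iff_im, inner_conj_symm, inner_mulX_one]
  -- 18 = 4 · 4 + 2: the bound on xφ' has constant 4, and ‖φ‖ is at most ‖osc φ‖.
  have h3 : ‖emb ((4 : ℂ) • mulX 1 (dS φ) + (2 : ℂ) • φ)‖ ≤ 18 * ‖emb (osc φ)‖ := by
    rw [emb_add, emb_smul, emb_smul]
    refine (norm_add_le _ _).trans ?_
    rw [norm_smul, norm_smul]
    have h4 := norm_mulX_deriv_le φ
    have h5 := norm_emb_le_oscS 1 φ
    rw [hosc] at h5
    norm_num
    linarith
  rw [h1, Complex.sub_im, h2, zero_sub, abs_neg, hermModel_diag, ← hφ, hosc]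
  refine (Complex.abs_im_le_norm _).trans ((norm_inner_le_norm _ _).trans ?_)
  calc _ ≤ ‖emb (osc φ)‖ * (18 * ‖emb (osc φ)‖) := by gcongr
    _ = _ := by ring

theorem hermModel_zero_pert (h : 0 ≤ 2 * 0) (n : ℕ) (ψ : L2) :
    (hermModel 0 0 h).pert n ψ = (hermModel 0 0 h).proj n ψ := by
  rw [hermModel_pert, hermModel_proj, mulX_zero]

theorem stable_zero_zero (h : 0 ≤ 2 * 0) {M : ℝ} (hM : 0 ≤ M) : (hermModel 0 0 h).Stable M := by
  refine DiagModel.stable_of_commutator_bound (κ := 0) _ hM le_rfl fun n ψ => ?_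
  set S := hermModel 0 0 h
  have : (inner ℂ (S.diag n ψ) (S.diag n (S.proj n (S.pert n ψ))) : ℂ).im = 0 := by
    rw [hermModel_zero_pert, S.diag_proj, S.diag_proj, ← Complex.conj_eq_iff_im, inner_conj_symm]
  rw [this, abs_zero, zero_mul]

/-- For α > 0 the eigenvalues tend to infinity. For α = 0 they do not, but then β = 0 and the
perturbation is the identity, which does not couple modes. -/
theorem tailDecay_hermModel {α β : ℕ} (h : β ≤ 2 * α) : (hermModel α β h).TailDecay := by
  rcases Nat.eq_zero_or_pos α with rfl | hα
  · obtain rfl : β = 0 := by omega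
    refine ⟨fun _ => 0, tendsto_const_nhds, fun n m hnm y z => ?_⟩
    set S := hermModel 0 0 h
    rw [hermModel_zero_pert, S.inner_proj_left, map_sub, S.proj_proj_of_le hnm,
      S.proj_proj_of_le le_rfl, sub_self, inner_zero_right, norm_zero, zero_mul]
  · refine DiagModel.tailDecay_of_tendsto _ (fun j k hjk => ?_) ?_
    · change (2 * j + 1 : ℝ) ^ α ≤ (2 * k + 1) ^ α
      gcongr
    · refine (tendsto_pow_atTop hα.ne').comp ?_
      exact tendsto_atTop_add_const_right _ _
        (tendsto_natCast_atTop_atTop.const_mul_atTop two_pos)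

/-! ### Weak solutions -/

theorem IsWeakSolution.weakSol {α β : ℕ} (h : β ≤ 2 * α) {u : ℝ → ℝ} {ψ₀ : L2} {ψ : ℝ → L2}
    (hψ : IsWeakSolution α β u ψ₀ ψ) : (hermModel α β h).WeakSol u ψ := by
  refine ⟨hψ.1, fun k t ht => ?_⟩
  have := hψ.2.2 (herm k) t ht
  simp only [oscS_herm, emb_smul, inner_smul_left, Complex.conj_ofReal, ← hermBasis_apply] at this
  rw [← hψ.2.1] at this
  exact this

/-- The defect F in the weak equation is conjugate linear in the test function, vanishes on Hermite
functions and is bounded by the graph norm. Hermite partial sums of a Schwartz function converge in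
that norm, so F vanishes. -/
theorem DiagModel.WeakSol.isWeakSolution {α β : ℕ} (h : β ≤ 2 * α) {u : ℝ → ℝ} (hu : Measurable u) {B : ℝ}
    (hB : ∀ t, |u t| ≤ B) {ψ : ℝ → L2} (hψ : (hermModel α β h).WeakSol u ψ) :
    IsWeakSolution α β u (ψ 0) ψ := by
  refine ⟨hψ.1, rfl, fun φ t ht => ?_⟩
  set S := hermModel α β h with hS
  have hB0 : 0 ≤ B := (abs_nonneg _).trans (hB 0)
  have hc : ContinuousOn ψ (uIcc 0 t) := by
    rw [uIcc_of_le ht]; exact hψ.1.mono Icc_subset_Ici_self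
  have hi : ∀ x y : L2, IntervalIntegrable (fun s => (-Complex.I) *
      (inner ℂ x (ψ s) + (u s : ℂ) * inner ℂ y (ψ s))) volume 0 t := by
    intro x y
    have h1 : ∀ x : L2, ContinuousOn (fun s => (inner ℂ x (ψ s) : ℂ)) (uIcc 0 t) := fun x =>
      continuousOn_const.inner hc
    exact (((h1 x).intervalIntegrable).add
      ((DiagModel.intervalIntegrable_of_measurable_of_bounded hu hB 0 t).mul_continuousOn
        (h1 y))).const_mul _
  obtain ⟨Z, hZ⟩ := isCompact_uIcc.exists_bound_of_continuousOn hc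
  let G : 𝓢(ℝ, ℂ) → ℝ → ℂ := fun φ s => (-Complex.I) *
    (inner ℂ (emb (oscS α φ)) (ψ s) + (u s : ℂ) * inner ℂ (emb (mulX β φ)) (ψ s))
  have hG : ∀ φ, IntervalIntegrable (G φ) volume 0 t := fun φ => hi _ _
  let F : 𝓢(ℝ, ℂ) → ℂ := fun φ =>
    inner ℂ (emb φ) (ψ t) - inner ℂ (emb φ) (ψ 0) - ∫ s in (0 : ℝ)..t, G φ s
  have hadd : ∀ φ χ, F (φ + χ) = F φ + F χ := by
    intro φ χ
    have : G (φ + χ) = fun s => G φ s + G χ s := by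
      ext s
      simp only [G, map_add, emb_add, inner_add_left]
      ring
    simp only [F, this, emb_add, inner_add_left, intervalIntegral.integral_add (hG φ) (hG χ)]
    ring
  have hsmul : ∀ (c : ℂ) φ, F (c • φ) = (starRingEnd ℂ) c * F φ := by
    intro c φ
    have : G (c • φ) = fun s => (starRingEnd ℂ) c * G φ s := by
      ext s
      simp only [G, map_smul, emb_smul, inner_smul_left]
      ring
    simp only [F, this, emb_smul, inner_smul_left, intervalIntegral.integral_const_mul]
    ring
  have hherm : ∀ k, F (herm k) = 0 := by
    intro k
    have h1 : (inner ℂ (hermBasis k) (ψ t) : ℂ) = inner ℂ (hermBasis k) (ψ 0) +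
      ∫ s in (0 : ℝ)..t, (-Complex.I) * ((((2 * k + 1) ^ α : ℝ) : ℂ) * inner ℂ (hermBasis k) (ψ s) +
        (u s : ℂ) * inner ℂ (emb (mulX β (herm k))) (ψ s)) := hψ.2 k t ht
    simp only [F, G, oscS_herm, emb_smul, inner_smul_left, Complex.conj_ofReal, ← hermBasis_apply]
    rw [h1]
    ring
  have hsum : ∀ n (χ : L2), F (hermSum n χ) = 0 := by
    intro n χ
    rw [hermSum]
    refine Finset.sum_induction _ (fun φ => F φ = 0) (fun φ χ h1 h2 => ?_) ?_ fun k _ => ?_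
    · rw [hadd, h1, h2, add_zero]
    · rw [← zero_smul ℂ φ, hsmul, map_zero, zero_mul]
    · rw [hsmul, hherm, mul_zero]
  set C : ℝ := 2 * Z + (1 + B * S.K) * Z * t with hC
  have hbound : ∀ φ, ‖F φ‖ ≤ C * ‖emb (oscS α φ)‖ := by
    intro φ
    have hK : ‖emb (mulX β φ)‖ ≤ S.K * ‖emb (oscS α φ)‖ :=
      (exists_norm_mulX_le h).choose_spec.2 φ
    set N := ‖emb (oscS α φ)‖
    have hN0 : 0 ≤ N := norm_nonneg _
    have hz : ∀ s ∈ uIcc 0 t, ‖(inner ℂ (emb φ) (ψ s) : ℂ)‖ ≤ N * Z := fun s hs =>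
      (norm_inner_le_norm _ _).trans
        (mul_le_mul (norm_emb_le_oscS α φ) (hZ s hs) (norm_nonneg _) hN0)
    have h1 : ‖∫ s in (0 : ℝ)..t, G φ s‖ ≤ (N * Z + B * (S.K * N * Z)) * |t - 0| := by
      refine intervalIntegral.norm_integral_le_of_norm_le_const fun s hs => ?_
      have hs' := hZ s (uIoc_subset_uIcc hs)
      simp only [G]
      rw [norm_mul, norm_neg, Complex.norm_I, one_mul]
      refine (norm_add_le _ _).trans (add_le_add ?_ ?_)
      · exact (norm_inner_le_norm _ _).trans (mul_le_mul_of_nonneg_left hs' hN0)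
      · rw [norm_mul, Complex.norm_real]
        refine mul_le_mul (hB s) ((norm_inner_le_norm _ _).trans ?_) (norm_nonneg _) hB0
        exact mul_le_mul hK hs' (norm_nonneg _) (mul_nonneg S.K_nonneg hN0)
    rw [sub_zero, abs_of_nonneg ht] at h1
    have h2 := hz t right_mem_uIcc
    have h3 := hz 0 left_mem_uIcc
    calc ‖F φ‖ ≤ N * Z + N * Z + (N * Z + B * (S.K * N * Z)) * t :=
          (norm_sub_le _ _).trans (add_le_add ((norm_sub_le _ _).trans (add_le_add h2 h3)) h1)
      _ = C * N := by rw [hC]; ring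
  have hdiag : ∀ n, emb (oscS α (hermSum n (emb φ))) = S.proj n (emb (oscS α φ)) := by
    intro n
    rw [← hermModel_diag h]
    refine DiagModel.diag_eq_proj (S := S) (fun k => ?_) n
    have := coeffH_oscS α φ k
    simp only [coeffH, ← hermBasis_apply] at this
    exact this
  have hlim : Tendsto (fun n => C * ‖emb (oscS α φ) - S.proj n (emb (oscS α φ))‖) atTop
      (𝓝 (C * 0)) :=
    (tendsto_iff_norm_sub_tendsto_zero.1 (S.tendsto_proj (emb (oscS α φ)))).congr
      (fun n => norm_sub_rev _ _) |>.const_mul C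
  rw [mul_zero] at hlim
  have h0 : ‖F φ‖ ≤ 0 := by
    refine ge_of_tendsto hlim (Eventually.of_forall fun n => ?_)
    have h1 : φ = (φ - hermSum n (emb φ)) + hermSum n (emb φ) := by abel
    have h2 : F φ = F (φ - hermSum n (emb φ)) := by
      conv_lhs => rw [h1]
      rw [hadd, hsum, add_zero]
    rw [h2, ← hdiag, ← emb_sub, ← map_sub]
    exact hbound _
  have h1 : F φ = 0 := norm_le_zero_iff.1 h0
  simp only [F, G] at h1
  linear_combination h1

/-! ### Well-posedness -/

section WellPosedness

variable {α β : ℕ} {h : β ≤ 2 * α} {u : ℝ → ℝ} {M τ : ℝ} {w : ℕ → ℕ → ℝ} {Υ : ℝ → L2 ≃ₗᵢ[ℂ] L2}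

theorem exists_propagator (hu : u ∈ controls) (hst : (hermModel α β h).Stable M)
    (hM : ∀ᵐ t : ℝ, |u t| ≤ M) (hτ : (eVariationOn u univ).toReal ≤ τ) :
    ∃ (w : ℕ → ℕ → ℝ) (Υ : ℝ → L2 ≃ₗᵢ[ℂ] L2),
      DiagModel.IsApprox M τ w u ∧ (hermModel α β h).IsLimit w Υ := by
  obtain ⟨w, hw⟩ := exists_isApprox hu hM hτ
  obtain ⟨Υ, hΥ⟩ := (hermModel α β h).exists_isLimit hst (tailDecay_hermModel h)
    (controls_measurable hu) (controls_abs_le hu) hw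
  exact ⟨w, Υ, hw, hΥ⟩

theorem isWeakSolution_propagator (hu : u ∈ controls) (hst : (hermModel α β h).Stable M)
    (hw : DiagModel.IsApprox M τ w u) (hΥ : (hermModel α β h).IsLimit w Υ) (ψ₀ : L2) :
    IsWeakSolution α β u ψ₀ fun t => Υ t ψ₀ := by
  have h1 := (hΥ.weakSol hst hw ψ₀).isWeakSolution h (controls_measurable hu) (controls_abs_le hu)
  rwa [hΥ.map_zero] at h1

theorem eq_propagator_of_isWeakSolution (hu : u ∈ controls) (hst : (hermModel α β h).Stable M)
    (hw : DiagModel.IsApprox M τ w u) (hΥ : (hermModel α β h).IsLimit w Υ) {ψ₀ : L2} {ψ : ℝ → L2}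
    (hψ : IsWeakSolution α β u ψ₀ ψ) {t : ℝ} (ht : 0 ≤ t) : ψ t = Υ t ψ₀ := by
  rw [hΥ.unique hst hw (controls_measurable hu) (controls_abs_le hu) (hψ.weakSol h) ht, hψ.2.1]

/-- The propagators act continuously on the domain of `(-Δ + x²) ^ α`. -/
theorem exists_norm_diag_propagator_le (hst : (hermModel α β h).Stable M)
    (hw : DiagModel.IsApprox M τ w u) (hΥ : (hermModel α β h).IsLimit w Υ) (T : ℝ) :
    ∃ C : ℝ, 0 ≤ C ∧ ∀ t ∈ Icc 0 T, ∀ {ψ₀ f₀ : L2}, (ψ₀, f₀) ∈ oscGraph α →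
      ∀ m, ‖(hermModel α β h).diag m (Υ t ψ₀)‖ ≤ C * ‖f₀‖ := by
  obtain ⟨C, hC0, hC⟩ := hst τ T
  refine ⟨C, hC0, fun t ht ψ₀ f₀ hf m => ?_⟩
  refine hΥ.norm_diag_le hw hC0
    (fun n w h t hh ht hw hs ψ => (hC n w h t hh ht hw hs ψ).1) ht (fun n => ?_) m
  rw [DiagModel.diag_eq_proj ((mem_oscGraph_iff_hermModel h).1 hf)]
  exact (hermModel α β h).norm_proj_le n f₀

theorem exists_oscGraph_propagator (hst : (hermModel α β h).Stable M)
    (hw : DiagModel.IsApprox M τ w u) (hΥ : (hermModel α β h).IsLimit w Υ) (T : ℝ) :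
    ∃ C : ℝ, 0 ≤ C ∧ ∀ t ∈ Icc 0 T, ∀ {ψ₀ f₀ : L2}, (ψ₀, f₀) ∈ oscGraph α →
      ∃ f : L2, (Υ t ψ₀, f) ∈ oscGraph α ∧ ‖f‖ ≤ C * ‖f₀‖ := by
  obtain ⟨C, hC0, hC⟩ := exists_norm_diag_propagator_le hst hw hΥ T
  refine ⟨C, hC0, fun t ht ψ₀ f₀ hf₀ => ?_⟩
  obtain ⟨f, hf⟩ := DiagModel.exists_of_norm_diag_le (hC t ht hf₀)
  exact ⟨f, (mem_oscGraph_iff_hermModel h).2 hf,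
    DiagModel.norm_le_of_norm_diag_le hf (hC t ht hf₀)⟩

theorem isStrongSolution_propagator (hu : u ∈ controls) (hst : (hermModel α β h).Stable M)
    (hw : DiagModel.IsApprox M τ w u) (hΥ : (hermModel α β h).IsLimit w Υ) {ψ₀ : L2}
    (hψ₀ : ψ₀ ∈ (opA α).domain) : IsStrongSolution α β u ψ₀ fun t => Υ t ψ₀ := by
  obtain ⟨f₀, hf₀, -⟩ := exists_oscGraph_of_mem_domain ⟨ψ₀, hψ₀⟩
  have hz := hΥ.weakSol hst hw ψ₀
  have hf : ∀ s, ∃ f : L2, 0 ≤ s → (Υ s ψ₀, f) ∈ oscGraph α := by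
    intro s
    by_cases hs : 0 ≤ s
    · obtain ⟨C, -, hC⟩ := exists_oscGraph_propagator hst hw hΥ s
      obtain ⟨f, hf, -⟩ := hC s ⟨hs, le_rfl⟩ hf₀
      exact ⟨f, fun _ => hf⟩
    · exact ⟨0, fun h => absurd h hs⟩
  choose f hf using hf
  have hf' := fun s hs => (mem_oscGraph_iff_hermModel h).1 (hf s hs)
  have hg : ∀ s, ∃ g : L2, 0 ≤ s →
      Tendsto (fun m => (hermModel α β h).pert m (Υ s ψ₀)) atTop (𝓝 g) := by
    intro s
    by_cases hs : 0 ≤ s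
    · obtain ⟨g, hg⟩ := DiagModel.exists_tendsto_pert (hf' s hs)
      exact ⟨g, fun _ => hg⟩
    · exact ⟨0, fun h => absurd h hs⟩
  choose g hg using hg
  refine ⟨hz.1, hΥ.map_zero ψ₀, fun s => (-Complex.I) • f s, fun s => (-Complex.I) • g s,
    fun s hs => ⟨mem_opA_graph (hf s hs),
      mem_opB_graph (mem_mulGraph_of_tendsto_pert h (hg s hs))⟩, fun t ht => ?_⟩
  obtain ⟨C, -, hC⟩ := exists_norm_diag_propagator_le hst hw hΥ t
  have := hz.strong (controls_measurable hu) (controls_abs_le hu) ht hf' hg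
    (fun s hs => hC s hs hf₀)
  rwa [hΥ.map_zero] at this

theorem exists_norm_opA_propagator_le (hst : (hermModel α β h).Stable M)
    (hw : DiagModel.IsApprox M τ w u) (hΥ : (hermModel α β h).IsLimit w Υ) (T : ℝ) :
    ∃ C : ℝ, ∀ t ∈ Icc 0 T, ∀ ψ₀ : (opA α).domain,
      ∃ h : Υ t (ψ₀ : L2) ∈ (opA α).domain,
        ‖opA α ⟨Υ t (ψ₀ : L2), h⟩‖ + ‖Υ t (ψ₀ : L2)‖ ≤ C * (‖opA α ψ₀‖ + ‖(ψ₀ : L2)‖) := by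
  obtain ⟨C, hC0, hC⟩ := exists_oscGraph_propagator hst hw hΥ T
  refine ⟨C + 1, fun t ht ψ₀ => ?_⟩
  obtain ⟨f₀, hf₀, he⟩ := exists_oscGraph_of_mem_domain ψ₀
  obtain ⟨f, hf, hle⟩ := hC t ht hf₀
  obtain ⟨y, hy1, hy2⟩ := (LinearPMap.mem_graph_iff _).1 (mem_opA_graph hf)
  have hy : Υ t (ψ₀ : L2) ∈ (opA α).domain := by
    rw [← show (y : L2) = Υ t (ψ₀ : L2) from hy1]
    exact y.2
  have hy' : opA α ⟨Υ t (ψ₀ : L2), hy⟩ = (-Complex.I) • f := by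
    rw [← show opA α y = (-Complex.I) • f from hy2]
    congr 1
    exact Subtype.ext hy1.symm
  refine ⟨hy, ?_⟩
  rw [hy', he, norm_smul, norm_smul, norm_neg, Complex.norm_I, one_mul, one_mul,
    LinearIsometryEquiv.norm_map]
  have h1 := norm_nonneg f₀
  have h2 : 0 ≤ C * ‖(ψ₀ : L2)‖ := by positivity
  linarith

/-- The level M is allowed to depend on u, but it must also serve every control of the class with no
larger variation, as these may occur in a sequence converging to u. -/
theorem wellPosed_of_stable {𝒱 : Set (ℝ → ℝ)} (h𝒱 : 𝒱 ⊆ controls)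
    (hst : ∀ u ∈ 𝒱, ∃ M, (hermModel α β h).Stable M ∧
      ∀ v ∈ 𝒱, eVariationOn v univ ≤ eVariationOn u univ → ∀ᵐ t : ℝ, |v t| ≤ M) :
    WellPosed α β 𝒱 := by
  have hex : ∀ u : ℝ → ℝ, ∃ Υ : ℝ → L2 ≃ₗᵢ[ℂ] L2, u ∈ 𝒱 → ∃ (M τ : ℝ) (w : ℕ → ℕ → ℝ),
      (hermModel α β h).Stable M ∧ DiagModel.IsApprox M τ w u ∧
        (hermModel α β h).IsLimit w Υ := by
    intro u
    by_cases hu : u ∈ 𝒱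
    · obtain ⟨M, hM, hle⟩ := hst u hu
      obtain ⟨w, Υ, hw, hΥ⟩ := exists_propagator (h𝒱 hu) hM (hle u hu le_rfl) le_rfl
      exact ⟨Υ, fun _ => ⟨M, _, w, hM, hw, hΥ⟩⟩
    · exact ⟨fun _ => LinearIsometryEquiv.refl ℂ L2, fun h => absurd h hu⟩
  choose Υ hΥ using hex
  have hweak : ∀ u ∈ 𝒱, ∀ ψ₀ : L2, IsWeakSolution α β u ψ₀ fun t => Υ u t ψ₀ := by
    intro u hu ψ₀
    obtain ⟨M, τ, w, hM, hw, hl⟩ := hΥ u hu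
    exact isWeakSolution_propagator (h𝒱 hu) hM hw hl ψ₀
  refine ⟨Υ, fun u hu => ⟨hweak u hu, ?_⟩, fun u hu v hv hlim ψ₀ t ht => ?_⟩
  · obtain ⟨M, τ, w, hM, hw, hl⟩ := hΥ u hu
    exact ⟨fun ψ₀ ψ hψ t ht => eq_propagator_of_isWeakSolution (h𝒱 hu) hM hw hl hψ ht,
      fun ψ₀ hψ₀ => isStrongSolution_propagator (h𝒱 hu) hM hw hl hψ₀,
      exists_norm_opA_propagator_le hM hw hl⟩
  · obtain ⟨M, hM, hle⟩ := hst u hu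
    have hTV : ∀ n, (eVariationOn (v n) univ).toReal ≤ (eVariationOn u univ).toReal := fun n =>
      ENNReal.toReal_mono (h𝒱 hu).1 (hlim.1 n)
    -- The propagators chosen above used a level and a variation bound depending on each control.
    -- They are rebuilt here with common constants, and identified with the chosen ones by
    -- uniqueness of weak solutions.
    obtain ⟨w, Υ₀, hw, hl⟩ := exists_propagator (h𝒱 hu) hM (hle u hu le_rfl) le_rfl
    choose w' Υ' hw' hl' using fun n =>
      exists_propagator (h𝒱 (hv n)) hM (hle (v n) (hv n) (hlim.1 n)) (hTV n)
    have h1 := hl.tendsto_of_control hM hw (controls_measurable (h𝒱 hu))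
      (controls_abs_le (h𝒱 hu)) hl' hw' (fun n => controls_measurable (h𝒱 (hv n)))
      (fun n s => (controls_abs_le (h𝒱 (hv n)) s).trans (hTV n)) hlim.2 ht ψ₀
    rw [eq_propagator_of_isWeakSolution (h𝒱 hu) hM hw hl (hweak u hu ψ₀) ht]
    exact h1.congr fun n =>
      (eq_propagator_of_isWeakSolution (h𝒱 (hv n)) hM (hw' n) (hl' n) (hweak _ (hv n) ψ₀) ht).symm

end WellPosedness

/-! ### The threshold in the critical case 2α = β -/

theorem sixteen_mul_le {β : ℕ} (h : 4 ≤ β) : 16 * (2 * (β : ℝ) + 1) ≤ 9 * 2 ^ β := by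
  induction β, h using Nat.le_induction with
  | base => norm_num
  | succ n hn ih =>
    have : (4 : ℝ) ≤ n := by exact_mod_cast hn
    push_cast
    rw [pow_succ]
    linarith

theorem exists_stable_of_eq {α β : ℕ} (h : β ≤ 2 * α) (heq : 2 * α = β) :
    ∃ M : ℝ, (hermModel α β h).Stable M ∧ √((2 * (β : ℝ) + 1) * (2 : ℝ) ^ (-(β : ℤ))) ≤ M := by
  rw [zpow_neg, zpow_natCast, ← div_eq_mul_inv]
  rcases lt_or_ge α 2 with hα | hα
  -- The thresholds are 1 for β = 0 and √5/2 for β = 2, out of reach of the relative bound argument.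
  -- The commutator argument accepts any level, and 2 exceeds both.
  · refine ⟨2, ?_, Real.sqrt_le_iff.2 ⟨by norm_num, ?_⟩⟩
    · interval_cases α
      · obtain rfl : β = 0 := by omega
        exact stable_zero_zero h zero_le_two
      · obtain rfl : β = 2 := by omega
        exact stable_one_two h zero_le_two
    · interval_cases α <;> subst heq <;> norm_num
  -- For β ≥ 4 the squared threshold is at most 9/16, with equality at β = 4, so 3/4 < 1 works.
  · refine ⟨3 / 4, stable_of_eq h heq.symm (by norm_num) (by norm_num),
      Real.sqrt_le_iff.2 ⟨by norm_num, ?_⟩⟩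
    rw [div_le_iff₀ (by positivity)]
    have := sixteen_mul_le (β := β) (by omega)
    linarith

end Anharmonic

theorem mainTheorem9 (α β : ℕ) :
    (2 * α = β →
      Anharmonic.WellPosed α β
        {u | u ∈ Anharmonic.controls ∧
          eLpNorm u ⊤ (volume : Measure ℝ) <
            ENNReal.ofReal (Real.sqrt ((2 * (β : ℝ) + 1) * (2 : ℝ) ^ (-(β : ℤ))))}) ∧
    (β < 2 * α → Anharmonic.WellPosed α β Anharmonic.controls) := by
  refine ⟨fun h => ?_, fun h => ?_⟩
  · obtain ⟨M, hM, hle⟩ := Anharmonic.exists_stable_of_eq h.ge h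
    refine Anharmonic.wellPosed_of_stable (h := h.ge) (fun u hu => hu.1) fun u _ =>
      ⟨M, hM, fun v hv _ => ?_⟩
    have h1 : eLpNormEssSup v volume ≤ ENNReal.ofReal M := by
      rw [← eLpNorm_exponent_top]
      exact hv.2.le.trans (ENNReal.ofReal_le_ofReal hle)
    have h0 : 0 ≤ M := (Real.sqrt_nonneg _).trans hle
    filter_upwards [enorm_ae_le_eLpNormEssSup v volume] with t ht
    have h2 := ht.trans h1
    rwa [← ofReal_norm, ENNReal.ofReal_le_ofReal_iff h0] at h2
  -- The level is the total variation of u, which bounds every control of no larger variation.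
  · refine Anharmonic.wellPosed_of_stable (h := h.le) Subset.rfl fun u hu =>
      ⟨(eVariationOn u univ).toReal, Anharmonic.stable_of_lt h.le h ENNReal.toReal_nonneg,
        fun v hv hle => Eventually.of_forall fun t => ?_⟩
    exact (Anharmonic.controls_abs_le hv t).trans (ENNReal.toReal_mono hu.1 hle)
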